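/- Let $\mathfrak B=\mathfrak B^0\oplus\mathfrak B^1$ be a $\mathbb Z/2$-graded unital real algebra with a Hausdorff, sequentially complete, locally convex topology for which multiplication is jointly continuous. Let $R:\mathbb R\times\mathfrak B\to\mathfrak B$, $(\alpha,b)\mapsto R^\alpha b$, be a smooth one-parameter group of unital algebra automorphisms with $R^{2\pi}=1$ on $\mathfrak B^0$ and $R^{2\pi}=-1$ on $\mathfrak B^1$. A skew-periodic cocycle is a smooth $c:\mathbb R\to\mathfrak B^0$ with $c(\alpha+2\pi)=-c(\alpha)$, $c(0)=1$ and $c(\alpha)=c(\beta)\,R^\beta c(\alpha-\beta)$ for all $\alpha,\beta$. We consider generalized kernels $C(\eta,\beta)$ which are functions of $\eta$ and $2\pi$-periodic $\mathfrak B$-valued distributions in $\beta$, tested against smooth $2\pi$-periodic functions $f:\mathbb R\to\mathfrak B$ by $\int C(\eta,\beta)f(\beta)\frac{d\beta}{2\pi}$ over a period. Let $\delta(\beta)$ be the periodic delta function, $\int\delta(\beta)f(\beta)\frac{d\beta}{2\pi}=f(0)$, and let $h(\beta)=\mathrm{PV}\cot\frac\beta2$. Kernels are multiplied by $$(C_1*C_2)(\eta,\beta)=\int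 C_1(\eta,\gamma)\,C_2(\eta+\gamma,\beta-\gamma)\frac{d\gamma}{2\pi}.$$ The external rotations are $(R^\mu C)(\eta,\beta)=R^\mu(C(\eta,\beta))$ and the internal ones are $(\widehat R^\mu C)(\eta,\beta)=R^\mu(C(\eta-\mu,\beta))$. **Theorem.** To each skew-periodic cocycle $c$ and all $\theta,\alpha\in\mathbb R$ one can assign a kernel $K(c,\theta,\alpha)=K(c,\theta,\alpha,\eta,\beta)$ such that, for all skew-periodic cocycles $c$ and all real $\theta,\alpha,\sigma,\gamma$: (i) $K(c,\theta,\alpha,\eta,\beta)=\cos\frac\alpha2\,\delta(\beta)+\sin\frac\alpha2\,h(\beta)+S_c(\theta,\alpha,\eta,\beta)$, where $S_c:\mathbb R^4\to\mathfrak B^0$ is smooth and is $2\pi$-periodic in $\eta$ and in $\beta$. (ii) $K(c,\theta,\cdot)$ is a skew-periodic cocycle for the internal rotations: $K(c,\theta,\alpha+2\pi)=-K(c,\theta,\alpha)$, $K(c,\theta,0)=\delta$, and $K(c,\theta,\alpha)=K(c,\theta,\sigma)*\widehat R^\sigma K(c,\theta,\alpha-\sigma)$, that is $$K(c,\theta,\alpha,\eta,\beta)=\int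 K(c,\theta,\sigma,\eta,\gamma')\,R^\sigma K(c,\theta,\alpha-\sigma,\eta-\sigma+\gamma',\beta-\gamma')\frac{d\gamma'}{2\pi}.$$ (iii) $K(c,0,\alpha,\eta,\beta)=\cos\frac\alpha2\,\delta(\beta)+\sin\frac\alpha2\ \mathrm{PV}\operatorname{cosec}\frac\beta2\;R^\eta c(\beta)$. (iv) $K(c,\frac\pi2,\alpha,\eta,\beta)=\cos\frac\alpha2\,(\delta(\beta)-1)+\sin\frac\alpha2\,h(\beta)+c(\alpha)$. (v) If $c(\lambda)=\cos\frac\lambda2+G\sin\frac\lambda2$, where $G\in\mathfrak B^0$, $G^2=-1$ and $R^\mu G=G$ for all $\mu$, then $K(c,\theta,\alpha,\eta,\beta)=\cos\frac\alpha2\,\delta(\beta)+\sin\frac\alpha2\,(h(\beta)+G)$ for all $\theta$. (vi) $K(R^\gamma c,\theta,\alpha,\eta,\beta)=R^\gamma K(c,\theta,\alpha,\eta,\beta)$. -/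

import Mathlib

open Filter Topology

noncomputable section

namespace CircleCocycle

/-- Smooth (`C^∞`) maps between real topological vector spaces: all iterated directional derivatives
`d^k f (x; v₁, …, v_k)` exist and are jointly continuous in the point and the directions.  This is
the usual (Michal--Bastiani) calculus; on `ℝ^n` it says that all iterated partial derivatives exist
and are continuous. -/
def IsSmoothMap {E F : Type*} [AddCommGroup E] [Module ℝ E] [TopologicalSpace E]
    [AddCommGroup F] [Module ℝ F] [TopologicalSpace F] [ContinuousAdd F] [ContinuousSMul ℝ F]
    (f : E → F) : Prop :=
  ∃ D : (k : ℕ) → E → (Fin k → E) → F,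
    (∀ x v, D 0 x v = f x) ∧
    (∀ k, Continuous fun p : E × (Fin k → E) => D k p.1 p.2) ∧
    (∀ k x v w, HasDerivAt (fun t : ℝ => D k (x + t • w) v) (D (k + 1) x (Fin.cons w v)) 0)

variable {B : Type*} [Ring B] [Algebra ℝ B] [TopologicalSpace B] [IsTopologicalRing B]
  [ContinuousSMul ℝ B]

/-- A smooth one-parameter group of automorphisms of a `ℤ/2`-graded algebra `B = 𝒜 0 ⊕ 𝒜 1` which
is `2π`-periodic on `𝒜 0` and `2π`-skew-periodic on `𝒜 1`.  Smoothness means smoothness of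
the map `(α, b) ↦ R^α b`, `ℝ × B → B`.  (Invertibility of each `R^α`
follows from the group law.) -/
structure RotationAction (𝒜 : ZMod 2 → Submodule ℝ B) where
  toFun : ℝ → (B →ₐ[ℝ] B)
  map_zero : ∀ b, toFun 0 b = b
  map_add : ∀ s t b, toFun (s + t) b = toFun s (toFun t b)
  smooth : IsSmoothMap fun p : ℝ × B => toFun p.1 p.2
  periodic : ∀ b ∈ 𝒜 0, toFun (2 * Real.pi) b = b
  skewPeriodic : ∀ b ∈ 𝒜 1, toFun (2 * Real.pi) b = -b

instance (𝒜 : ZMod 2 → Submodule ℝ B) :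
    CoeFun (RotationAction 𝒜) (fun _ => ℝ → (B →ₐ[ℝ] B)) :=
  ⟨RotationAction.toFun⟩

/-- Skew-periodic cocycles with values in the even part `𝒜 0`. -/
structure IsSkewCocycle {𝒜 : ZMod 2 → Submodule ℝ B} (R : RotationAction 𝒜) (c : ℝ → B) :
    Prop where
  mem : ∀ α, c α ∈ 𝒜 0
  smooth : IsSmoothMap c
  skew : ∀ α, c (α + 2 * Real.pi) = -c α
  one : c 0 = 1
  cocycle : ∀ α β, c α = c β * R β (c (α - β))

/-- `v` is the weak integral of `F` over `[0, 2π]` with respect to `dβ / 2π`, taken as a Cauchy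
principal value at the endpoint `0 ≡ 2π`.  For a function that is continuous on `[0, 2π]` this is
the ordinary (vector-valued) integral `∫_0^{2π} F(β) dβ/2π`. -/
def IsCircleIntegral (F : ℝ → B) (v : B) : Prop :=
  ∀ l : B →L[ℝ] ℝ,
    Tendsto (fun ε : ℝ => (2 * Real.pi)⁻¹ * ∫ β in ε..(2 * Real.pi - ε), l (F β)) (𝓝[>] 0)
      (𝓝 (l v))

/-- The integral `∫ F(β) dβ/2π`, with principal value at `0 ≡ 2π`.  In a sequentially
complete Hausdorff locally convex space it exists and is unique if `F` is continuous, or if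
`F` is `cot (β/2)` times a smooth `2π`-periodic function or `cosec (β/2)` times a smooth
`2π`-skew-periodic function; it is only used for such `F`. -/
def circleIntegral (F : ℝ → B) : B :=
  Classical.epsilon (IsCircleIntegral F)

/-- Test functions: smooth `2π`-periodic functions with values in `B`. -/
structure IsTest (f : ℝ → B) : Prop where
  smooth : IsSmoothMap f
  periodic : ∀ β, f (β + 2 * Real.pi) = f β

/-- Generalized kernels `C(η, β)`: functions in `η`, distributions in `β`.  `C η f` is
the pairing `∫ C(η, β) f(β) dβ/2π`; only its values at test functions `f` matter, see `Kernel.Same`.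
The linear structure is pointwise. -/
abbrev Kernel (B : Type*) := ℝ → (ℝ → B) → B

namespace Kernel

/-- Equality of kernels as distributions in `β`, for every `η`. -/
def Same (C₁ C₂ : Kernel B) : Prop :=
  ∀ (η : ℝ) (f : ℝ → B), IsTest f → C₁ η f = C₂ η f

/-- The kernel given by a function `S(η, β)` (as a principal value if `S` has a pole at `β ∈ 2πℤ`). -/
def ofFun (S : ℝ → ℝ → B) : Kernel B :=
  fun η f => circleIntegral fun β => S η β * f β

/-- The periodic delta function `δ(β)`, of total mass `1` with respect to `dβ/2π` on a period. -/
def delta : Kernel B := fun _ f => f 0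

/-- The periodic principal value `PV cot (β/2)`. -/
def hilbert : Kernel B :=
  ofFun fun _ β => (Real.cos (β / 2) / Real.sin (β / 2)) • (1 : B)

/-- `(C₁ * C₂)(η, β) = ∫ C₁(η, γ) C₂(η + γ, β - γ) dγ/2π`, written in terms of the pairings:
`∫∫ C₁(η, γ) C₂(η + γ, β) f(β + γ) dβ/2π dγ/2π`. -/
def conv (C₁ C₂ : Kernel B) : Kernel B :=
  fun η f => C₁ η fun γ => C₂ (η + γ) fun β => f (β + γ)

variable {𝒜 : ZMod 2 → Submodule ℝ B}

/-- External rotation `(R^μ C)(η, β) = R^μ (C(η, β))`; in terms of the pairings,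
`∫ R^μ(C(η, β)) f(β) = R^μ (∫ C(η, β) R^{-μ}(f(β)))`. -/
def extRot (R : RotationAction 𝒜) (μ : ℝ) (C : Kernel B) : Kernel B :=
  fun η f => R μ (C η fun β => R (-μ) (f β))

/-- Internal rotation `(R̂^μ C)(η, β) = R^μ (C(η - μ, β))`. -/
def intRot (R : RotationAction 𝒜) (μ : ℝ) (C : Kernel B) : Kernel B :=
  fun η f => extRot R μ C (η - μ) f

/-- The kernel `PV cosec (β/2) · R^η (c(β))`. -/
def bott (R : RotationAction 𝒜) (c : ℝ → B) : Kernel B :=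
  ofFun fun η β => (Real.sin (β / 2))⁻¹ • R η (c β)

end Kernel

/-- Families `S(θ, α, η, β)` of smooth `𝒜 0`-valued kernels, `2π`-periodic in `η` and in `β`,
depending smoothly on `(θ, α, η, β)`. -/
structure IsSmoothKernelFamily (𝒜 : ZMod 2 → Submodule ℝ B) (S : ℝ → ℝ → ℝ → ℝ → B) : Prop where
  mem : ∀ θ α η β, S θ α η β ∈ 𝒜 0
  smooth : IsSmoothMap fun p : ℝ × ℝ × ℝ × ℝ => S p.1 p.2.1 p.2.2.1 p.2.2.2
  periodic_left : ∀ θ α η β, S θ α (η + 2 * Real.pi) β = S θ α η β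
  periodic_right : ∀ θ α η β, S θ α η (β + 2 * Real.pi) = S θ α η β

end CircleCocycle

end

open Filter Topology

noncomputable section

namespace CircleCocycle

open Real Set MeasureTheory
open scoped ContDiff

set_option linter.unusedSectionVars false

/-! ### Smooth dependence on parameters: integrals, divided differences, the Hilbert transform. -/

section Smoothness

section ParametricIntegrals

variable {E F : Type*} [NormedAddCommGroup E] [NormedSpace ℝ E] [FiniteDimensional ℝ E]
  [NormedAddCommGroup F] [NormedSpace ℝ F] [CompleteSpace F]

/-! A kernel C(η, β) is read as the operator F ↦ ∫ C(x, y - x) F(y) dy/2π. Then `conv` is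
composition, and `intRot` is conjugation by R^σ combined with translation by σ. Since R^x c(y - x) =
cos((y - x)/2) + sin((y - x)/2) Δ(x, y) with Δ smooth and doubly periodic (`cocycleQuot`), the
kernel required at θ = 0 is cos(α/2) + sin(α/2) J, where J = H + Δ (`bottOp`) and H is the periodic
Hilbert transform. The cocycle relation gives c(x) (cot((y - x)/2) + Δ(x, y)) = cosec((y - x)/2)
c(y). So c conjugates J to the scalar cosecant transform, and J inherits a Tricomi identity: J(b JG
+ (Hb) G) = (Hb) JG - b G for real periodic b (`bottOp_tricomi`). For b = 1 this is J² = -1.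

On θ < π/4 a radius r < 1 is introduced, with Poisson kernel P and conjugate kernel Q. The Tricomi
identity for multiples of translates of P, together with the addition formulas of P and Q, shows
that the operators cos(α/2) + sin(α/2) (Q(· - α) + J P(· - α)) still satisfy a cocycle law
(`rotOp_rotOp`). Their singular part is wrong, and conjugation repairs it. Let L_α be `outer r α`;
on Fourier modes it is 1 - r times a shift by one step towards the mode 0, with a phase depending on
α. By `outer_rotation`, L_0 (cos(α/2) + sin(α/2) H) equals the above operator with H in place of J,
followed on the right by L_α. Hence L_0⁻¹ (the operator above) L_α = cos(α/2) + sin(α/2) H +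
sin(α/2) L_0⁻¹ Δ P(· - α) L_α, and the last term has a smooth kernel (`kernelOne`,
`outer_kernelOp`). The factors L_0⁻¹ and L_α cancel in products, which gives the law (ii)
(`kernelOp_add_of_lt`).

The smooth term can be written with averages against P_r. The r-derivative of such an average is
again such an average, and averages tend to evaluation at 0 as r → 1, so everything extends smoothly
to r = 1 (`contDiff_poissonMean`). There the smooth term has become a function ω_α(x) independent of
y. Operators of this shape compose by an explicit formula, which is respected by replacing ω with (1
- τ) ω + τ mean ω (`affineComp_interpolate`). This is the deformation on θ ≥ π/4, and its end point
is right because mean ω_α = sin(α/2) Δ(0, α) = c(α) - cos(α/2).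

Values in the algebra are handled through continuous functionals: all formulas are proved for
scalars, and sequential completeness supplies vectors representing the results. The construction is
linear in Δ and commutes with continuous linear maps, which gives equivariance and evenness. A
linear cocycle has constant Δ = G, which the deformation leaves unchanged. -/

theorem hasFDerivAt_intervalIntegral_of_contDiff {φ : E × ℝ → F} (hφ : ContDiff ℝ 1 φ) (a b : ℝ)
    (p : E) :
    HasFDerivAt (fun p => ∫ u in a..b, φ (p, u))
      (∫ u in a..b, (fderiv ℝ φ (p, u)).comp (ContinuousLinearMap.inl ℝ E ℝ)) p := by
  have hproper : ProperSpace E := FiniteDimensional.proper_real E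
  have hc : Continuous fun q : E × ℝ =>
      (fderiv ℝ φ q).comp (ContinuousLinearMap.inl ℝ E ℝ) :=
    (hφ.continuous_fderiv one_ne_zero).clm_comp continuous_const
  obtain ⟨C, hC⟩ := ((isCompact_closedBall p 1).prod (isCompact_uIcc (a := a) (b := b))).exists_bound_of_continuousOn
    hc.continuousOn
  refine intervalIntegral.hasFDerivAt_integral_of_dominated_of_fderiv_le
    (F := fun p u => φ (p, u)) (F' := fun p u => (fderiv ℝ φ (p, u)).comp (ContinuousLinearMap.inl ℝ E ℝ))
    (s := Metric.closedBall p 1) (bound := fun _ => C)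
    (Metric.closedBall_mem_nhds p one_pos) ?_ ?_ ?_ ?_ ?_ ?_
  · exact Eventually.of_forall fun x =>
      (hφ.continuous.comp (by fun_prop : Continuous fun u => (x, u))).aestronglyMeasurable
  · exact (hφ.continuous.comp (by fun_prop : Continuous fun u => (p, u))).intervalIntegrable _ _
  · exact (hc.comp (by fun_prop : Continuous fun u => (p, u))).aestronglyMeasurable
  · exact Eventually.of_forall fun t ht x hx => hC (x, t) ⟨hx, uIoc_subset_uIcc ht⟩
  · exact intervalIntegrable_const
  · refine Eventually.of_forall fun t _ x _ => ?_
    exact ((hφ.differentiable one_ne_zero (x, t)).hasFDerivAt).comp x (hasFDerivAt_prodMk_left x t)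

/-- Induction on the order. In finite dimensions it is enough to control the derivative in each
fixed direction, and that is an integral of the same kind. -/
theorem contDiff_intervalIntegral {φ : E × ℝ → F} (hφ : ContDiff ℝ ∞ φ) (a b : ℝ) :
    ContDiff ℝ ∞ fun p => ∫ u in a..b, φ (p, u) := by
  rw [contDiff_infty]
  intro n
  induction n generalizing φ with
  | zero =>
    exact contDiff_zero.2 (continuous_iff_continuousAt.2 fun p =>
      (hasFDerivAt_intervalIntegral_of_contDiff (hφ.of_le (by simp)) a b p).continuousAt)
  | succ n ih =>
    have h1 : ContDiff ℝ 1 φ := hφ.of_le (by simp)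
    have hd := hasFDerivAt_intervalIntegral_of_contDiff h1 a b
    push_cast
    rw [contDiff_succ_iff_fderiv_apply]
    refine ⟨fun p => (hd p).differentiableAt, by simp, fun y => ?_⟩
    have h2 : ContDiff ℝ ∞ fun q : E × ℝ => fderiv ℝ φ q (y, 0) :=
      (hφ.fderiv_right (m := ∞) (by simp)).clm_apply contDiff_const
    convert ih h2 using 2 with p
    rw [(hd p).fderiv, ContinuousLinearMap.intervalIntegral_apply]
    · rfl
    · refine Continuous.intervalIntegrable ?_ _ _
      exact ((h1.continuous_fderiv one_ne_zero).comp
        (by fun_prop : Continuous fun u => (p, u))).clm_comp continuous_const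

end ParametricIntegrals

section Quotient

variable {F : Type*} [NormedAddCommGroup F] [NormedSpace ℝ F]

/-- The difference quotient `(f a - f b) / sin ((a - b) / 2)`, extended to the diagonal. -/
def quot (f : ℝ → F) (a b : ℝ) : F :=
  if sin ((a - b) / 2) = 0 then (2 * cos ((a - b) / 2)) • deriv f a
  else (sin ((a - b) / 2))⁻¹ • (f a - f b)

theorem periodic_of_sin_half_eq_zero {X : Type*} {f : ℝ → X} (hf : Function.Periodic f (2 * π)) {a b : ℝ}
    (h : sin ((a - b) / 2) = 0) : f a = f b := by
  obtain ⟨n, hn⟩ := sin_eq_zero_iff.1 h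
  have : a = b + n * (2 * π) := by linarith
  rw [this]
  simpa using (hf.int_mul n) b

/-- On the zero set of the sine both sides vanish, because there a and b differ by a multiple of the
period. -/
theorem sin_smul_quot {f : ℝ → F} (hf : Function.Periodic f (2 * π)) (a b : ℝ) :
    sin ((a - b) / 2) • quot f a b = f a - f b := by
  unfold quot
  split_ifs with h
  · rw [h, periodic_of_sin_half_eq_zero hf h]; simp
  · rw [smul_smul, mul_inv_cancel₀ h, one_smul]

theorem periodic_deriv {f : ℝ → F} {T : ℝ} (hf : Function.Periodic f T) :
    Function.Periodic (deriv f) T := by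
  intro x
  have h : (fun y => f (y + T)) = f := funext hf
  rw [← deriv_comp_add_const, h]

theorem quot_add_left {f : ℝ → F} (hf : Function.Periodic f (2 * π)) (a b : ℝ) :
    quot f (a + 2 * π) b = -quot f a b := by
  have h1 : (a + 2 * π - b) / 2 = (a - b) / 2 + π := by ring
  unfold quot
  rw [h1, sin_add_pi, cos_add_pi, periodic_deriv hf a, hf a]
  by_cases h : sin ((a - b) / 2) = 0
  · simp [h]
  · simp [h, inv_neg]

theorem quot_add_right {f : ℝ → F} (hf : Function.Periodic f (2 * π)) (a b : ℝ) :
    quot f a (b + 2 * π) = -quot f a b := by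
  have h1 : (a - (b + 2 * π)) / 2 = (a - b) / 2 - π := by ring
  unfold quot
  rw [h1, sin_sub_pi, cos_sub_pi, hf b]
  by_cases h : sin ((a - b) / 2) = 0
  · simp [h]
  · simp [h, inv_neg]

theorem quot_add_both {f : ℝ → F} (hf : Function.Periodic f (2 * π)) (a b : ℝ) :
    quot f (a + 2 * π) (b + 2 * π) = quot f a b := by
  rw [quot_add_left hf, quot_add_right hf, neg_neg]

theorem quot_comp_add (f : ℝ → F) (a b s : ℝ) :
    quot (fun x => f (x + s)) a b = quot f (a + s) (b + s) := by
  unfold quot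
  rw [deriv_comp_add_const]
  simp

end Quotient

/-- The mean value over the circle. -/
def mean {F : Type*} [NormedAddCommGroup F] [NormedSpace ℝ F] (f : ℝ → F) : F :=
  (2 * π)⁻¹ • ∫ u in (0 : ℝ)..(2 * π), f u

/-- The periodic Hilbert transform, with kernel `cot (u / 2)`. -/
def hilb {F : Type*} [NormedAddCommGroup F] [NormedSpace ℝ F] (f : ℝ → F) (x : ℝ) : F :=
  mean fun u => cos (u / 2) • quot f (x + u) x

section Smoothness

variable {E F : Type*} [NormedAddCommGroup E] [NormedSpace ℝ E] [FiniteDimensional ℝ E]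
  [NormedAddCommGroup F] [NormedSpace ℝ F] [CompleteSpace F]

theorem contDiff_mean {φ : E × ℝ → F} (hφ : ContDiff ℝ ∞ φ) :
    ContDiff ℝ ∞ fun p => mean fun u => φ (p, u) :=
  (contDiff_intervalIntegral hφ 0 (2 * π)).const_smul _

theorem sub_eq_smul_integral_deriv {f : ℝ → F} (hf : ContDiff ℝ 1 f) (a b : ℝ) :
    f a - f b = (a - b) • ∫ t in (0 : ℝ)..1, deriv f (b + t * (a - b)) := by
  have h : ∀ t ∈ uIcc (0 : ℝ) 1, HasDerivAt (fun t : ℝ => f (b + t * (a - b)))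
      ((a - b) • deriv f (b + t * (a - b))) t := by
    intro t _
    have h1 : HasDerivAt (fun t : ℝ => b + t * (a - b)) (a - b) t := by
      simpa using ((hasDerivAt_id t).mul_const (a - b)).const_add b
    exact ((hf.differentiable one_ne_zero _).hasDerivAt).scomp t h1
  have hc : Continuous fun t : ℝ => (a - b) • deriv f (b + t * (a - b)) :=
    ((hf.continuous_deriv le_rfl).comp (by fun_prop)).const_smul _
  have := intervalIntegral.integral_eq_sub_of_hasDerivAt h (hc.intervalIntegrable _ _)
  rw [intervalIntegral.integral_smul] at this
  rw [this]; simp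

/-- A smooth function that equals `sin (s / 2) / s` off `0`. -/
def sincHalf (s : ℝ) : ℝ := ∫ t in (0 : ℝ)..1, cos (t * s / 2) / 2

theorem contDiff_sincHalf : ContDiff ℝ ∞ sincHalf := by
  have : ContDiff ℝ ∞ fun q : ℝ × ℝ => cos (q.2 * q.1 / 2) / 2 := by fun_prop
  exact contDiff_intervalIntegral this 0 1

theorem mul_sincHalf (s : ℝ) : s * sincHalf s = sin (s / 2) := by
  have h := sub_eq_smul_integral_deriv (f := fun x : ℝ => sin (x / 2)) (by fun_prop) s 0
  have hd : deriv (fun x : ℝ => sin (x / 2)) = fun x => cos (x / 2) / 2 := by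
    funext x
    have : HasDerivAt (fun x : ℝ => sin (x / 2)) (cos (x / 2) * (1 / 2)) x :=
      ((hasDerivAt_id x).div_const 2).sin
    rw [this.deriv]; ring
  rw [hd] at h
  simp only [sub_zero, zero_div, sin_zero, zero_add, smul_eq_mul] at h
  rw [h]; rfl

/-- In this range sin(s/2) vanishes only at s = 0, where the integral has the value 1/2. -/
theorem sincHalf_ne_zero {s : ℝ} (hs : |s| < 2 * π) : sincHalf s ≠ 0 := by
  intro h
  have h1 : sin (s / 2) = 0 := by rw [← mul_sincHalf, h, mul_zero]
  rw [abs_lt] at hs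
  have h2 : s / 2 = 0 := by
    refine (sin_eq_zero_iff_of_lt_of_lt ?_ ?_).1 h1 <;> linarith
  have h3 : s = 0 := by linarith
  rw [h3] at h
  norm_num [sincHalf] at h

theorem contDiff_deriv_snd {φ : E × ℝ → F} (hφ : ContDiff ℝ ∞ φ) :
    ContDiff ℝ ∞ fun q : E × ℝ => deriv (fun u => φ (q.1, u)) q.2 := by
  have h : ∀ q : E × ℝ, deriv (fun u => φ (q.1, u)) q.2 = fderiv ℝ φ q (0, 1) := by
    intro q
    have h1 : HasFDerivAt φ (fderiv ℝ φ q) (q.1, q.2) :=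
      (hφ.differentiable (by simp) q).hasFDerivAt
    have h2 : HasDerivAt (fun u : ℝ => (q.1, u)) ((0 : E), (1 : ℝ)) q.2 :=
      (hasDerivAt_const _ _).prodMk (hasDerivAt_id _)
    exact (h1.comp_hasDerivAt q.2 h2).deriv
  simp_rw [h]
  exact (hφ.fderiv_right (m := ∞) (by simp)).clm_apply contDiff_const

/-- In the strip |a - b| < 2π numerator and denominator are both divided by a - b, in the manner of
Hadamard, which leaves a smooth numerator over the nonvanishing `sincHalf`. Skew-periodicity in a
moves every point into this strip. -/
theorem contDiff_quot {φ : E × ℝ → F} (hφ : ContDiff ℝ ∞ φ)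
    (hper : ∀ p, Function.Periodic (fun u => φ (p, u)) (2 * π)) :
    ContDiff ℝ ∞ fun q : E × ℝ × ℝ => quot (fun u => φ (q.1, u)) q.2.1 q.2.2 := by
  set W : E × ℝ × ℝ → F := fun q => quot (fun u => φ (q.1, u)) q.2.1 q.2.2 with hW
  have hφp : ∀ p, ContDiff ℝ ∞ fun u => φ (p, u) := fun p => hφ.comp (by fun_prop)
  have hd := contDiff_deriv_snd hφ
  set J : E × ℝ × ℝ → F := fun q =>
    ∫ t in (0 : ℝ)..1, deriv (fun u => φ (q.1, u)) (q.2.2 + t * (q.2.1 - q.2.2)) with hJ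
  have hJs : ContDiff ℝ ∞ J := by
    have : ContDiff ℝ ∞ fun s : (E × ℝ × ℝ) × ℝ =>
        deriv (fun u => φ (s.1.1, u)) (s.1.2.2 + s.2 * (s.1.2.1 - s.1.2.2)) :=
      hd.comp (f := fun s : (E × ℝ × ℝ) × ℝ => (s.1.1, s.1.2.2 + s.2 * (s.1.2.1 - s.1.2.2)))
        (by fun_prop)
    exact contDiff_intervalIntegral this 0 1
  have hloc : ∀ q : E × ℝ × ℝ, |q.2.1 - q.2.2| < 2 * π → W q = (sincHalf (q.2.1 - q.2.2))⁻¹ • J q := by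
    intro q hq
    have hne := sincHalf_ne_zero hq
    simp only [hW, quot]
    split_ifs with h
    · have h0 : (q.2.1 - q.2.2) / 2 = 0 := by
        rw [abs_lt] at hq
        refine (sin_eq_zero_iff_of_lt_of_lt ?_ ?_).1 h <;> linarith
      have h1 : q.2.1 - q.2.2 = 0 := by linarith
      have h2 : q.2.1 = q.2.2 := by linarith
      simp only [hJ, h2]
      norm_num [sincHalf]
    · rw [sub_eq_smul_integral_deriv ((hφp q.1).of_le (by simp)), ← mul_sincHalf, mul_inv,
        smul_smul]
      have h1 : q.2.1 - q.2.2 ≠ 0 := by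
        intro h0; apply h; rw [h0]; simp
      congr 1
      field_simp
  have hat : ∀ q : E × ℝ × ℝ, |q.2.1 - q.2.2| < 2 * π → ContDiffAt ℝ ∞ W q := by
    intro q hq
    have hev : ∀ᶠ q' : E × ℝ × ℝ in 𝓝 q, |q'.2.1 - q'.2.2| < 2 * π :=
      (isOpen_lt (by fun_prop : Continuous fun q' : E × ℝ × ℝ => |q'.2.1 - q'.2.2|)
        continuous_const).mem_nhds hq
    refine ContDiffAt.congr_of_eventuallyEq ?_ (hev.mono hloc)
    refine ContDiffAt.smul (ContDiffAt.inv ?_ (sincHalf_ne_zero hq)) hJs.contDiffAt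
    exact (contDiff_sincHalf.comp (by fun_prop : ContDiff ℝ ∞ fun q : E × ℝ × ℝ => q.2.1 - q.2.2)).contDiffAt
  have hshift : ∀ (n : ℕ) (q : E × ℝ × ℝ),
      W (q.1, q.2.1 + n * (2 * π), q.2.2) = (-1 : ℝ) ^ n • W q := by
    intro n
    induction n with
    | zero => intro q; simp
    | succ n ih =>
      intro q
      have : q.2.1 + ((n + 1 : ℕ) : ℝ) * (2 * π) = (q.2.1 + n * (2 * π)) + 2 * π := by
        push_cast; ring
      rw [this]
      simp only [hW] at ih ⊢
      rw [quot_add_left (hper q.1), ih q, pow_succ]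
      simp
  have hshift' : ∀ (n : ℤ) (q : E × ℝ × ℝ), ∃ c : ℝ,
      ∀ q, W q = c • W (q.1, q.2.1 + n * (2 * π), q.2.2) := by
    intro n q
    obtain ⟨k, rfl | rfl⟩ := n.eq_nat_or_neg
    · refine ⟨(-1) ^ k, fun q => ?_⟩
      have := hshift k q
      push_cast
      rw [this, smul_smul, ← mul_pow]; simp
    · refine ⟨(-1) ^ k, fun q => ?_⟩
      have := hshift k (q.1, q.2.1 + -k * (2 * π), q.2.2)
      push_cast
      rw [← this]
      congr 1
      ext <;> simp
  refine contDiff_iff_contDiffAt.2 fun q => ?_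
  -- Rounding brings a - b to absolute value at most π, safely inside the strip.
  set n : ℤ := -round ((q.2.1 - q.2.2) / (2 * π)) with hn
  have hlt : |q.2.1 + n * (2 * π) - q.2.2| < 2 * π := by
    have h1 := abs_sub_round ((q.2.1 - q.2.2) / (2 * π))
    have h2 : q.2.1 + n * (2 * π) - q.2.2 =
        ((q.2.1 - q.2.2) / (2 * π) - round ((q.2.1 - q.2.2) / (2 * π))) * (2 * π) := by
      rw [hn]; push_cast; field_simp; ring
    rw [h2, abs_mul, abs_of_pos two_pi_pos]
    nlinarith [two_pi_pos]
  obtain ⟨c, hc⟩ := hshift' n q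
  have h3 : ContDiffAt ℝ ∞ (fun q : E × ℝ × ℝ => c • W (q.1, q.2.1 + n * (2 * π), q.2.2)) q := by
    refine ContDiffAt.const_smul c ?_
    exact ContDiffAt.comp q (g := W) (f := fun q : E × ℝ × ℝ => (q.1, q.2.1 + n * (2 * π), q.2.2))
      (hat _ hlt) (by fun_prop)
  exact h3.congr_of_eventuallyEq (Eventually.of_forall hc)

theorem contDiff_hilb {φ : E × ℝ → F} (hφ : ContDiff ℝ ∞ φ)
    (hper : ∀ p, Function.Periodic (fun u => φ (p, u)) (2 * π)) :
    ContDiff ℝ ∞ fun q : E × ℝ => hilb (fun u => φ (q.1, u)) q.2 := by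
  have h : ContDiff ℝ ∞ fun s : (E × ℝ) × ℝ =>
      cos (s.2 / 2) • quot (fun u => φ (s.1.1, u)) (s.1.2 + s.2) s.1.2 := by
    refine ContDiff.smul (by fun_prop) ?_
    exact (contDiff_quot hφ hper).comp
      (f := fun s : (E × ℝ) × ℝ => (s.1.1, s.1.2 + s.2, s.1.2)) (by fun_prop)
  exact contDiff_mean h

theorem periodic_hilb {f : ℝ → F} (hf : Function.Periodic f (2 * π)) :
    Function.Periodic (hilb f) (2 * π) := by
  intro x
  unfold hilb
  congr 1; funext u
  rw [show x + 2 * π + u = (x + u) + 2 * π by ring, quot_add_both hf]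

end Smoothness

end Smoothness

/-! ### Circle means, elementary properties of the Hilbert transform, and its action on characters.
-/

section HilbertTransform

section Mean

variable {F : Type*} [NormedAddCommGroup F] [NormedSpace ℝ F]

/-- Smooth `2π`-periodic functions with values in a normed space. -/
structure SmoothPer (f : ℝ → F) : Prop where
  smooth : ContDiff ℝ ∞ f
  periodic : Function.Periodic f (2 * π)

theorem SmoothPer.continuous {f : ℝ → F} (hf : SmoothPer f) : Continuous f := hf.smooth.continuous

theorem SmoothPer.add {f g : ℝ → F} (hf : SmoothPer f) (hg : SmoothPer g) :
    SmoothPer fun x => f x + g x :=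
  ⟨hf.smooth.add hg.smooth, fun x => by simp only [hf.periodic x, hg.periodic x]⟩

theorem SmoothPer.sub {f g : ℝ → F} (hf : SmoothPer f) (hg : SmoothPer g) :
    SmoothPer fun x => f x - g x :=
  ⟨hf.smooth.sub hg.smooth, fun x => by simp only [hf.periodic x, hg.periodic x]⟩

theorem SmoothPer.neg {f : ℝ → F} (hf : SmoothPer f) : SmoothPer fun x => -f x :=
  ⟨hf.smooth.neg, fun x => by simp only [hf.periodic x]⟩

theorem SmoothPer.mul {A : Type*} [NormedRing A] [NormedAlgebra ℝ A] {f g : ℝ → A}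
    (hf : SmoothPer f) (hg : SmoothPer g) : SmoothPer fun x => f x * g x :=
  ⟨hf.smooth.mul hg.smooth, fun x => by simp only [hf.periodic x, hg.periodic x]⟩

theorem SmoothPer.const (c : F) : SmoothPer fun _ : ℝ => c := ⟨contDiff_const, fun _ => rfl⟩

theorem SmoothPer.hilb [CompleteSpace F] {f : ℝ → F} (hf : SmoothPer f) : SmoothPer (hilb f) := by
  refine ⟨?_, periodic_hilb hf.periodic⟩
  exact (contDiff_hilb (E := ℝ) (φ := fun q : ℝ × ℝ => f q.2) (hf.smooth.comp contDiff_snd)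
    fun _ => hf.periodic).comp (f := fun x : ℝ => ((0 : ℝ), x)) (by fun_prop)

theorem SmoothPer.comp_add {f : ℝ → F} (hf : SmoothPer f) (s : ℝ) :
    SmoothPer fun x => f (x + s) :=
  ⟨hf.smooth.comp (by fun_prop), fun x => by
    rw [show x + 2 * π + s = x + s + 2 * π by ring, hf.periodic]⟩

theorem SmoothPer.comp_sub {f : ℝ → F} (hf : SmoothPer f) (s : ℝ) :
    SmoothPer fun x => f (x - s) := by
  simpa [sub_eq_add_neg] using hf.comp_add (-s)

theorem smoothPer_cos : SmoothPer cos := ⟨contDiff_cos, cos_periodic⟩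

theorem smoothPer_sin : SmoothPer sin := ⟨contDiff_sin, sin_periodic⟩

theorem SmoothPer.ofReal {f : ℝ → ℝ} (hf : SmoothPer f) : SmoothPer fun x => (f x : ℂ) :=
  ⟨Complex.ofRealCLM.contDiff.comp hf.smooth, fun x => by simp only [hf.periodic x]⟩

/-- Only the open interval matters, and there sin(u/2) > 0, so divided differences may be replaced
by honest quotients. -/
theorem mean_congr {f g : ℝ → F} (h : ∀ u ∈ Ioo 0 (2 * π), f u = g u) : mean f = mean g := by
  unfold mean
  congr 1
  rw [intervalIntegral.integral_of_le two_pi_pos.le, intervalIntegral.integral_of_le two_pi_pos.le,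
    integral_Ioc_eq_integral_Ioo, integral_Ioc_eq_integral_Ioo]
  exact setIntegral_congr_fun measurableSet_Ioo h

theorem mean_add {f g : ℝ → F} (hf : Continuous f) (hg : Continuous g) :
    mean (fun u => f u + g u) = mean f + mean g := by
  unfold mean
  rw [intervalIntegral.integral_add (hf.intervalIntegrable _ _) (hg.intervalIntegrable _ _),
    smul_add]

theorem mean_sub {f g : ℝ → F} (hf : Continuous f) (hg : Continuous g) :
    mean (fun u => f u - g u) = mean f - mean g := by
  unfold mean
  rw [intervalIntegral.integral_sub (hf.intervalIntegrable _ _) (hg.intervalIntegrable _ _),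
    smul_sub]

theorem mean_neg (f : ℝ → F) : mean (fun u => -f u) = -mean f := by
  unfold mean
  rw [intervalIntegral.integral_neg, smul_neg]

theorem mean_smul (c : ℝ) (f : ℝ → F) : mean (fun u => c • f u) = c • mean f := by
  unfold mean
  rw [intervalIntegral.integral_smul, smul_comm]

theorem mean_const [CompleteSpace F] (c : F) : mean (fun _ => c) = c := by
  unfold mean
  rw [intervalIntegral.integral_const, smul_smul, sub_zero,
    inv_mul_cancel₀ two_pi_pos.ne', one_smul]

theorem mean_mul_left {𝕜 : Type*} [RCLike 𝕜] (c : 𝕜) (f : ℝ → 𝕜) :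
    mean (fun u => c * f u) = c * mean f := by
  unfold mean
  rw [intervalIntegral.integral_const_mul, mul_smul_comm]

theorem mean_mul_right {𝕜 : Type*} [RCLike 𝕜] (c : 𝕜) (f : ℝ → 𝕜) :
    mean (fun u => f u * c) = mean f * c := by
  unfold mean
  rw [intervalIntegral.integral_mul_const, smul_mul_assoc]

theorem mean_comp_two_pi_sub (f : ℝ → F) : mean (fun u => f (2 * π - u)) = mean f := by
  unfold mean
  rw [intervalIntegral.integral_comp_sub_left]
  simp

theorem mean_comp_add {f : ℝ → F} (hf : Function.Periodic f (2 * π)) (s : ℝ) :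
    mean (fun u => f (u + s)) = mean f := by
  unfold mean
  rw [intervalIntegral.integral_comp_add_right]
  congr 1
  rw [zero_add, add_comm]
  simpa using hf.intervalIntegral_add_eq s 0

theorem mean_ofReal (f : ℝ → ℝ) : mean (fun u => (f u : ℂ)) = (mean f : ℝ) := by
  unfold mean
  rw [intervalIntegral.integral_ofReal]
  simp

theorem mean_swap [CompleteSpace F] {f : ℝ × ℝ → F} (hf : Continuous f) :
    mean (fun x => mean fun y => f (x, y)) = mean fun y => mean fun x => f (x, y) := by
  unfold mean
  simp only [intervalIntegral.integral_smul]
  congr 2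
  simp only [intervalIntegral.integral_of_le two_pi_pos.le]
  refine integral_integral_swap ?_
  rw [Measure.prod_restrict]
  exact (hf.continuousOn.integrableOn_compact (isCompact_Icc.prod isCompact_Icc)).mono_set
    (prod_mono Ioc_subset_Icc_self Ioc_subset_Icc_self)

theorem continuous_mean [CompleteSpace F] {X : Type*} [TopologicalSpace X] {f : X × ℝ → F}
    (hf : Continuous f) : Continuous fun x => mean fun u => f (x, u) := by
  unfold mean
  exact (intervalIntegral.continuous_parametric_intervalIntegral_of_continuous' (f := fun x u => f (x, u)) hf 0 (2 * π)).const_smul _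

end Mean

theorem sin_half_pos {u : ℝ} (hu : u ∈ Ioo 0 (2 * π)) : 0 < sin (u / 2) :=
  sin_pos_of_pos_of_lt_pi (by linarith [hu.1]) (by linarith [hu.2])

section HilbertBasic

variable {F : Type*} [NormedAddCommGroup F] [NormedSpace ℝ F] [CompleteSpace F]

/-- Subtracting f x does not change the principal value, since cot(u/2) is odd about π. -/
theorem hilb_eq_mean_cot {f : ℝ → F} (hf : Function.Periodic f (2 * π)) (x : ℝ) :
    hilb f x = mean fun u => (cos (u / 2) / sin (u / 2)) • (f (x + u) - f x) := by
  refine mean_congr fun u hu => ?_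
  have h := sin_smul_quot hf (x + u) x
  rw [add_sub_cancel_left] at h
  rw [← h, smul_smul, div_mul_cancel₀ _ (sin_half_pos hu).ne']

theorem continuous_quot {f : ℝ → F} (hf : SmoothPer f) :
    Continuous fun q : ℝ × ℝ => quot f q.1 q.2 := by
  have := (contDiff_quot (E := ℝ) (φ := fun q : ℝ × ℝ => f q.2) (hf.smooth.comp contDiff_snd)
    fun _ => hf.periodic).continuous
  exact this.comp (f := fun q : ℝ × ℝ => ((0 : ℝ), q.1, q.2)) (by fun_prop)

theorem continuous_quot_shift {f : ℝ → F} (hf : SmoothPer f) :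
    Continuous fun q : ℝ × ℝ => quot f (q.1 + q.2) q.1 :=
  (continuous_quot hf).comp (f := fun q : ℝ × ℝ => (q.1 + q.2, q.1)) (by fun_prop)

theorem continuous_hilb_integrand_right {f : ℝ → F} (hf : SmoothPer f) (x : ℝ) :
    Continuous fun u : ℝ => cos (u / 2) • quot f (x + u) x :=
  Continuous.smul (by fun_prop)
    ((continuous_quot_shift hf).comp (f := fun u : ℝ => (x, u)) (by fun_prop))

theorem hilb_add {f g : ℝ → F} (hf : SmoothPer f) (hg : SmoothPer g) (x : ℝ) :
    hilb (fun x => f x + g x) x = hilb f x + hilb g x := by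
  unfold hilb
  rw [← mean_add (continuous_hilb_integrand_right hf x) (continuous_hilb_integrand_right hg x)]
  refine mean_congr fun u hu => ?_
  have hne := (sin_half_pos hu).ne'
  simp only [quot, add_sub_cancel_left, if_neg hne, ← smul_add]
  congr 2
  abel

theorem hilb_smul (c : ℝ) {f : ℝ → F} (x : ℝ) :
    hilb (fun x => c • f x) x = c • hilb f x := by
  unfold hilb
  rw [← mean_smul]
  refine mean_congr fun u hu => ?_
  have hne := (sin_half_pos hu).ne'
  simp only [quot, add_sub_cancel_left, if_neg hne, ← smul_sub]
  module

theorem hilb_mul_left {𝕜 : Type*} [RCLike 𝕜] (c : 𝕜) {f : ℝ → 𝕜} (x : ℝ) :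
    hilb (fun x => c * f x) x = c * hilb f x := by
  unfold hilb
  rw [← mean_mul_left]
  refine mean_congr fun u hu => ?_
  have hne := (sin_half_pos hu).ne'
  simp only [quot, add_sub_cancel_left, if_neg hne, ← mul_sub, mul_smul_comm]

theorem hilb_mul_right {𝕜 : Type*} [RCLike 𝕜] (c : 𝕜) {f : ℝ → 𝕜} (x : ℝ) :
    hilb (fun x => f x * c) x = hilb f x * c := by
  simp only [mul_comm _ c, hilb_mul_left]

theorem hilb_neg {f : ℝ → F} (x : ℝ) : hilb (fun x => -f x) x = -hilb f x := by
  simpa using hilb_smul (-1) (f := f) x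

theorem hilb_sub {f g : ℝ → F} (hf : SmoothPer f) (hg : SmoothPer g) (x : ℝ) :
    hilb (fun x => f x - g x) x = hilb f x - hilb g x := by
  simp only [sub_eq_add_neg]
  rw [hilb_add hf hg.neg, hilb_neg]

theorem hilb_const (c : F) (x : ℝ) : hilb (fun _ => c) x = 0 := by
  simp [hilb, quot, mean]

theorem hilb_comp_add (f : ℝ → F) (s x : ℝ) : hilb (fun x => f (x + s)) x = hilb f (x + s) := by
  unfold hilb
  simp only [quot_comp_add]
  congr 1; funext u
  rw [add_right_comm]

theorem hilb_comp_sub (f : ℝ → F) (s x : ℝ) : hilb (fun x => f (x - s)) x = hilb f (x - s) := by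
  simpa [sub_eq_add_neg] using hilb_comp_add f (-s) x

theorem hilb_ofReal {f : ℝ → ℝ} (hf : Function.Periodic f (2 * π)) (x : ℝ) :
    hilb (fun x => (f x : ℂ)) x = (hilb f x : ℝ) := by
  have hf' : Function.Periodic (fun x => (f x : ℂ)) (2 * π) := fun y => by simp only [hf y]
  rw [hilb_eq_mean_cot hf, hilb_eq_mean_cot hf', ← mean_ofReal]
  congr 1; funext u
  simp [Complex.real_smul]

/-- Antisymmetry of the kernel `cot (u / 2)`, for functions of two variables. -/
theorem mean_mean_cot_antisymm {Φ k₁ k₂ : ℝ × ℝ → F} (hΦ : Continuous Φ)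
    (hper₁ : ∀ x y, Φ (x + 2 * π, y) = Φ (x, y)) (hper₂ : ∀ x y, Φ (x, y + 2 * π) = Φ (x, y))
    (hk₁ : Continuous k₁) (hk₂ : Continuous k₂)
    (h₁ : ∀ y u, sin (u / 2) • k₁ (y, u) = Φ (y, y + u) - Φ (y, y))
    (h₂ : ∀ y u, sin (u / 2) • k₂ (y, u) = Φ (y + u, y) - Φ (y, y)) :
    (mean fun y => mean fun u => cos (u / 2) • k₁ (y, u)) =
      -mean fun y => mean fun u => cos (u / 2) • k₂ (y, u) := by
  have s₁ : Continuous fun q : ℝ × ℝ => cos (q.2 / 2) • k₁ q := by fun_prop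
  have s₂ : Continuous fun q : ℝ × ℝ => cos (q.2 / 2) • k₂ q := by fun_prop
  have e₁ := mean_swap s₁
  have e₂ := mean_swap s₂
  dsimp only at e₁ e₂
  -- After Fubini u is fixed. The substitution u ↦ 2π - u changes the sign of cos(u/2) and keeps
  -- sin(u/2), and a translation of y by u then matches the two integrands.
  rw [e₁, e₂, ← mean_comp_two_pi_sub (fun y => mean fun x => cos (y / 2) • k₂ (x, y)), ← mean_neg]
  refine mean_congr fun u hu => ?_
  have hne := (sin_half_pos hu).ne'
  have hs : (2 * π - u) / 2 = π - u / 2 := by ring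
  rw [mean_smul, mean_smul, hs, cos_pi_sub, neg_smul, neg_neg]
  congr 1
  have hc1 : Continuous fun y => k₁ (y, u) := by fun_prop
  have hc2 : Continuous fun y => k₂ (y, 2 * π - u) := by fun_prop
  have key : sin (u / 2) • mean (fun y => k₁ (y, u)) =
      sin (u / 2) • mean (fun y => k₂ (y, 2 * π - u)) := by
    rw [← mean_smul, ← mean_smul]
    have hd : Continuous fun y => Φ (y, y) := by fun_prop
    have g1 : (fun y => sin (u / 2) • k₁ (y, u)) = fun y => Φ (y, y + u) - Φ (y, y) :=
      funext fun y => h₁ y u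
    have g2 : (fun y => sin (u / 2) • k₂ (y, 2 * π - u)) =
        fun y => Φ (y + -u, (y + -u) + u) - Φ (y, y) := by
      funext y
      have := h₂ y (2 * π - u)
      rw [hs, sin_pi_sub] at this
      rw [this, show y + (2 * π - u) = y + -u + 2 * π by ring, hper₁]
      simp
    rw [g1, g2, mean_sub (by fun_prop) hd, mean_sub (by fun_prop) hd,
      mean_comp_add (f := fun y => Φ (y, y + u)) (fun y => by
        simp only
        rw [hper₁, show y + 2 * π + u = y + u + 2 * π by ring, hper₂])]
  have := congrArg (fun z => (sin (u / 2))⁻¹ • z) key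
  simpa [smul_smul, inv_mul_cancel₀ hne] using this

/-- The Hilbert transform is skew-adjoint: antisymmetry of the cotangent applied to b(x) f(y). -/
theorem mean_mul_hilb {𝕜 : Type*} [RCLike 𝕜] {b f : ℝ → 𝕜} (hb : SmoothPer b) (hf : SmoothPer f) :
    mean (fun y => b y * hilb f y) = -mean fun y => hilb b y * f y := by
  have h := mean_mean_cot_antisymm (Φ := fun q : ℝ × ℝ => b q.1 * f q.2)
    (k₁ := fun q => b q.1 * quot f (q.1 + q.2) q.1) (k₂ := fun q => quot b (q.1 + q.2) q.1 * f q.1)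
    ((hb.continuous.comp continuous_fst).mul (hf.continuous.comp continuous_snd))
    (fun x y => by simp only [hb.periodic x]) (fun x y => by simp only [hf.periodic y])
    ((hb.continuous.comp continuous_fst).mul (continuous_quot_shift hf))
    ((continuous_quot_shift hb).mul
      (hf.continuous.comp continuous_fst))
    (fun y u => by
      have := sin_smul_quot hf.periodic (y + u) y
      rw [add_sub_cancel_left] at this
      simp only
      rw [← mul_smul_comm, this, mul_sub])
    (fun y u => by
      have := sin_smul_quot hb.periodic (y + u) y
      rw [add_sub_cancel_left] at this
      simp only
      rw [← smul_mul_assoc, this, sub_mul])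
  convert h using 2
  · funext y
    rw [hilb, ← mean_mul_left]
    simp only [mul_smul_comm]
  · congr 1
    funext y
    rw [hilb, ← mean_mul_right]
    simp only [smul_mul_assoc]

theorem mean_hilb {𝕜 : Type*} [RCLike 𝕜] {f : ℝ → 𝕜} (hf : SmoothPer f) : mean (hilb f) = 0 := by
  have := mean_mul_hilb (SmoothPer.const (1 : 𝕜)) hf
  simpa [hilb_const, mean] using this

end HilbertBasic

section Fourier

open Complex (I exp)

/-- The characters `e^{inx}`. -/
def character (n : ℤ) (x : ℝ) : ℂ := exp (n * x * I)

theorem smoothPer_character (n : ℤ) : SmoothPer (character n) := by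
  refine ⟨?_, fun x => ?_⟩
  · unfold character
    have : ContDiff ℝ ∞ fun x : ℝ => (x : ℂ) := Complex.ofRealCLM.contDiff
    fun_prop
  · unfold character
    rw [Complex.exp_eq_exp_iff_exists_int]
    exact ⟨n, by push_cast; ring⟩

theorem character_mul (n k : ℤ) (x : ℝ) : character n x * character k x = character (n + k) x := by
  unfold character
  rw [← Complex.exp_add]
  congr 1; push_cast; ring

theorem character_zero (x : ℝ) : character 0 x = 1 := by simp [character]

theorem character_add (n : ℤ) (x y : ℝ) : character n (x + y) = character n x * character n y := by
  unfold character
  rw [← Complex.exp_add]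
  congr 1; push_cast; ring

theorem mean_character (n : ℤ) : mean (character n) = if n = 0 then 1 else 0 := by
  split_ifs with h
  · subst h
    simp only [funext character_zero]
    exact mean_const 1
  · unfold mean character
    have hc : (n : ℂ) * I ≠ 0 := mul_ne_zero (by exact_mod_cast h) Complex.I_ne_zero
    have : ∀ x : ℝ, exp (n * x * I) = exp (n * I * x) := fun x => by congr 1; ring
    simp only [this]
    rw [integral_exp_mul_complex hc]
    have h2 : exp (n * I * ((2 * π : ℝ) : ℂ)) = 1 := by
      rw [Complex.exp_eq_one_iff]
      exact ⟨n, by push_cast; ring⟩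
    rw [h2]; simp

/-- Since cot(u/2) = i (e^{iu} + 1)/(e^{iu} - 1), the product of cot(u/2) with e^{i(n+1)u} - e^{inu}
is i (e^{i(n+1)u} + e^{inu}). -/
theorem hilb_character_zero_succ (n : ℤ) :
    hilb (character (n + 1)) 0 =
      hilb (character n) 0 + I * (mean (character (n + 1)) + mean (character n)) := by
  rw [hilb_eq_mean_cot (smoothPer_character _).periodic]
  have h1 : hilb (character n) 0 = mean fun u => cos (u / 2) • quot (character n) (0 + u) 0 := rfl
  have c1 : Continuous fun u => cos (u / 2) • quot (character n) (0 + u) 0 :=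
    continuous_hilb_integrand_right (smoothPer_character n) 0
  have c2 := (smoothPer_character n).continuous
  have c3 := (smoothPer_character (n + 1)).continuous
  rw [h1, ← mean_add c3 c2, ← mean_mul_left, ← mean_add c1 (by fun_prop)]
  refine mean_congr fun u hu => ?_
  have hne := (sin_half_pos hu).ne'
  have hneC : (sin (u / 2) : ℂ) ≠ 0 := by exact_mod_cast hne
  have e1 : character (n + 1) u = character n u * character 1 u := by rw [character_mul]
  have e2 : character 1 u = (cos (u / 2) + sin (u / 2) * I) ^ 2 := by
    unfold character
    have : ((cos (u / 2) : ℝ) : ℂ) + (sin (u / 2) : ℝ) * I = exp ((u / 2 : ℝ) * I) := by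
      rw [Complex.exp_mul_I, Complex.ofReal_cos, Complex.ofReal_sin]
    rw [this, ← Complex.exp_nat_mul]
    congr 1; push_cast; ring
  have e3 : (cos (u / 2) : ℂ) ^ 2 + (sin (u / 2) : ℂ) ^ 2 = 1 := by
    exact_mod_cast cos_sq_add_sin_sq (u / 2)
  have e4 : ∀ m : ℤ, character m 0 = 1 := fun m => by simp [character]
  simp only [quot, zero_add, sub_zero, if_neg hne, e4, Complex.real_smul]
  rw [e1, e2]
  push_cast
  push_cast at hneC e3
  generalize Complex.cos (u / 2) = a at *
  generalize Complex.sin (u / 2) = b at *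
  generalize character n u = w
  field_simp
  have hI : I ^ 2 = -1 := Complex.I_sq
  linear_combination w * (a + b * I) * e3 - w * (a + b * I) * b ^ 2 * hI

end Fourier

end HilbertTransform

/-! ### The Hilbert transform as a Fourier multiplier; its square and Cotlar's identity. -/

section FourierCoefficients

section Fourier

open Complex (I exp)

/-- The recursion changes the value only between the modes -1, 0 and 1, where one of the two means
is 1. -/
theorem hilb_character_zero (n : ℤ) : hilb (character n) 0 = I * n.sign := by
  induction n using Int.induction_on with
  | zero => simp [funext character_zero, hilb_const]
  | succ n ih =>
    rw [hilb_character_zero_succ, ih, mean_character, mean_character]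
    have h1 : ((n : ℤ) + 1).sign = 1 := Int.sign_eq_one_of_pos (by positivity)
    have h2 : (n : ℤ) + 1 ≠ 0 := by positivity
    rw [h1, if_neg h2]
    rcases Nat.eq_zero_or_pos n with rfl | h
    · simp
    · have h3 : (n : ℤ) ≠ 0 := by positivity
      rw [if_neg h3, Int.sign_eq_one_of_pos (by positivity)]; simp
  | pred n ih =>
    have h := hilb_character_zero_succ (-(n : ℤ) - 1)
    rw [sub_add_cancel, ih, mean_character, mean_character] at h
    have h1 : (-(n : ℤ) - 1).sign = -1 := Int.sign_eq_neg_one_of_neg (by omega)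
    have h2 : -(n : ℤ) - 1 ≠ 0 := by omega
    rw [if_neg h2] at h
    rw [h1]
    rcases Nat.eq_zero_or_pos n with rfl | h0
    · simp at h ⊢
      linear_combination -h
    · have h3 : -(n : ℤ) ≠ 0 := by omega
      rw [if_neg h3, Int.sign_eq_neg_one_of_neg (by omega)] at h
      rw [← sub_eq_zero] at h ⊢
      linear_combination -h

theorem hilb_character (n : ℤ) (x : ℝ) :
    hilb (character n) x = I * n.sign * character n x := by
  have h := hilb_comp_add (character n) x 0
  rw [zero_add] at h
  rw [← h, show (fun y => character n (y + x)) = fun y => character n y * character n x from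
    funext fun y => character_add n y x, hilb_mul_right, hilb_character_zero]

/-- Fourier coefficients. -/
def fcoef (f : ℝ → ℂ) (n : ℤ) : ℂ := mean fun x => f x * character (-n) x

theorem fcoef_mul_character (f : ℝ → ℂ) (n k : ℤ) :
    fcoef (fun x => f x * character (-n) x) k = fcoef f (k + n) := by
  unfold fcoef
  congr 1; funext x
  rw [mul_assoc, character_mul]
  congr 2; ring

theorem fcoef_add {f g : ℝ → ℂ} (hf : Continuous f) (hg : Continuous g) (n : ℤ) :
    fcoef (fun x => f x + g x) n = fcoef f n + fcoef g n := by
  unfold fcoef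
  have := (smoothPer_character (-n)).continuous
  rw [← mean_add (by fun_prop) (by fun_prop)]
  simp only [add_mul]

theorem fcoef_sub {f g : ℝ → ℂ} (hf : Continuous f) (hg : Continuous g) (n : ℤ) :
    fcoef (fun x => f x - g x) n = fcoef f n - fcoef g n := by
  unfold fcoef
  have := (smoothPer_character (-n)).continuous
  rw [← mean_sub (by fun_prop) (by fun_prop)]
  simp only [sub_mul]

theorem fcoef_mul_left (c : ℂ) (f : ℝ → ℂ) (n : ℤ) :
    fcoef (fun x => c * f x) n = c * fcoef f n := by
  unfold fcoef
  rw [← mean_mul_left]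
  simp only [mul_assoc]

theorem fcoef_const (c : ℂ) (n : ℤ) : fcoef (fun _ => c) n = if n = 0 then c else 0 := by
  unfold fcoef
  rw [mean_mul_left, mean_character]
  simp

theorem fcoef_zero (f : ℝ → ℂ) : fcoef f 0 = mean f := by
  simp [fcoef, character_zero]

theorem fcoef_hilb {f : ℝ → ℂ} (hf : SmoothPer f) (n : ℤ) :
    fcoef (hilb f) n = I * n.sign * fcoef f n := by
  unfold fcoef
  have h := mean_mul_hilb (smoothPer_character (-n)) hf
  simp only [hilb_character, mul_assoc, mean_mul_left] at h
  simp only [mul_comm _ (character _ _), h, Int.sign_neg]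
  push_cast; ring

/-- The zero Fourier series is summable, so it converges pointwise to the continuous function it
represents. -/
theorem eq_zero_of_fcoef_eq_zero {f : ℝ → ℂ} (hf : Continuous f)
    (hper : Function.Periodic f (2 * π)) (h : ∀ n, fcoef f n = 0) (x : ℝ) : f x = 0 := by
  have : Fact (0 < 2 * π) := ⟨two_pi_pos⟩
  let g : C(AddCircle (2 * π), ℂ) := ⟨hper.lift, by
    rw [continuous_coinduced_dom]
    exact hf⟩
  have hg : ∀ y : ℝ, g y = f y := fun y => rfl
  have h0 : ∀ n, fourierCoeff g n = 0 := by
    intro n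
    rw [fourierCoeff_eq_intervalIntegral _ _ 0, ← h n]
    unfold fcoef mean
    rw [zero_add, one_div]
    congr 1
    refine intervalIntegral.integral_congr fun y _ => ?_
    simp only [hg, smul_eq_mul, mul_comm (f y)]
    congr 1
    rw [fourier_coe_apply]
    unfold character
    have : (π : ℂ) ≠ 0 := by exact_mod_cast pi_ne_zero
    congr 1; push_cast; field_simp
  have h1 : fourierCoeff g = 0 := funext h0
  have h2 := has_pointwise_sum_fourier_series_of_summable (f := g) (by rw [h1]; exact summable_zero) x
  simp only [h1, Pi.zero_apply, zero_smul] at h2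
  rw [← hg]
  exact h2.unique hasSum_zero

theorem eq_of_fcoef_eq {f g : ℝ → ℂ} (hf : SmoothPer f) (hg : SmoothPer g)
    (h : ∀ n, fcoef f n = fcoef g n) (x : ℝ) : f x = g x := by
  rw [← sub_eq_zero]
  refine eq_zero_of_fcoef_eq_zero (f := fun x => f x - g x) (hf.sub hg).continuous
    (hf.sub hg).periodic (fun n => ?_) x
  rw [fcoef_sub hf.continuous hg.continuous, h, sub_self]

/-- Cotlar's identity on the level of symbols. The correction at n = k = 0 produces the product of
the means. -/
theorem sign_mul_add_sign (n k : ℤ) :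
    (1 : ℂ) + n.sign * k.sign =
      (n + k).sign * (n.sign + k.sign) + if n = 0 ∧ k = 0 then 1 else 0 := by
  have h : 1 + n.sign * k.sign =
      (n + k).sign * (n.sign + k.sign) + if n = 0 ∧ k = 0 then 1 else 0 := by
    rcases lt_trichotomy n 0 with hn | hn | hn <;> rcases lt_trichotomy k 0 with hk | hk | hk
    · have h3 : n + k < 0 := by omega
      simp [Int.sign_eq_neg_one_of_neg hn, Int.sign_eq_neg_one_of_neg hk, Int.sign_eq_neg_one_of_neg h3, hn.ne]
    · simp [hk, Int.sign_eq_neg_one_of_neg hn, hn.ne]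
    · simp [Int.sign_eq_neg_one_of_neg hn, Int.sign_eq_one_of_pos hk, hn.ne]
    · simp [hn, Int.sign_eq_neg_one_of_neg hk, hk.ne]
    · simp [hn, hk]
    · simp [hn, Int.sign_eq_one_of_pos hk, hk.ne']
    · simp [Int.sign_eq_neg_one_of_neg hk, Int.sign_eq_one_of_pos hn, hn.ne']
    · simp [hk, Int.sign_eq_one_of_pos hn, hn.ne']
    · have h3 : 0 < n + k := by omega
      simp [Int.sign_eq_one_of_pos hn, Int.sign_eq_one_of_pos hk, Int.sign_eq_one_of_pos h3, hn.ne']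
  exact_mod_cast h

theorem hilb_hilb_complex {f : ℝ → ℂ} (hf : SmoothPer f) (x : ℝ) :
    hilb (hilb f) x = -f x + mean f := by
  refine eq_of_fcoef_eq hf.hilb.hilb (hf.neg.add (SmoothPer.const _)) (fun n => ?_) x
  have hn := hf.neg
  have e : fcoef (fun x => -f x) n = -fcoef f n := by
    simpa using fcoef_mul_left (-1) f n
  rw [fcoef_hilb hf.hilb, fcoef_hilb hf, fcoef_add hn.continuous continuous_const, fcoef_const, e]
  split_ifs with h
  · subst h; simp [fcoef_zero]
  · have h1 : (n.sign : ℂ) * n.sign = 1 := by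
      have : n.sign * n.sign = 1 := by
        rcases lt_or_gt_of_ne h with h | h
        · simp [Int.sign_eq_neg_one_of_neg h]
        · simp [Int.sign_eq_one_of_pos h]
      exact_mod_cast this
    linear_combination I ^ 2 * fcoef f n * h1 + fcoef f n * Complex.I_sq

/-- Convolutions of Fourier series are avoided. By skew-adjointness the n-th coefficient of every
product is a mean of f against a function built from g alone, so the claim becomes a linear identity
in g. -/
theorem hilb_cotlar_complex {f g : ℝ → ℂ} (hf : SmoothPer f) (hg : SmoothPer g) (x : ℝ) :
    hilb (fun x => f x * hilb g x + g x * hilb f x) x =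
      hilb f x * hilb g x - f x * g x + mean f * mean g := by
  -- The linear identity in g; on Fourier coefficients it reduces to `sign_mul_add_sign`.
  have key : ∀ (n : ℤ) (x : ℝ), I * n.sign * (hilb g x * character (-n) x
      - hilb (fun x => g x * character (-n) x) x)
      + (hilb (fun x => hilb g x * character (-n) x) x + g x * character (-n) x) =
      if n = 0 then mean g else 0 := by
    intro n x
    have hc := smoothPer_character (-n)
    have s1 := hg.hilb.mul hc
    have s2 := (hg.mul hc)
    have s3 := (SmoothPer.const (I * n.sign)).mul (s1.sub s2.hilb)
    have s4 := s1.hilb.add s2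
    refine eq_of_fcoef_eq (s3.add s4) (SmoothPer.const _) (fun k => ?_) x
    rw [fcoef_add s3.continuous s4.continuous, fcoef_mul_left,
      fcoef_sub s1.continuous s2.hilb.continuous, fcoef_add s1.hilb.continuous s2.continuous,
      fcoef_hilb s2, fcoef_hilb s1, fcoef_mul_character, fcoef_mul_character, fcoef_hilb hg,
      fcoef_const]
    have hs := sign_mul_add_sign n k
    rw [add_comm n k] at hs
    have : (if k = 0 then if n = 0 then mean g else 0 else 0) =
        fcoef g (k + n) * if n = 0 ∧ k = 0 then 1 else 0 := by
      split_ifs with h1 h2 h3 h4 <;> first | (exfalso; tauto) | simp_all [fcoef_zero]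
    rw [this]
    linear_combination fcoef g (k + n) * hs + fcoef g (k + n) * (n.sign * (k + n).sign - n.sign * k.sign + k.sign * (k+n).sign) * Complex.I_sq
  have s0 := (hf.mul hg.hilb).add (hg.mul hf.hilb)
  have t1 := hf.hilb.mul hg.hilb
  have t2 := hf.mul hg
  refine eq_of_fcoef_eq s0.hilb ((t1.sub t2).add (SmoothPer.const _)) (fun n => ?_) x
  rw [fcoef_hilb s0, fcoef_add (t1.sub t2).continuous continuous_const,
    fcoef_sub t1.continuous t2.continuous, fcoef_const,
    fcoef_add (hf.mul hg.hilb).continuous (hg.mul hf.hilb).continuous]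
  have hc := smoothPer_character (-n)
  have e1 : fcoef (fun x => g x * hilb f x) n =
      -mean fun x => f x * hilb (fun x => g x * character (-n) x) x := by
    have := mean_mul_hilb (hg.mul hc) hf
    unfold fcoef
    simp only [mul_right_comm, mul_comm (f _)] at this ⊢
    exact this
  have e2 : fcoef (fun x => hilb f x * hilb g x) n =
      -mean fun x => f x * hilb (fun x => hilb g x * character (-n) x) x := by
    have := mean_mul_hilb (hg.hilb.mul hc) hf
    unfold fcoef
    simp only [mul_comm (hilb f _), mul_right_comm, mul_comm (f _)] at this ⊢
    exact this
  have e3 := congrArg mean (funext fun x => congrArg (fun z => f x * z) (key n x))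
  have hS1 := (hf.mul (hg.hilb.mul hc)).continuous
  have hS2 := (hf.mul (hg.mul hc).hilb).continuous
  have hS3 := (hf.mul (hg.hilb.mul hc).hilb).continuous
  have hS4 := (hf.mul (hg.mul hc)).continuous
  have e4 : (mean fun x => f x * (I * n.sign * (hilb g x * character (-n) x
      - hilb (fun x => g x * character (-n) x) x)
      + (hilb (fun x => hilb g x * character (-n) x) x + g x * character (-n) x))) =
      I * n.sign * ((mean fun x => f x * (hilb g x * character (-n) x))
        - mean fun x => f x * hilb (fun x => g x * character (-n) x) x)
      + ((mean fun x => f x * hilb (fun x => hilb g x * character (-n) x) x)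
        + mean fun x => f x * (g x * character (-n) x)) := by
    rw [← mean_sub hS1 hS2, ← mean_mul_left, ← mean_add hS3 hS4, ← mean_add (by fun_prop) (by fun_prop)]
    congr 1; funext x; ring
  rw [e4, mean_mul_right] at e3
  rw [e1, e2]
  simp only [fcoef, mul_assoc] at e3 ⊢
  simp only [mul_ite, mul_zero] at e3
  linear_combination e3

theorem hilb_hilb {f : ℝ → ℝ} (hf : SmoothPer f) (x : ℝ) : hilb (hilb f) x = -f x + mean f := by
  have h := hilb_hilb_complex hf.ofReal x
  simp only [funext (hilb_ofReal hf.periodic), hilb_ofReal hf.hilb.periodic, mean_ofReal] at h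
  exact_mod_cast h

theorem hilb_cotlar {f g : ℝ → ℝ} (hf : SmoothPer f) (hg : SmoothPer g) (x : ℝ) :
    hilb (fun x => f x * hilb g x + g x * hilb f x) x =
      hilb f x * hilb g x - f x * g x + mean f * mean g := by
  have h := hilb_cotlar_complex hf.ofReal hg.ofReal x
  have s := (hf.mul hg.hilb).add (hg.mul hf.hilb)
  simp only [hilb_ofReal hf.periodic, hilb_ofReal hg.periodic, mean_ofReal, ← Complex.ofReal_mul,
    ← Complex.ofReal_add, hilb_ofReal s.periodic, ← Complex.ofReal_sub] at h
  exact_mod_cast h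

end Fourier

end FourierCoefficients

/-! ### Commutators with trigonometric functions; Poisson and conjugate Poisson kernels. -/

section Poisson

section Commutators

/-- Because cot(u/2) (cos(x + u) - cos x) = -sin(x + u) - sin x, the commutator with the cosine has
finite rank and consists of two means. -/
theorem hilb_cos_mul {g : ℝ → ℝ} (hg : SmoothPer g) (x : ℝ) :
    hilb (fun x => cos x * g x) x =
      cos x * hilb g x - (mean fun y => sin y * g y) - sin x * mean g := by
  have hx := hg.comp_add x
  have e1 : (mean fun y => sin y * g y) = mean fun u => sin (x + u) * g (x + u) := by
    rw [← mean_comp_add (smoothPer_sin.mul hg).periodic x]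
    simp only [add_comm]
  have e2 : mean g = mean fun u => g (x + u) := by
    rw [← mean_comp_add hg.periodic x]
    simp only [add_comm]
  have hc := hg.continuous
  have hq := continuous_hilb_integrand_right hg x
  simp only [smul_eq_mul] at hq
  rw [hilb_eq_mean_cot (smoothPer_cos.mul hg).periodic, e1, e2, ← mean_mul_left (sin x)]
  unfold hilb
  rw [← mean_mul_left, ← mean_sub (by simp only [smul_eq_mul]; fun_prop) (by fun_prop),
    ← mean_sub (by simp only [smul_eq_mul]; fun_prop) (by fun_prop)]
  refine mean_congr fun u hu => ?_
  have hne := (sin_half_pos hu).ne'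
  simp only [quot, add_sub_cancel_left, if_neg hne, smul_eq_mul]
  have e3 : cos (x + u) = cos x * (2 * cos (u / 2) ^ 2 - 1) - sin x * (2 * sin (u / 2) * cos (u / 2)) := by
    rw [← cos_two_mul, ← sin_two_mul, ← cos_add]; ring_nf
  have e4 : sin (x + u) = sin x * (2 * cos (u / 2) ^ 2 - 1) + cos x * (2 * sin (u / 2) * cos (u / 2)) := by
    rw [← cos_two_mul, ← sin_two_mul, ← sin_add]; ring_nf
  have e5 := cos_sq_add_sin_sq (u / 2)
  rw [e3, e4]
  field_simp
  linear_combination (2 * cos (u / 2) * cos x * g (x + u)) * e5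

theorem hilb_sin_mul {g : ℝ → ℝ} (hg : SmoothPer g) (x : ℝ) :
    hilb (fun x => sin x * g x) x =
      sin x * hilb g x + (mean fun y => cos y * g y) + cos x * mean g := by
  have h := hilb_cos_mul (hg.comp_add (π / 2)) (x - π / 2)
  have h1 := hilb_comp_add (fun y => sin y * g y) (π / 2) (x - π / 2)
  have e1 : ∀ y, cos y = sin (y + π / 2) := fun y => by rw [sin_add_pi_div_two]
  have e2 : ∀ y, cos (y + π / 2) = - sin y := fun y => by rw [cos_add_pi_div_two]
  have h2 := mean_comp_add (smoothPer_cos.mul hg).periodic (π / 2)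
  simp only [e2, sub_add_cancel] at h h1 h2
  simp only [← e1] at h1
  rw [h1, hilb_comp_add, sub_add_cancel, mean_comp_add hg.periodic, cos_sub_pi_div_two,
    sin_sub_pi_div_two] at h
  simp only [neg_mul, mean_neg] at h2
  linear_combination h + h2

theorem hilb_cos_sub_mul {g : ℝ → ℝ} (hg : SmoothPer g) (s x : ℝ) :
    hilb (fun x => cos (x - s) * g x) x =
      cos (x - s) * hilb g x - (mean fun y => sin (y - s) * g y) - sin (x - s) * mean g := by
  have h := hilb_cos_mul (hg.comp_add s) (x - s)
  have h1 := hilb_comp_add (fun y => cos (y - s) * g y) s (x - s)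
  have h2 := mean_comp_add ((smoothPer_sin.comp_sub s).mul hg).periodic s
  simp only [add_sub_cancel_right, sub_add_cancel] at h h1 h2
  rw [h1, h2, hilb_comp_add, sub_add_cancel, mean_comp_add hg.periodic] at h
  exact h

end Commutators

section Poisson

/-- The denominator of the Poisson kernel. -/
def poissonDenom (r v : ℝ) : ℝ := 1 - 2 * r * cos v + r ^ 2

/-- The Poisson kernel. -/
def poisson (r v : ℝ) : ℝ := (1 - r ^ 2) / poissonDenom r v

/-- The conjugate Poisson kernel. -/
def conjPoisson (r v : ℝ) : ℝ := 2 * r * sin v / poissonDenom r v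

variable {r : ℝ}

theorem poissonDenom_pos (hr : |r| < 1) (v : ℝ) : 0 < poissonDenom r v := by
  unfold poissonDenom
  have h1 := neg_one_le_cos v
  have h2 := cos_le_one v
  rw [abs_lt] at hr
  nlinarith [sq_nonneg (r - cos v), sq_nonneg (1 - r), sq_nonneg (1 + r), sin_sq_add_cos_sq v, mul_self_pos.2 (sub_ne_zero.2 hr.2.ne), mul_self_pos.2 (show 1 + r ≠ 0 by linarith)]

theorem contDiff_poissonDenom : ContDiff ℝ ∞ (poissonDenom r) := by
  unfold poissonDenom; fun_prop

theorem smoothPer_poisson (hr : |r| < 1) : SmoothPer (poisson r) :=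
  ⟨contDiff_const.div contDiff_poissonDenom fun v => (poissonDenom_pos hr v).ne', fun v => by
    simp [poisson, poissonDenom]⟩

theorem smoothPer_conjPoisson (hr : |r| < 1) : SmoothPer (conjPoisson r) :=
  ⟨(by fun_prop : ContDiff ℝ ∞ fun v => 2 * r * sin v).div contDiff_poissonDenom
    fun v => (poissonDenom_pos hr v).ne', fun v => by simp [conjPoisson, poissonDenom]⟩

theorem poisson_nonneg (hr : |r| < 1) (v : ℝ) : 0 ≤ poisson r v := by
  refine div_nonneg ?_ (poissonDenom_pos hr v).le
  have := (sq_lt_one_iff_abs_lt_one r).2 hr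
  linarith

theorem poisson_mul_denom (hr : |r| < 1) (v : ℝ) :
    (1 + r ^ 2) * poisson r v - 2 * r * (cos v * poisson r v) = 1 - r ^ 2 := by
  have h := (poissonDenom_pos hr v).ne'
  unfold poisson
  field_simp
  unfold poissonDenom
  ring

/-- Poisson's integral formula for the constant function 1 at the point r of the disc. -/
theorem mean_poisson (hr : |r| < 1) : mean (poisson r) = 1 := by
  have h := DiffContOnCl.circleAverage_poissonKernel_smul' (f := fun _ : ℂ => (1 : ℂ)) (R := 1)
    (c := 0) (w := (r : ℂ)) diffContOnCl_const (by simpa using hr)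
  have e : (mean fun u => (poisson r u : ℂ)) = 1 := by
    rw [← h, circleAverage_def]
    unfold mean
    congr 2; funext u
    have e1 : ‖circleMap 0 1 u‖ = 1 := by simp
    have e2 : ‖circleMap 0 1 u - (r : ℂ)‖ ^ 2 = poissonDenom r u := by
      rw [← Complex.normSq_eq_norm_sq, Complex.normSq_apply]
      simp only [circleMap, Complex.ofReal_one, one_mul, zero_add, Complex.sub_re, Complex.sub_im,
        Complex.exp_ofReal_mul_I_re, Complex.exp_ofReal_mul_I_im, Complex.ofReal_re,
        Complex.ofReal_im]
      unfold poissonDenom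
      linear_combination sin_sq_add_cos_sq u
    simp only [sub_zero, e1, e2, poisson]
    simp
  rw [mean_ofReal] at e
  exact_mod_cast e

theorem mean_sin_poisson : (mean fun v => sin v * poisson r v) = 0 := by
  have h := mean_comp_two_pi_sub fun v => sin v * poisson r v
  simp only [poisson, poissonDenom, cos_two_pi_sub, sin_two_pi_sub, neg_mul, mean_neg] at h ⊢
  linarith

theorem mean_cos_poisson (hr : |r| < 1) : (mean fun v => cos v * poisson r v) = r := by
  rcases eq_or_ne r 0 with rfl | h0
  · simp [poisson, poissonDenom, mean]
  · have hp := (smoothPer_poisson hr)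
    have h1 := (smoothPer_cos.mul hp).continuous
    have h2 := hp.continuous
    have h := congrArg mean (funext (poisson_mul_denom hr))
    rw [mean_sub (by fun_prop) (by fun_prop), mean_mul_left, mean_mul_left, mean_poisson hr,
      mean_const] at h
    have h3 : r * ((mean fun v => cos v * poisson r v) - r) = 0 := by linear_combination -h / 2
    rcases mul_eq_zero.1 h3 with h3 | h3
    · exact absurd h3 h0
    · linarith

/-- Applying H to (1 + r²) P - 2r cos · P = 1 - r² gives, by the commutator with the cosine, the
product of the denominator with HP as -2r sin v. -/
theorem hilb_poisson (hr : |r| < 1) (v : ℝ) : hilb (poisson r) v = -conjPoisson r v := by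
  have hp := smoothPer_poisson hr
  have h := congrArg (fun f => hilb f v) (funext (poisson_mul_denom hr))
  simp only [hilb_const] at h
  rw [hilb_sub ((SmoothPer.const _).mul hp) ((SmoothPer.const _).mul (smoothPer_cos.mul hp)),
    hilb_mul_left, hilb_mul_left, hilb_cos_mul hp, mean_sin_poisson, mean_poisson hr] at h
  have hd := (poissonDenom_pos hr v).ne'
  unfold conjPoisson
  field_simp
  unfold poissonDenom
  linear_combination h

theorem hilb_conjPoisson (hr : |r| < 1) (v : ℝ) : hilb (conjPoisson r) v = poisson r v - 1 := by
  have h := hilb_hilb (smoothPer_poisson hr) v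
  rw [funext (hilb_poisson hr), hilb_neg, mean_poisson hr] at h
  linarith

theorem sin_mul_poisson (r v : ℝ) :
    r * sin v * poisson r v = (1 - r ^ 2) / 2 * conjPoisson r v := by
  unfold poisson conjPoisson; ring

theorem poisson_mul_one_sub_cos (hr : |r| < 1) (v : ℝ) :
    poisson r v * (1 - r * cos v) = (1 - r ^ 2) / 2 * (poisson r v + 1) := by
  have := poisson_mul_denom hr v
  linear_combination this / 2

theorem one_sub_cos_mul_conjPoisson (hr : |r| < 1) (v : ℝ) :
    conjPoisson r v * (1 - r * cos v) = r * sin v * (poisson r v + 1) := by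
  have hd := (poissonDenom_pos hr v).ne'
  unfold poisson conjPoisson
  field_simp
  unfold poissonDenom
  ring

theorem poisson_conjPoisson_sum (hr : |r| < 1) (v : ℝ) :
    (1 - r * cos v) * (1 + poisson r v) + r * sin v * conjPoisson r v = 2 := by
  have hd := (poissonDenom_pos hr v).ne'
  unfold poisson conjPoisson
  field_simp
  unfold poissonDenom
  linear_combination 2 * r ^ 2 * sin_sq_add_cos_sq v

/-- Addition formula for `conjPoisson`. -/
theorem poisson_conjPoisson_add (hr : |r| < 1) (a b : ℝ) :
    cos ((a - b) / 2) * (poisson r b - poisson r a) =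
      sin ((a - b) / 2) * (conjPoisson r a * poisson r b + poisson r a * conjPoisson r b) := by
  have ha := (poissonDenom_pos hr a).ne'
  have hb := (poissonDenom_pos hr b).ne'
  obtain ⟨p, q, rfl, rfl⟩ : ∃ p q, a = p + q ∧ b = p - q := ⟨(a + b) / 2, (a - b) / 2, by ring, by ring⟩
  have e : (p + q - (p - q)) / 2 = q := by ring
  rw [e]
  unfold poisson conjPoisson
  field_simp
  unfold poissonDenom
  rw [cos_add, cos_sub, sin_add, sin_sub]
  linear_combination 0 * sin_sq_add_cos_sq p

/-- With W = P + iQ = (1 + re^{iv})/(1 - re^{iv}), this and `poisson_conjPoisson_add` are the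
imaginary and real parts of cos((a - b)/2) (W_a - W_b) = i sin((a - b)/2) (W_a W_b - 1). -/
theorem poisson_conjPoisson_sub (hr : |r| < 1) (a b : ℝ) :
    cos ((a - b) / 2) * (conjPoisson r a - conjPoisson r b) =
      sin ((a - b) / 2) *
        (poisson r a * poisson r b - conjPoisson r a * conjPoisson r b - 1) := by
  have ha := (poissonDenom_pos hr a).ne'
  have hb := (poissonDenom_pos hr b).ne'
  obtain ⟨p, q, rfl, rfl⟩ : ∃ p q, a = p + q ∧ b = p - q := ⟨(a + b) / 2, (a - b) / 2, by ring, by ring⟩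
  have e : (p + q - (p - q)) / 2 = q := by ring
  rw [e]
  unfold poisson conjPoisson
  field_simp
  unfold poissonDenom
  rw [cos_add, cos_sub, sin_add, sin_sub]
  have h1 := sin_sq_add_cos_sq p
  have h2 := sin_sq_add_cos_sq q
  grind

end Poisson

end Poisson

/-! ### The conjugating operators `outer`, their inverses, and forms that survive at radius 1. -/

section OuterOperators

section Operators

theorem mean_comp_sub {F : Type*} [NormedAddCommGroup F] [NormedSpace ℝ F] {f : ℝ → F}
    (hf : Function.Periodic f (2 * π)) (s : ℝ) : mean (fun u => f (u - s)) = mean f :=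
  mean_comp_add hf (-s)

variable {r : ℝ}

/-- The operator `F ↦ F - r (cos (x - s) (F - mean F) - sin (x - s) HF)`. -/
def outer (r s : ℝ) (F : ℝ → ℝ) (x : ℝ) : ℝ :=
  F x - r * (cos (x - s) * (F x - mean F) - sin (x - s) * hilb F x)

theorem SmoothPer.outer {F : ℝ → ℝ} (hF : SmoothPer F) (r s : ℝ) : SmoothPer (outer r s F) := by
  have h1 := (smoothPer_cos.comp_sub s).mul (hF.sub (SmoothPer.const (mean F)))
  have h2 := (smoothPer_sin.comp_sub s).mul hF.hilb
  exact hF.sub ((SmoothPer.const r).mul (h1.sub h2))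

/-- The inverse of `outer r 0`. -/
def outerInv (r : ℝ) (u : ℝ → ℝ) (x : ℝ) : ℝ :=
  ((1 + poisson r x) * u x - hilb (fun y => conjPoisson r y * u y) x
    + mean fun y => (poisson r y - 1) * u y) / 2

/-- The terms containing H cancel after H is applied to (1 - r cos) Q = r sin (1 + P) and commuted
past sine and cosine. The remaining ones combine by (1 - r cos)(1 + P) + r sin Q = 2. -/
theorem outer_outerInv (hr : |r| < 1) {u : ℝ → ℝ} (hu : SmoothPer u) (x : ℝ) :
    outer r 0 (outerInv r u) x = u x := by
  have hp := smoothPer_poisson hr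
  have hq := smoothPer_conjPoisson hr
  have h1 := ((SmoothPer.const 1).add hp).mul hu
  have h2 := hq.mul hu
  set k := mean fun y => (poisson r y - 1) * u y with hk
  have hW : outerInv r u = fun x => (1 / 2 : ℝ) * ((1 + poisson r x) * u x
      - hilb (fun y => conjPoisson r y * u y) x + k) := by
    funext x; unfold outerInv; ring
  have h3 := (h1.sub h2.hilb).add (SmoothPer.const k)
  have e1 : mean (outerInv r u) = 1 / 2 * ((mean fun x => (1 + poisson r x) * u x) + k) := by
    rw [hW, mean_mul_left, mean_add (h1.sub h2.hilb).continuous continuous_const, mean_const,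
      mean_sub h1.continuous h2.hilb.continuous, mean_hilb h2, sub_zero]
  have e2 : hilb (outerInv r u) x = 1 / 2 * (hilb (fun x => (1 + poisson r x) * u x) x
      - (-(conjPoisson r x * u x) + mean fun y => conjPoisson r y * u y)) := by
    rw [hW, hilb_mul_left, hilb_add (h1.sub h2.hilb) (SmoothPer.const k), hilb_const,
      hilb_sub h1 h2.hilb, hilb_hilb h2, add_zero]
  have e3 : hilb (fun y => conjPoisson r y * u y) x
      - r * hilb (fun y => cos y * (conjPoisson r y * u y)) x =
      r * hilb (fun y => sin y * ((1 + poisson r y) * u y)) x := by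
    rw [← hilb_mul_left r, ← hilb_mul_left r,
      ← hilb_sub h2 ((SmoothPer.const r).mul (smoothPer_cos.mul h2))]
    congr 1; funext y
    linear_combination u y * one_sub_cos_mul_conjPoisson hr y
  rw [hilb_cos_mul h2, hilb_sin_mul h1] at e3
  have e4 : r * (mean fun y => sin y * (conjPoisson r y * u y))
      - r * (mean fun y => cos y * ((1 + poisson r y) * u y)) = -k := by
    have s1 := (smoothPer_sin.mul h2).continuous
    have s2 := (smoothPer_cos.mul h1).continuous
    rw [hk, ← mean_neg, ← mean_mul_left, ← mean_mul_left, ← mean_sub (by fun_prop) (by fun_prop)]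
    congr 1; funext y
    linear_combination u y * poisson_conjPoisson_sum hr y
  have e5 := poisson_conjPoisson_sum hr x
  unfold outer
  rw [e1, e2]
  simp only [hW, sub_zero]
  linear_combination u x / 2 * e5 - e3 / 2 + e4 / 2

theorem poisson_mul_outer (hr : |r| < 1) (s : ℝ) (F : ℝ → ℝ) (x : ℝ) :
    poisson r (x - s) * outer r s F x =
      (1 - r ^ 2) / 2 * ((1 + poisson r (x - s)) * F x + conjPoisson r (x - s) * hilb F x)
        + r * (cos (x - s) * poisson r (x - s)) * mean F := by
  unfold outer
  linear_combination F x * poisson_mul_one_sub_cos hr (x - s) + hilb F x * sin_mul_poisson r (x - s)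

/-- By `poisson_mul_outer` and HQ = P - 1, the function P · `outer` F is a multiple of Q HF + F HQ +
2F plus a multiple of cos · P. Cotlar's identity evaluates H on the first two summands. -/
theorem hilb_poisson_mul_outer (hr : |r| < 1) (s : ℝ) {F : ℝ → ℝ} (hF : SmoothPer F) (x : ℝ) :
    conjPoisson r (x - s) * outer r s F x
      + hilb (fun y => poisson r (y - s) * outer r s F y) x =
      hilb F x + r * (sin (x - s) * (F x - mean F) + cos (x - s) * hilb F x) := by
  have hp := (smoothPer_poisson hr).comp_sub s
  have hq := (smoothPer_conjPoisson hr).comp_sub s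
  have hHq : ∀ y, hilb (fun y => conjPoisson r (y - s)) y = poisson r (y - s) - 1 := fun y => by
    rw [hilb_comp_sub, hilb_conjPoisson hr]
  have hHp : ∀ y, hilb (fun y => poisson r (y - s)) y = -conjPoisson r (y - s) := fun y => by
    rw [hilb_comp_sub, hilb_poisson hr]
  have mq : mean (fun y => conjPoisson r (y - s)) = 0 := by
    have := mean_hilb hp
    rw [funext hHp, mean_neg] at this
    linarith
  have cot := hilb_cotlar hq hF x
  simp only [hHq, mq, zero_mul, add_zero] at cot
  have hFq := hq.mul hF.hilb
  have hFp := ((SmoothPer.const 1).add hp).mul hF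
  have hcp := (smoothPer_cos.comp_sub s).mul hp
  have e1 : hilb (fun y => (1 + poisson r (y - s)) * F y + conjPoisson r (y - s) * hilb F y) x =
      hilb F x + poisson r (x - s) * hilb F x - conjPoisson r (x - s) * F x := by
    have : (fun y => (1 + poisson r (y - s)) * F y + conjPoisson r (y - s) * hilb F y) =
        fun y => (conjPoisson r (y - s) * hilb F y + F y * (poisson r (y - s) - 1)) + 2 * F y := by
      funext y; ring
    rw [this, hilb_add (hFq.add (hF.mul (hp.sub (SmoothPer.const 1)))) ((SmoothPer.const 2).mul hF),
      cot, hilb_mul_left]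
    ring
  have e2 : hilb (fun y => cos (y - s) * poisson r (y - s)) x =
      -(cos (x - s) * conjPoisson r (x - s)) - sin (x - s) := by
    have := hilb_cos_sub_mul hp s x
    rw [hHp, mean_comp_sub (f := fun y => sin y * poisson r y)
      (smoothPer_sin.mul (smoothPer_poisson hr)).periodic, mean_sin_poisson,
      mean_comp_sub (smoothPer_poisson hr).periodic, mean_poisson hr] at this
    rw [this]; ring
  have e3 : hilb (fun y => poisson r (y - s) * outer r s F y) x =
      (1 - r ^ 2) / 2 * (hilb F x + poisson r (x - s) * hilb F x - conjPoisson r (x - s) * F x)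
        + r * mean F * (-(cos (x - s) * conjPoisson r (x - s)) - sin (x - s)) := by
    rw [← e1, ← e2, ← hilb_mul_left, ← hilb_mul_left, ← hilb_add
      ((SmoothPer.const _).mul (hFp.add hFq)) ((SmoothPer.const _).mul hcp)]
    congr 1; funext y
    rw [poisson_mul_outer hr]; ring
  rw [e3]
  unfold outer
  linear_combination F x * one_sub_cos_mul_conjPoisson hr (x - s)
    + F x * sin_mul_poisson r (x - s)
    - hilb F x * poisson_mul_one_sub_cos hr (x - s) + hilb F x * poisson_conjPoisson_sum hr (x - s)

/-- The intertwining relation behind the construction, in the case Δ = 0. It makes the conjugated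
operators keep the singular part cos(s/2) + sin(s/2) H. Angle addition reduces it to
`hilb_poisson_mul_outer`. -/
theorem outer_rotation (hr : |r| < 1) (s : ℝ) {F : ℝ → ℝ} (hF : SmoothPer F) (x : ℝ) :
    cos (s / 2) * outer r 0 F x + sin (s / 2) * outer r 0 (hilb F) x =
      (cos (s / 2) + sin (s / 2) * conjPoisson r (x - s)) * outer r s F x
        + hilb (fun y => sin (s / 2) * poisson r (y - s) * outer r s F y) x := by
  simp only [mul_assoc (sin (s / 2)), hilb_mul_left]
  have h := hilb_poisson_mul_outer hr s hF x
  have e1 : cos (s / 2) * cos x + sin (s / 2) * sin x =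
      cos (s / 2) * cos (x - s) - sin (s / 2) * sin (x - s) := by
    have h1 := cos_sub x (s / 2)
    have h2 := cos_add (x - s) (s / 2)
    rw [show x - s + s / 2 = x - s / 2 by ring] at h2
    linear_combination h2 - h1
  have e2 : cos (s / 2) * sin x - sin (s / 2) * cos x =
      cos (s / 2) * sin (x - s) + sin (s / 2) * cos (x - s) := by
    have h1 := sin_sub x (s / 2)
    have h2 := sin_add (x - s) (s / 2)
    rw [show x - s + s / 2 = x - s / 2 by ring] at h2
    linear_combination h2 - h1
  have e3 : outer r 0 (hilb F) x = hilb F x - r * (cos x * hilb F x + sin x * (F x - mean F)) := by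
    unfold outer
    rw [mean_hilb hF, hilb_hilb hF, sub_zero]; ring
  have e4 : outer r 0 F x = F x - r * (cos x * (F x - mean F) - sin x * hilb F x) := by
    unfold outer; rw [sub_zero]
  have e5 : outer r s F x =
      F x - r * (cos (x - s) * (F x - mean F) - sin (x - s) * hilb F x) := rfl
  rw [e3, e4]
  linear_combination -sin (s / 2) * h - r * (F x - mean F) * e1 + r * hilb F x * e2
    - cos (s / 2) * e5

/-- If `outer r 0 F` vanishes, `hilb_poisson_mul_outer` gives the companion relation `key`. Applying
H to it and subtracting the result from the hypothesis shows that 2F is constant, and on constants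
`outer` is the identity. -/
theorem outer_injective (hr : |r| < 1) {F : ℝ → ℝ} (hF : SmoothPer F)
    (h : ∀ x, outer r 0 F x = 0) (x : ℝ) : F x = 0 := by
  have key : ∀ x, hilb F x + r * (sin x * (F x - mean F) + cos x * hilb F x) = 0 := fun x => by
    have := hilb_poisson_mul_outer hr 0 hF x
    simp only [h, mul_zero, hilb_const, add_zero, sub_zero] at this
    exact this.symm
  have hF0 := hF.sub (SmoothPer.const (mean F))
  have m0 : mean (fun x => F x - mean F) = 0 := by
    rw [mean_sub hF.continuous continuous_const, mean_const, sub_self]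
  have hH0 : ∀ x, hilb (fun x => F x - mean F) x = hilb F x := fun x => by
    rw [hilb_sub hF (SmoothPer.const _), hilb_const, sub_zero]
  have s1 := smoothPer_sin.mul hF0
  have s2 := smoothPer_cos.mul hF.hilb
  obtain ⟨C, hC⟩ : ∃ C, ∀ x, 2 * F x = C := by
    refine ⟨mean F + r * ((mean fun y => cos y * (F y - mean F)) -
      mean fun y => sin y * hilb F y), fun x => ?_⟩
    have h1 := congrArg (fun f => hilb f x) (funext key)
    simp only [hilb_const] at h1
    rw [hilb_add hF.hilb ((SmoothPer.const r).mul (s1.add s2)), hilb_mul_left, hilb_add s1 s2,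
      hilb_sin_mul hF0, hilb_cos_mul hF.hilb, hilb_hilb hF, hH0, m0, mean_hilb hF] at h1
    have h2 := h x
    unfold outer at h2
    rw [sub_zero] at h2
    linear_combination h2 - h1
  have hF1 : F = fun _ => C / 2 := funext fun x => by linarith [hC x]
  have h2 := h x
  unfold outer at h2
  have h3 : hilb F x = 0 := by rw [hF1, hilb_const]
  have h4 : F x = mean F := by rw [hF1, mean_const]
  rw [h3, ← h4] at h2
  linarith

/-- The weighted average `mean (P_r φ)`, extended by `φ 0` to `r = 1`. -/
def poissonMean (r : ℝ) (φ : ℝ → ℝ) : ℝ :=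
  if r < 1 then mean fun u => poisson r u * φ u else φ 0

/-- The function to which the inverse of `outer r 0` is applied, in the other variable, to obtain
the deformed kernel; its defining formula makes sense for `r = 1`. -/
def innerKernel (r α : ℝ) (g : ℝ → ℝ) (y : ℝ) : ℝ :=
  g y + r * poissonMean r fun u => sin ((α - u - y) / 2) * quot g (u + α) y

/-- A formula for `outerInv` that makes sense for `r = 1`. -/
def outerInvExt (r : ℝ) (u : ℝ → ℝ) (x : ℝ) : ℝ :=
  poissonMean r (fun ξ => u ξ + u x - cos ((ξ - x) / 2) * quot (hilb u) ξ x) / 2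

/-- The Hilbert transform as an integral against `cot ((ξ - x) / 2)`. -/
theorem mean_mul_cos_mul_quot {p g : ℝ → ℝ} (hp : SmoothPer p) (hg : SmoothPer g) (x : ℝ) :
    mean (fun ξ => p ξ * (cos ((ξ - x) / 2) * quot g ξ x)) =
      hilb (fun ξ => p ξ * g ξ) x - g x * hilb p x := by
  have hper : Function.Periodic (fun ξ => p ξ * (cos ((ξ - x) / 2) * quot g ξ x)) (2 * π) := by
    intro ξ
    have e : (ξ + 2 * π - x) / 2 = (ξ - x) / 2 + π := by ring
    simp only [hp.periodic ξ, quot_add_left hg.periodic, e, cos_add_pi, neg_mul_neg]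
  have c1 := continuous_hilb_integrand_right (hp.mul hg) x
  have c2 := continuous_hilb_integrand_right hp x
  rw [← mean_comp_add hper x]
  unfold hilb
  rw [← mean_mul_left, ← mean_sub c1 (by fun_prop)]
  refine mean_congr fun u hu => ?_
  have hne := (sin_half_pos hu).ne'
  simp only [quot, add_sub_cancel_left, if_neg hne, smul_eq_mul, add_comm u x]
  ring

/-- The right side is the transpose of F ↦ P(· - α) `outer r α F` applied to g, but its separate
terms have no meaning at r = 1. Splitting sin((ξ - y)/2 - (ξ - α)) exhibits it as a Poisson average,
which does extend. -/
theorem innerKernel_eq (hr : |r| < 1) (α : ℝ) {g : ℝ → ℝ} (hg : SmoothPer g) (y : ℝ) :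
    innerKernel r α g y = (1 - r ^ 2) / 2 * ((1 + poisson r (y - α)) * g y
      - hilb (fun y => conjPoisson r (y - α) * g y) y)
      + r * mean fun y => cos (y - α) * poisson r (y - α) * g y := by
  have hr1 : r < 1 := (abs_lt.1 hr).2
  have hp := (smoothPer_poisson hr).comp_sub α
  have hq := (smoothPer_conjPoisson hr).comp_sub α
  have hcp := ((smoothPer_cos.comp_sub α).mul hp)
  have hsp := ((smoothPer_sin.comp_sub α).mul hp)
  unfold innerKernel poissonMean
  rw [if_pos hr1]
  have hper : Function.Periodic (fun u => poisson r u *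
      (sin ((α - u - y) / 2) * quot g (u + α) y)) (2 * π) := by
    intro u
    have e : (α - (u + 2 * π) - y) / 2 = (α - u - y) / 2 - π := by ring
    simp only [(smoothPer_poisson hr).periodic u, show u + 2 * π + α = u + α + 2 * π by ring,
      quot_add_left hg.periodic, e, sin_sub_pi, neg_mul_neg]
  have hqc : Continuous fun ξ => quot g ξ y :=
    (continuous_quot hg).comp (f := fun ξ : ℝ => (ξ, y)) (by fun_prop)
  have e1 : (mean fun u => poisson r u * (sin ((α - u - y) / 2) * quot g (u + α) y)) =
      mean fun ξ => (cos (ξ - α) * poisson r (ξ - α) * g ξ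
        - g y * (cos (ξ - α) * poisson r (ξ - α)))
        - sin (ξ - α) * poisson r (ξ - α) * (cos ((ξ - y) / 2) * quot g ξ y) := by
    rw [← mean_comp_add hper (-α)]
    congr 1; funext ξ
    have h1 : (α - (ξ + -α) - y) / 2 = (ξ - y) / 2 - (ξ - α) := by ring
    have h2 := sin_smul_quot hg.periodic ξ y
    rw [smul_eq_mul] at h2
    rw [h1, sin_sub, ← sub_eq_add_neg, sub_add_cancel]
    linear_combination poisson r (ξ - α) * cos (ξ - α) * h2
  have c1 := (hcp.mul hg).continuous
  have c2 := hcp.continuous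
  have c3 := hsp.continuous
  have e2 : (mean fun ξ => cos (ξ - α) * poisson r (ξ - α)) = r := by
    rw [mean_comp_sub (f := fun y => cos y * poisson r y)
      (smoothPer_cos.mul (smoothPer_poisson hr)).periodic, mean_cos_poisson hr]
  rw [e1, mean_sub (by fun_prop) (by fun_prop), mean_sub c1 (by fun_prop), mean_mul_left, e2,
    mean_mul_cos_mul_quot hsp hg]
  have e3 : ∀ y, r * hilb (fun ξ => sin (ξ - α) * poisson r (ξ - α)) y =
      (1 - r ^ 2) / 2 * (poisson r (y - α) - 1) := by
    intro y
    rw [← hilb_conjPoisson hr, ← hilb_comp_sub, ← hilb_mul_left, ← hilb_mul_left]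
    congr 1; funext z
    rw [← sin_mul_poisson]; ring
  have e4 : r * hilb (fun ξ => sin (ξ - α) * poisson r (ξ - α) * g ξ) y =
      (1 - r ^ 2) / 2 * hilb (fun y => conjPoisson r (y - α) * g y) y := by
    rw [← hilb_mul_left, ← hilb_mul_left]
    congr 1; funext z
    linear_combination g z * sin_mul_poisson r (z - α)
  linear_combination g y * e3 y - e4

/-- Cotlar's identity for P and u replaces H(Qu), which degenerates at r = 1, by H(P Hu). The latter
becomes an average against P once the value at x is subtracted. -/
theorem outerInvExt_eq (hr : |r| < 1) {u : ℝ → ℝ} (hu : SmoothPer u) (x : ℝ) :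
    outerInvExt r u x = outerInv r u x := by
  have hr1 : r < 1 := (abs_lt.1 hr).2
  have hp := smoothPer_poisson hr
  unfold outerInvExt poissonMean outerInv
  rw [if_pos hr1]
  have hqc : Continuous fun ξ => quot (hilb u) ξ x :=
    (continuous_quot hu.hilb).comp (f := fun ξ : ℝ => (ξ, x)) (by fun_prop)
  have c1 := hp.continuous
  have c2 := hu.continuous
  have e1 : (mean fun ξ => poisson r ξ * (u ξ + u x - cos ((ξ - x) / 2) * quot (hilb u) ξ x)) =
      (mean fun ξ => poisson r ξ * u ξ) + u x
        - (hilb (fun ξ => poisson r ξ * hilb u ξ) x - hilb u x * hilb (poisson r) x) := by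
    rw [← mean_mul_cos_mul_quot hp hu.hilb]
    have e : u x = mean fun ξ => poisson r ξ * u x := by
      rw [mean_mul_right, mean_poisson hr, one_mul]
    conv_rhs => rw [e]
    rw [← mean_add (by fun_prop) (by fun_prop), ← mean_sub (by fun_prop) (by fun_prop)]
    congr 1; funext ξ; ring
  have cot := hilb_cotlar hp hu x
  have s1 := hp.mul hu.hilb
  have s2 := (smoothPer_conjPoisson hr).mul hu
  have e2 : hilb (fun x => poisson r x * hilb u x + u x * hilb (poisson r) x) x =
      hilb (fun ξ => poisson r ξ * hilb u ξ) x - hilb (fun y => conjPoisson r y * u y) x := by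
    rw [← hilb_sub s1 s2]
    congr 1; funext y
    rw [hilb_poisson hr]; ring
  rw [e2, mean_poisson hr] at cot
  have e3 : (mean fun y => (poisson r y - 1) * u y) =
      (mean fun ξ => poisson r ξ * u ξ) - mean u := by
    rw [← mean_sub (by fun_prop) (by fun_prop)]
    congr 1; funext y; ring
  rw [e1, e3]
  linear_combination -cot / 2

/-- At radius 1 the average is evaluation at u = 0, and sin((α - y)/2) cancels the denominator of
the divided difference. All dependence on y disappears. -/
theorem innerKernel_one (α : ℝ) {g : ℝ → ℝ} (hg : SmoothPer g) (y : ℝ) :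
    innerKernel 1 α g y = g α := by
  have h := sin_smul_quot hg.periodic α y
  simp only [innerKernel, poissonMean, lt_irrefl, if_false, sub_zero, zero_add, one_mul]
  rw [smul_eq_mul] at h
  linarith

end Operators

end OuterOperators

/-! ### Smoothness of Poisson means up to radius 1. -/

section PoissonMeans

section Partials

variable {E : Type*} [NormedAddCommGroup E] [NormedSpace ℝ E] [FiniteDimensional ℝ E]

/-- A class of continuous functions on `ℝ × E` consists of smooth functions if its partial
derivatives are built from the class by operations preserving differentiability. -/
theorem contDiff_of_partials {P : (ℝ × E → ℝ) → Prop} (hc : ∀ f, P f → Continuous f)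
    (h₁ : ∀ f, P f → ∃ g : ℝ × E → ℝ,
      (∀ n : ℕ, (∀ f, P f → ContDiff ℝ n f) → ContDiff ℝ n g) ∧
      ∀ t p, HasDerivAt (fun t => f (t, p)) (g (t, p)) t)
    (h₂ : ∀ f, P f → (∀ t p, DifferentiableAt ℝ (fun p => f (t, p)) p) ∧
      ∀ w, ∃ g : ℝ × E → ℝ,
        (∀ n : ℕ, (∀ f, P f → ContDiff ℝ n f) → ContDiff ℝ n g) ∧
        ∀ t p, fderiv ℝ (fun p => f (t, p)) p w = g (t, p))
    {f : ℝ × E → ℝ} (hf : P f) : ContDiff ℝ ∞ f := by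
  rw [contDiff_infty]
  intro n
  have h0 : ∀ f, P f → ContDiff ℝ ((0 : ℕ) : WithTop ℕ∞) f := fun f hf => by
    exact_mod_cast contDiff_zero.2 (hc f hf)
  induction n generalizing f with
  | zero => exact h0 f hf
  | succ n ih =>
    obtain ⟨g, hg, hgd⟩ := h₁ f hf
    obtain ⟨hd, hw⟩ := h₂ f hf
    choose k hk hkd using hw
    have hgc : Continuous g := (hg 0 h0).continuous
    -- Continuous partial derivatives in the two factors give joint differentiability.
    have hfd : ∀ q : ℝ × E, HasStrictFDerivAt f
        ((ContinuousLinearMap.toSpanSingleton ℝ (g q)).coprod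
          (fderiv ℝ (fun p => f (q.1, p)) q.2)) q := by
      intro q
      refine hasStrictFDerivAt_uncurry_coprod (𝕜 := ℝ) (u := q) (f := fun t p => f (t, p))
        (f₁ := fun t p => ContinuousLinearMap.toSpanSingleton ℝ (g (t, p)))
        (f₂ := fun t p => fderiv ℝ (fun p => f (t, p)) p) ?_ ?_ ?_ ?_
      · exact Eventually.of_forall fun v => (hgd v.1 v.2).hasFDerivAt
      · exact Eventually.of_forall fun v => (hd v.1 v.2).hasFDerivAt
      · have : Continuous fun v : ℝ × E => ContinuousLinearMap.toSpanSingleton ℝ (g v) := by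
          rw [continuous_clm_apply]
          intro y
          simp only [ContinuousLinearMap.toSpanSingleton_apply]
          exact Continuous.smul (continuous_const (y := y)) hgc
        exact this.continuousAt
      · have : Continuous fun v : ℝ × E => fderiv ℝ (fun p => f (v.1, p)) v.2 := by
          rw [continuous_clm_apply]
          intro w
          simp only [hkd]
          exact (hk w 0 h0).continuous
        exact this.continuousAt
    push_cast
    rw [contDiff_succ_iff_fderiv_apply]
    refine ⟨fun q => (hfd q).hasFDerivAt.differentiableAt, by simp, fun y => ?_⟩
    have : (fun q => fderiv ℝ f q y) = fun q => y.1 * g q + k y.2 q := by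
      funext q
      rw [(hfd q).hasFDerivAt.fderiv]
      simp [ContinuousLinearMap.coprod_apply, hkd]
    rw [this]
    exact (contDiff_const.mul (hg n fun f hf => ih hf)).add (hk _ n fun f hf => ih hf)

end Partials

section PoissonMean

variable {E : Type*} [NormedAddCommGroup E] [NormedSpace ℝ E] [FiniteDimensional ℝ E]

/-- The generator of the semigroup of Poisson means. -/
def poissonGen (φ : ℝ → ℝ) (u : ℝ) : ℝ := -(cos u * hilb (deriv φ) u) - sin u * deriv φ u

theorem SmoothPer.deriv {φ : ℝ → ℝ} (hφ : SmoothPer φ) : SmoothPer (deriv φ) :=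
  ⟨(contDiff_infty_iff_deriv.1 hφ.smooth).2, periodic_deriv hφ.periodic⟩

theorem mean_deriv_mul {a b : ℝ → ℝ} (ha : SmoothPer a) (hb : SmoothPer b) :
    mean (fun u => deriv a u * b u) = -mean fun u => a u * deriv b u := by
  have h := intervalIntegral.integral_deriv_mul_eq_sub (a := 0) (b := 2 * π) (u := a) (v := b)
    (u' := deriv a) (v' := deriv b)
    (fun x _ => (ha.smooth.differentiable (by simp) x).hasDerivAt)
    (fun x _ => (hb.smooth.differentiable (by simp) x).hasDerivAt)
    (ha.deriv.continuous.intervalIntegrable _ _) (hb.deriv.continuous.intervalIntegrable _ _)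
  have e1 := ha.periodic 0
  have e2 := hb.periodic 0
  rw [zero_add] at e1 e2
  rw [e1, e2, sub_self] at h
  rw [eq_neg_iff_add_eq_zero, ← mean_add (ha.deriv.mul hb).continuous (ha.mul hb.deriv).continuous]
  unfold mean
  rw [h, smul_zero]

theorem hasDerivAt_poisson {r : ℝ} (hr : |r| < 1) (u : ℝ) :
    HasDerivAt (fun r => poisson r u)
      ((2 * cos u * (1 + r ^ 2) - 4 * r) / poissonDenom r u ^ 2) r := by
  have hne := (poissonDenom_pos hr u).ne'
  have h1 : HasDerivAt (fun r => poissonDenom r u) (-(2 * cos u) + 2 * r) r := by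
    have := (((hasDerivAt_id r).const_mul (2 * cos u)).const_sub 1).add ((hasDerivAt_id r).pow 2)
    refine (this.congr_deriv (by simp)).congr_of_eventuallyEq (Eventually.of_forall fun s => ?_)
    simp [poissonDenom]; ring
  have h2 : HasDerivAt (fun r : ℝ => 1 - r ^ 2) (-(2 * r)) r := by
    have := ((hasDerivAt_id r).pow 2).const_sub 1
    exact this.congr_deriv (by simp)
  refine (h2.div h1 hne).congr_deriv ?_
  congr 1
  unfold poissonDenom
  ring

/-- The r-derivative of P is the u-derivative of 2 sin u divided by the denominator, so integration
by parts applies, and H(cos · P) = -cos · Q - sin gives the generator. Its factors cos and sin lower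
the modulus of each mode by one, which takes the place of a division by r and keeps r = 0 regular.
-/
theorem mean_deriv_poisson {r : ℝ} (hr : |r| < 1) {φ : ℝ → ℝ} (hφ : SmoothPer φ) :
    mean (fun u => (2 * cos u * (1 + r ^ 2) - 4 * r) / poissonDenom r u ^ 2 * φ u) =
      mean fun u => poisson r u * poissonGen φ u := by
  have hp := smoothPer_poisson hr
  have hs : SmoothPer fun u => 2 * sin u / poissonDenom r u :=
    ⟨(by fun_prop : ContDiff ℝ ∞ fun v => 2 * sin v).div contDiff_poissonDenom
      fun v => (poissonDenom_pos hr v).ne', fun v => by simp [poissonDenom]⟩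
  have hd : ∀ u, deriv (fun u => 2 * sin u / poissonDenom r u) u =
      (2 * cos u * (1 + r ^ 2) - 4 * r) / poissonDenom r u ^ 2 := by
    intro u
    have h1 : HasDerivAt (fun u => poissonDenom r u) (2 * r * sin u) u := by
      have := (((hasDerivAt_cos u).const_mul (2 * r)).const_sub 1).add_const (r ^ 2)
      exact this.congr_deriv (by ring)
    have h2 := ((hasDerivAt_sin u).const_mul 2).div h1 (poissonDenom_pos hr u).ne'
    have h3 : HasDerivAt (fun u => 2 * sin u / poissonDenom r u) _ u := h2
    rw [h3.deriv]
    congr 1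
    unfold poissonDenom
    linear_combination (-4 * r) * sin_sq_add_cos_sq u
  have e1 := mean_deriv_mul hs hφ
  simp only [hd] at e1
  have hcp := smoothPer_cos.mul hp
  have e2 := mean_mul_hilb hcp hφ.deriv
  have e3 : ∀ u, hilb (fun u => cos u * poisson r u) u =
      -(cos u * conjPoisson r u) - sin u := fun u => by
    rw [hilb_cos_mul hp, hilb_poisson hr, mean_sin_poisson, mean_poisson hr]; ring
  simp only [e3] at e2
  have c1 := hcp.mul hφ.deriv.hilb
  have c2 := (smoothPer_sin.mul hp).mul hφ.deriv
  have c3 := ((smoothPer_cos.mul (smoothPer_conjPoisson hr)).neg.sub smoothPer_sin).mul hφ.deriv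
  have e4 : (mean fun u => poisson r u * poissonGen φ u) =
      -(mean fun u => cos u * poisson r u * hilb (deriv φ) u)
        - mean fun u => sin u * poisson r u * deriv φ u := by
    rw [← mean_neg, ← mean_sub c1.neg.continuous c2.continuous]
    congr 1; funext u; unfold poissonGen; ring
  rw [e1, e4, e2, neg_neg, ← mean_sub c3.continuous c2.continuous, ← mean_neg]
  congr 1; funext u
  have hne := (poissonDenom_pos hr u).ne'
  unfold poisson conjPoisson
  field_simp
  unfold poissonDenom
  ring

theorem hasDerivAt_poissonMean {r : ℝ} (hr : |r| < 1) {φ : ℝ → ℝ} (hφ : SmoothPer φ) :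
    HasDerivAt (fun r => poissonMean r φ) (poissonMean r (poissonGen φ)) r := by
  have hr1 : r < 1 := (abs_lt.1 hr).2
  obtain ⟨ε, hε, hball⟩ : ∃ ε > 0, Metric.closedBall r ε ⊆ {s | |s| < 1} :=
    Metric.nhds_basis_closedBall.mem_iff.1
      ((isOpen_lt continuous_abs continuous_const).mem_nhds hr)
  have hD : Continuous fun q : ℝ × ℝ => poissonDenom q.1 q.2 := by unfold poissonDenom; fun_prop
  set F' : ℝ → ℝ → ℝ := fun r u =>
    (2 * cos u * (1 + r ^ 2) - 4 * r) / poissonDenom r u ^ 2 * φ u with hF'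
  have hcont : ContinuousOn (fun q : ℝ × ℝ => F' q.1 q.2)
      (Metric.closedBall r ε ×ˢ uIcc 0 (2 * π)) := by
    have hφc := hφ.continuous
    refine ContinuousOn.mul (ContinuousOn.div (by fun_prop) (by fun_prop) ?_) (by fun_prop)
    rintro ⟨s, u⟩ ⟨hs, _⟩
    exact pow_ne_zero 2 (poissonDenom_pos (hball hs) u).ne'
  obtain ⟨C, hC⟩ := ((isCompact_closedBall r ε).prod isCompact_uIcc).exists_bound_of_continuousOn
    hcont
  have hPc : ∀ s, |s| < 1 → Continuous fun u => poisson s u * φ u := fun s hs =>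
    ((smoothPer_poisson hs).mul hφ).continuous
  have hder := (intervalIntegral.hasDerivAt_integral_of_dominated_loc_of_deriv_le
    (μ := volume) (a := 0) (b := 2 * π) (F := fun r u => poisson r u * φ u) (F' := F') (x₀ := r)
    (s := Metric.closedBall r ε) (bound := fun _ => C) (Metric.closedBall_mem_nhds r hε)
    ((eventually_of_mem (Metric.closedBall_mem_nhds r hε) fun s hs =>
      (hPc s (hball hs)).aestronglyMeasurable))
    ((hPc r hr).intervalIntegrable _ _)
    (by
      refine Continuous.aestronglyMeasurable ?_
      have hφc := hφ.continuous
      refine Continuous.mul (Continuous.div (by fun_prop) ?_ fun u =>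
        pow_ne_zero 2 (poissonDenom_pos hr u).ne') hφc
      exact (contDiff_poissonDenom.continuous).pow 2)
    (Eventually.of_forall fun u hu s hs => hC (s, u) ⟨hs, uIoc_subset_uIcc hu⟩)
    intervalIntegrable_const
    (Eventually.of_forall fun u _ s hs =>
      (hasDerivAt_poisson (hball hs) u).mul_const (φ u))).2
  have h2 := hder.const_smul (2 * π)⁻¹
  have e : poissonMean r (poissonGen φ) = (2 * π)⁻¹ • ∫ u in (0 : ℝ)..(2 * π), F' r u := by
    unfold poissonMean
    rw [if_pos hr1, ← mean_deriv_poisson hr hφ]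
    rfl
  rw [e]
  refine h2.congr_of_eventuallyEq ?_
  filter_upwards [isOpen_Iio.mem_nhds hr1] with s hs
  unfold poissonMean
  rw [if_pos (mem_Iio.1 hs)]
  rfl

theorem abs_mean_le {f g : ℝ → ℝ} (hf : Continuous f) (hg : Continuous g)
    (h : ∀ u ∈ Icc 0 (2 * π), |f u| ≤ g u) : |mean f| ≤ mean g := by
  unfold mean
  rw [smul_eq_mul, smul_eq_mul, abs_mul, abs_of_pos (inv_pos.2 two_pi_pos)]
  refine mul_le_mul_of_nonneg_left ?_ (inv_pos.2 two_pi_pos).le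
  exact (intervalIntegral.abs_integral_le_integral_abs two_pi_pos.le).trans
    (intervalIntegral.integral_mono_on two_pi_pos.le (hf.abs.intervalIntegrable _ _)
      (hg.intervalIntegrable _ _) h)

/-- With s = |sin(u/2)| and ε = √(1 - r), one has s ≤ ε/2 + s²/(2ε), and the Poisson mean of
sin²(u/2) is exactly (1 - r)/2. -/
theorem abs_poissonMean_sub_le {r : ℝ} (h0 : 0 ≤ r) (h1 : r ≤ 1) {φ : ℝ → ℝ} (hφ : SmoothPer φ)
    {C : ℝ} (hC : ∀ u ∈ Icc 0 (2 * π), |φ u - φ 0| ≤ C * |sin (u / 2)|) (hC0 : 0 ≤ C) :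
    |poissonMean r φ - φ 0| ≤ C * √(1 - r) := by
  rcases h1.lt_or_eq with hlt | rfl
  · have hr : |r| < 1 := by rw [abs_of_nonneg h0]; exact hlt
    have hp := smoothPer_poisson hr
    set ε := √(1 - r) with hε
    have hεpos : 0 < ε := sqrt_pos.2 (by linarith)
    have hεsq : ε ^ 2 = 1 - r := sq_sqrt (by linarith)
    have c1 := hp.continuous
    have c2 := hφ.continuous
    unfold poissonMean
    rw [if_pos hlt]
    have e1 : (mean fun u => poisson r u * φ u) - φ 0 =
        mean fun u => poisson r u * (φ u - φ 0) := by
      simp only [mul_sub]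
      rw [mean_sub (by fun_prop) (by fun_prop), mean_mul_right, mean_poisson hr, one_mul]
    have e2 : (mean fun u => C / 2 * ((ε + 1 / (2 * ε)) * poisson r u
        - 1 / (2 * ε) * (cos u * poisson r u))) = C / 2 * (ε + (1 - r) / (2 * ε)) := by
      rw [mean_mul_left, mean_sub (by fun_prop) (by fun_prop), mean_mul_left, mean_mul_left,
        mean_poisson hr, mean_cos_poisson hr]
      ring
    rw [e1]
    refine (abs_mean_le (g := fun u => C / 2 * ((ε + 1 / (2 * ε)) * poisson r u
        - 1 / (2 * ε) * (cos u * poisson r u))) (by fun_prop) (by fun_prop) fun u hu => ?_).trans ?_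
    · rw [abs_mul, abs_of_nonneg (poisson_nonneg hr u)]
      have hP := poisson_nonneg hr u
      set s := |sin (u / 2)| with hs
      have hs2 : s ^ 2 = (1 - cos u) / 2 := by
        rw [hs, sq_abs, sin_sq_eq_half_sub, show 2 * (u / 2) = u by ring]; ring
      have h3 : s ≤ ε / 2 + s ^ 2 / (2 * ε) := by
        have : 0 ≤ (s - ε) ^ 2 / (2 * ε) := by positivity
        have e : (s - ε) ^ 2 / (2 * ε) = ε / 2 + s ^ 2 / (2 * ε) - s := by
          field_simp; ring
        linarith
      calc poisson r u * |φ u - φ 0| ≤ poisson r u * (C * s) :=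
            mul_le_mul_of_nonneg_left (hC u hu) hP
        _ ≤ poisson r u * (C * (ε / 2 + s ^ 2 / (2 * ε))) := by gcongr
        _ = _ := by rw [hs2]; ring
    · rw [e2, ← hεsq]
      have : C / 2 * (ε + ε ^ 2 / (2 * ε)) = 3 / 4 * (C * ε) := by field_simp; ring
      rw [this]
      nlinarith [mul_nonneg hC0 hεpos.le]
  · simp [poissonMean]

variable {ρ : ℝ → ℝ}

theorem continuous_poissonMean {X : Type*} [TopologicalSpace X] [LocallyCompactSpace X]
    (hρ : Continuous ρ) (h0 : ∀ t, 0 ≤ ρ t)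
    (h1 : ∀ t, ρ t ≤ 1) {φ : X × ℝ → ℝ} (hφc : Continuous φ) (hφ : ∀ p, SmoothPer fun u => φ (p, u))
    (hq : Continuous fun q : X × ℝ => quot (fun u => φ (q.1, u)) q.2 0) :
    Continuous fun q : ℝ × X => poissonMean (ρ q.1) fun u => φ (q.2, u) := by
  rw [continuous_iff_continuousAt]
  rintro ⟨t, p⟩
  rcases (h1 t).lt_or_eq with hlt | heq
  -- Cutting the radius off at r₁ < 1 changes nothing near t and keeps the denominator positive
  -- everywhere.
  · obtain ⟨r₁, hr1, hr2⟩ := exists_between hlt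
    have hr0 : 0 ≤ r₁ := (h0 t).trans hr1.le
    have hlt' : ∀ t, |min (ρ t) r₁| < 1 := fun t => by
      rw [abs_of_nonneg (le_min (h0 t) hr0)]
      exact (min_le_right _ _).trans_lt hr2
    have hc : Continuous fun q : (ℝ × X) × ℝ => poisson (min (ρ q.1.1) r₁) q.2 * φ (q.1.2, q.2) := by
      refine Continuous.mul ?_ (hφc.comp (f := fun q : (ℝ × X) × ℝ => (q.1.2, q.2)) (by fun_prop))
      unfold poisson
      refine Continuous.div (by fun_prop) ?_ fun q => (poissonDenom_pos (hlt' q.1.1) q.2).ne'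
      unfold poissonDenom
      fun_prop
    refine (continuous_mean hc).continuousAt.congr ?_
    have hev : ∀ᶠ q : ℝ × X in 𝓝 (t, p), ρ q.1 < r₁ :=
      (isOpen_lt (hρ.comp continuous_fst) continuous_const).mem_nhds hr1
    filter_upwards [hev] with q hq
    unfold poissonMean
    rw [if_pos (hq.trans hr2), min_eq_left hq.le]
  -- Near radius 1 the divided difference at 0 is bounded uniformly for parameters in K, so the
  -- estimate of order √(1 - ρ) is locally uniform.
  · obtain ⟨K, hK, hKp⟩ := exists_compact_mem_nhds p
    obtain ⟨C, hC⟩ := (hK.prod (isCompact_Icc (a := (0 : ℝ)) (b := 2 * π))).exists_bound_of_continuousOn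
      hq.continuousOn
    have hC0 : 0 ≤ C := (norm_nonneg _).trans
      (hC (p, 0) ⟨mem_of_mem_nhds hKp, left_mem_Icc.2 two_pi_pos.le⟩)
    have hlim : Tendsto (fun q : ℝ × X => poissonMean (ρ q.1) (fun u => φ (q.2, u)) - φ (q.2, 0))
        (𝓝 (t, p)) (𝓝 0) := by
      have hsq : Tendsto (fun q : ℝ × X => C * √(1 - ρ q.1)) (𝓝 (t, p)) (𝓝 0) := by
        have : Continuous fun q : ℝ × X => C * √(1 - ρ q.1) := by fun_prop
        convert this.tendsto (t, p) using 2
        simp [heq]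
      refine squeeze_zero_norm' ?_ hsq
      filter_upwards [continuous_snd.continuousAt.preimage_mem_nhds hKp] with q hq
      refine abs_poissonMean_sub_le (h0 _) (h1 _) (hφ q.2) (fun u hu => ?_) hC0
      have h := sin_smul_quot (hφ q.2).periodic u 0
      rw [sub_zero, smul_eq_mul] at h
      rw [← h, abs_mul, mul_comm]
      exact mul_le_mul_of_nonneg_right (hC (q.2, u) ⟨hq, hu⟩) (abs_nonneg _)
    have hc0 : Continuous fun q : ℝ × X => φ (q.2, 0) :=
      hφc.comp (f := fun q : ℝ × X => (q.2, (0 : ℝ))) (by fun_prop)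
    have := hlim.add hc0.continuousAt
    simp only [sub_add_cancel, zero_add] at this
    have e : poissonMean (ρ t) (fun u => φ (p, u)) = φ (p, 0) := by
      simp [poissonMean, heq]
    rw [ContinuousAt]
    simpa only [e] using this

/-- Joint smoothness of Poisson means up to the boundary. -/
theorem contDiff_poissonMean (hρ : ContDiff ℝ ∞ ρ) (h0 : ∀ t, 0 ≤ ρ t) (h1 : ∀ t, ρ t ≤ 1)
    {t₀ : ℝ} (ht : ∀ t, ρ t = 1 ↔ t₀ ≤ t) {φ : E × ℝ → ℝ} (hφ : ContDiff ℝ ∞ φ)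
    (hper : ∀ p, Function.Periodic (fun u => φ (p, u)) (2 * π)) :
    ContDiff ℝ ∞ fun q : ℝ × E => poissonMean (ρ q.1) fun u => φ (q.2, u) := by
  have hproper : ProperSpace E := FiniteDimensional.proper_real E
  have hsm : ∀ {φ : E × ℝ → ℝ}, ContDiff ℝ ∞ φ → ∀ p, ContDiff ℝ ∞ fun u => φ (p, u) :=
    fun hφ p => hφ.comp (by fun_prop)
  have hcont : ∀ {φ : E × ℝ → ℝ}, ContDiff ℝ ∞ φ →
      (∀ p, Function.Periodic (fun u => φ (p, u)) (2 * π)) →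
      Continuous fun q : ℝ × E => poissonMean (ρ q.1) fun u => φ (q.2, u) := by
    intro φ hφ hper
    refine continuous_poissonMean hρ.continuous h0 h1 hφ.continuous
      (fun p => ⟨hsm hφ p, hper p⟩) ?_
    exact (contDiff_quot hφ hper).continuous.comp
      (f := fun q : E × ℝ => (q.1, q.2, (0 : ℝ))) (by fun_prop)
  -- Poisson means form a class closed under derivatives in the parameter, and under the
  -- t-derivative up to the smooth factor ρ'.
  refine contDiff_of_partials (P := fun f => ∃ φ : E × ℝ → ℝ, ContDiff ℝ ∞ φ ∧
    (∀ p, Function.Periodic (fun u => φ (p, u)) (2 * π)) ∧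
    f = fun q : ℝ × E => poissonMean (ρ q.1) fun u => φ (q.2, u)) ?_ ?_ ?_ ⟨φ, hφ, hper, rfl⟩
  · rintro _ ⟨φ, hφ, hper, rfl⟩
    exact hcont hφ hper
  · rintro _ ⟨φ, hφ, hper, rfl⟩
    set Λ : E × ℝ → ℝ := fun q => poissonGen (fun u => φ (q.1, u)) q.2 with hΛ
    have hd := contDiff_deriv_snd hφ
    have hΛs : ContDiff ℝ ∞ Λ := by
      refine ContDiff.sub (ContDiff.neg (ContDiff.mul (by fun_prop) ?_)) (ContDiff.mul (by fun_prop) hd)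
      exact contDiff_hilb hd fun p => periodic_deriv (hper p)
    have hΛp : ∀ p, Function.Periodic (fun u => Λ (p, u)) (2 * π) := by
      intro p u
      simp only [hΛ, poissonGen, cos_add_two_pi, sin_add_two_pi,
        periodic_hilb (periodic_deriv (hper p)) u, periodic_deriv (hper p) u]
    refine ⟨fun q => deriv ρ q.1 * poissonMean (ρ q.1) fun u => Λ (q.2, u), fun n hn => ?_,
      fun t p => ?_⟩
    · refine ContDiff.mul ?_ (hn _ ⟨Λ, hΛs, hΛp, rfl⟩)
      exact ((contDiff_infty_iff_deriv.1 hρ).2.comp contDiff_fst).of_le (by exact_mod_cast le_top)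
    · have hc1 := (hcont hφ hper).comp (f := fun t : ℝ => (t, p)) (by fun_prop)
      have hc2 := (hcont hΛs hΛp).comp (f := fun t : ℝ => (t, p)) (by fun_prop)
      -- The derivative formula is clear on both sides of t₀. At t₀ itself it follows from the
      -- continuity of the function and of the candidate derivative.
      refine hasDerivAt_of_hasDerivAt_of_ne' (x := t₀)
        (f := fun t => poissonMean (ρ t) fun u => φ (p, u))
        (g := fun t => deriv ρ t * poissonMean (ρ t) fun u => Λ (p, u)) (fun s hs => ?_)
        hc1.continuousAt
        (((contDiff_infty_iff_deriv.1 hρ).2.continuous.mul hc2).continuousAt) t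
      rcases lt_or_gt_of_ne hs with hlt | hgt
      · have hρ1 : ρ s < 1 := lt_of_le_of_ne (h1 s) fun h => not_lt.2 ((ht s).1 h) hlt
        have hr : |ρ s| < 1 := by rw [abs_of_nonneg (h0 s)]; exact hρ1
        have := (hasDerivAt_poissonMean hr (φ := fun u => φ (p, u)) ⟨hsm hφ p, hper p⟩).comp s
          (hρ.differentiable (by simp) s).hasDerivAt
        exact this.congr_deriv (mul_comm _ _)
      · have hev : ∀ᶠ y in 𝓝 s, ρ y = 1 := by
          filter_upwards [isOpen_Ioi.mem_nhds hgt] with y hy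
          exact (ht y).2 (le_of_lt hy)
        have hd0 : deriv ρ s = 0 := by
          rw [EventuallyEq.deriv_eq (f := fun _ => (1 : ℝ)) hev]; simp
        rw [hd0, zero_mul]
        refine (hasDerivAt_const s (φ (p, 0))).congr_of_eventuallyEq ?_
        filter_upwards [hev] with y hy
        simp [poissonMean, hy]
  · rintro _ ⟨φ, hφ, hper, rfl⟩
    have key : ∀ t p, HasFDerivAt (fun p => poissonMean (ρ t) fun u => φ (p, u))
        (if ρ t < 1 then (2 * π)⁻¹ • ∫ u in (0 : ℝ)..(2 * π),
          (fderiv ℝ (fun q : E × ℝ => poisson (ρ t) q.2 * φ q) (p, u)).comp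
            (ContinuousLinearMap.inl ℝ E ℝ) else
          (fderiv ℝ φ (p, 0)).comp (ContinuousLinearMap.inl ℝ E ℝ)) p := by
      intro t p
      unfold poissonMean
      split_ifs with h
      · have hr : |ρ t| < 1 := by rw [abs_of_nonneg (h0 t)]; exact h
        have hs : ContDiff ℝ 1 fun q : E × ℝ => poisson (ρ t) q.2 * φ q :=
          (((smoothPer_poisson hr).smooth.comp contDiff_snd).mul hφ).of_le (by simp)
        have h3 := hasFDerivAt_intervalIntegral_of_contDiff hs 0 (2 * π) p
        exact h3.const_smul (2 * π)⁻¹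
      · exact ((hφ.differentiable (by simp) (p, 0)).hasFDerivAt).comp p
          (hasFDerivAt_prodMk_left p (0 : ℝ))
    refine ⟨fun t p => (key t p).differentiableAt, fun w => ?_⟩
    set ψ : E × ℝ → ℝ := fun q => fderiv ℝ φ q (w, 0) with hψ
    have hψs : ContDiff ℝ ∞ ψ := (hφ.fderiv_right (m := ∞) (by simp)).clm_apply contDiff_const
    have hψp : ∀ p, Function.Periodic (fun u => ψ (p, u)) (2 * π) := by
      intro p u
      have h : (fun q : E × ℝ => φ (q + ((0 : E), 2 * π))) = φ := by
        funext q
        have := hper q.1 q.2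
        simpa [Prod.add_def] using this
      have h2 := fderiv_comp_add_right (𝕜 := ℝ) (f := φ) (x := (p, u)) ((0 : E), 2 * π)
      rw [h] at h2
      simp only [hψ]
      rw [h2]
      simp
    refine ⟨_, fun n hn => hn _ ⟨ψ, hψs, hψp, rfl⟩, fun t p => ?_⟩
    simp only
    rw [(key t p).fderiv]
    unfold poissonMean
    split_ifs with h
    · have hr : |ρ t| < 1 := by rw [abs_of_nonneg (h0 t)]; exact h
      have hs : ContDiff ℝ 1 fun q : E × ℝ => poisson (ρ t) q.2 * φ q :=
          (((smoothPer_poisson hr).smooth.comp contDiff_snd).mul hφ).of_le (by simp)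
      rw [smul_apply, ContinuousLinearMap.intervalIntegral_apply]
      · unfold mean
        congr 1
        refine intervalIntegral.integral_congr fun u _ => ?_
        simp only [ContinuousLinearMap.comp_apply, ContinuousLinearMap.inl_apply, hψ]
        have h3 : HasFDerivAt (fun q : E × ℝ => poisson (ρ t) q.2)
            ((fderiv ℝ (poisson (ρ t)) u).comp (ContinuousLinearMap.snd ℝ E ℝ)) (p, u) :=
          HasFDerivAt.comp (g := poisson (ρ t)) (f := fun q : E × ℝ => q.2) (p, u)
            (((smoothPer_poisson hr).smooth.differentiable (by simp) u).hasFDerivAt)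
            hasFDerivAt_snd
        have h4 : HasFDerivAt (fun q : E × ℝ => poisson (ρ t) q.2 * φ q) _ (p, u) :=
          h3.mul (hφ.differentiable (by simp) (p, u)).hasFDerivAt
        rw [h4.fderiv]
        simp
      · refine Continuous.intervalIntegrable ?_ _ _
        exact ((hs.continuous_fderiv one_ne_zero).comp
          (by fun_prop : Continuous fun u => (p, u))).clm_comp continuous_const
    · rfl

end PoissonMean

/-! ### The cosecant transform and its Tricomi identity. -/

section Cosecant

/-- The principal value integral with kernel `cosec (u / 2)`, for skew-periodic functions. -/
def cosecHilb {F : Type*} [NormedAddCommGroup F] [NormedSpace ℝ F] (g : ℝ → F) (x : ℝ) : F :=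
  mean fun u => (sin (u / 2))⁻¹ • (g (x + u) - cos (u / 2) • g x)

theorem cosecHilb_ofReal (g : ℝ → ℝ) (x : ℝ) :
    cosecHilb (fun x => (g x : ℂ)) x = (cosecHilb g x : ℝ) := by
  unfold cosecHilb
  rw [← mean_ofReal]
  congr 1; funext u
  simp

open Complex (I exp) in
-- The factor e^{ix/2} exchanges periodic and skew-periodic functions, and e^{iu/2}/sin(u/2) =
-- cot(u/2) + i.
theorem cosecHilb_exp_mul {F : ℝ → ℂ} (hF : SmoothPer F) (x : ℝ) :
    cosecHilb (fun x => exp (x / 2 * I) * F x) x = exp (x / 2 * I) * (hilb F x + I * mean F) := by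
  have c1 := continuous_hilb_integrand_right hF x
  have hx := (hF.comp_add x).continuous
  rw [← mean_comp_add hF.periodic x]
  unfold hilb cosecHilb
  have c2 : Continuous fun u => I * F (u + x) := continuous_const.mul hx
  rw [← mean_mul_left, ← mean_add c1 c2, ← mean_mul_left]
  refine mean_congr fun u hu => ?_
  have hne := (sin_half_pos hu).ne'
  have hneC : (sin (u / 2) : ℂ) ≠ 0 := by exact_mod_cast hne
  have e : exp (((x + u : ℝ) : ℂ) / 2 * I) =
      exp (x / 2 * I) * (cos (u / 2) + sin (u / 2) * I) := by
    rw [Complex.ofReal_cos, Complex.ofReal_sin, ← Complex.exp_mul_I, ← Complex.exp_add]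
    congr 1; push_cast; ring
  simp only [quot, add_sub_cancel_left, if_neg hne, Complex.real_smul, e, add_comm u x]
  push_cast at hneC ⊢
  field_simp
  ring

open Complex (I exp) in
-- Writing g = e^{ix/2} F turns the claim into Cotlar's identity for b and F. Skew-adjointness
-- removes the mean of b HF + F Hb, and the constant mean(b) mean(F) in Cotlar's identity cancels
-- against the square of i.
theorem cosecHilb_tricomi {b g : ℝ → ℝ} (hb : SmoothPer b) (hg : ContDiff ℝ ∞ g)
    (hskew : ∀ x, g (x + 2 * π) = -g x) (x : ℝ) :
    cosecHilb (fun x => b x * cosecHilb g x + g x * hilb b x) x =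
      hilb b x * cosecHilb g x - b x * g x := by
  have hw : ContDiff ℝ ∞ fun x : ℝ => exp (-(x / 2 * I)) := by
    have : ContDiff ℝ ∞ fun x : ℝ => (x : ℂ) := Complex.ofRealCLM.contDiff
    fun_prop
  set F : ℝ → ℂ := fun x => exp (-(x / 2 * I)) * g x with hFdef
  have hF : SmoothPer F := by
    refine ⟨hw.mul (Complex.ofRealCLM.contDiff.comp hg), fun x => ?_⟩
    have e : exp (-(((x + 2 * π : ℝ) : ℂ) / 2 * I)) = -exp (-(x / 2 * I)) := by
      have : -(((x + 2 * π : ℝ) : ℂ) / 2 * I) = -(x / 2 * I) - π * I := by push_cast; ring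
      rw [this, Complex.exp_sub, Complex.exp_pi_mul_I, div_neg, div_one]
    rw [hFdef]
    simp only [hskew]
    rw [e]
    push_cast; ring
  have hgF : ∀ x, (g x : ℂ) = exp (x / 2 * I) * F x := fun x => by
    rw [hFdef]
    rw [← mul_assoc, ← Complex.exp_add]; simp
  have hT : ∀ x, ((cosecHilb g x : ℝ) : ℂ) = exp (x / 2 * I) * (hilb F x + I * mean F) := fun x => by
    rw [← cosecHilb_exp_mul hF]
    simp only [← hgF]
    exact (cosecHilb_ofReal g x).symm
  have hbC := hb.ofReal
  have hHb : ∀ x, ((hilb b x : ℝ) : ℂ) = hilb (fun x => (b x : ℂ)) x := fun x =>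
    (hilb_ofReal hb.periodic x).symm
  set bC : ℝ → ℂ := fun x => (b x : ℂ) with hbCdef
  have s1 := (hbC.mul hF.hilb).add (hF.mul hbC.hilb)
  have hG := (s1.add ((SmoothPer.const (I * mean F)).mul hbC))
  have e1 : ((cosecHilb (fun x => b x * cosecHilb g x + g x * hilb b x) x : ℝ) : ℂ) =
      cosecHilb (fun x => exp (x / 2 * I) *
        ((bC x * hilb F x + F x * hilb bC x) + I * mean F * bC x)) x := by
    have h : ∀ x : ℝ, exp (x / 2 * I) * ((bC x * hilb F x + F x * hilb bC x) + I * mean F * bC x) =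
        ((b x * cosecHilb g x + g x * hilb b x : ℝ) : ℂ) := fun x => by
      push_cast
      rw [hT, hgF, hHb]; ring
    simp only [h]
    exact (cosecHilb_ofReal _ x).symm
  have m1 : mean (fun x => bC x * hilb F x + F x * hilb bC x) = 0 := by
    rw [mean_add (hbC.mul hF.hilb).continuous (hF.mul hbC.hilb).continuous, mean_mul_hilb hbC hF]
    simp only [mul_comm (F _)]
    ring
  have e2 := hilb_cotlar_complex hbC hF x
  rw [cosecHilb_exp_mul hG, mean_add s1.continuous ((SmoothPer.const (I * mean F)).mul hbC).continuous,
    m1, mean_mul_left, hilb_add s1 ((SmoothPer.const (I * mean F)).mul hbC), hilb_mul_left, e2] at e1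
  have : ((cosecHilb (fun x => b x * cosecHilb g x + g x * hilb b x) x : ℝ) : ℂ) =
      ((hilb b x * cosecHilb g x - b x * g x : ℝ) : ℂ) := by
    rw [e1]
    push_cast
    rw [hT, hgF, hHb]
    linear_combination exp (x / 2 * I) * mean F * mean bC * Complex.I_sq
  exact_mod_cast this

end Cosecant

end PoissonMeans

/-! ### The smooth part of the deformed kernel for scalar Δ. -/

section ScalarKernels

section ScalarKernel

/-- Smooth functions on the torus, as doubly periodic functions. -/
structure BiPer (δ : ℝ → ℝ → ℝ) : Prop where
  smooth : ContDiff ℝ ∞ fun q : ℝ × ℝ => δ q.1 q.2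
  left : ∀ x y, δ (x + 2 * π) y = δ x y
  right : ∀ x y, δ x (y + 2 * π) = δ x y

theorem BiPer.smoothPer_right {δ : ℝ → ℝ → ℝ} (hδ : BiPer δ) (x : ℝ) : SmoothPer (δ x) :=
  ⟨hδ.smooth.comp (f := fun y : ℝ => (x, y)) (by fun_prop), hδ.right x⟩

theorem BiPer.smoothPer_left {δ : ℝ → ℝ → ℝ} (hδ : BiPer δ) (y : ℝ) : SmoothPer fun x => δ x y :=
  ⟨hδ.smooth.comp (f := fun x : ℝ => (x, y)) (by fun_prop), fun x => hδ.left x y⟩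

/-- The radius `r`, rising from `0` at `θ ≤ 0` to `1` at `θ ≥ π / 4`. -/
def rad (θ : ℝ) : ℝ := smoothTransition (4 * θ / π)

/-- A cutoff rising from `0` at `θ ≤ π / 4` to `1` at `θ ≥ π / 2`. -/
def cut (θ : ℝ) : ℝ := smoothTransition (4 * θ / π - 1)

theorem contDiff_rad : ContDiff ℝ ∞ rad :=
  smoothTransition.contDiff.comp (by fun_prop)

theorem contDiff_cut : ContDiff ℝ ∞ cut :=
  smoothTransition.contDiff.comp (by fun_prop)

theorem rad_nonneg (θ : ℝ) : 0 ≤ rad θ := smoothTransition.nonneg _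

theorem rad_le_one (θ : ℝ) : rad θ ≤ 1 := smoothTransition.le_one _

theorem rad_eq_one_iff (θ : ℝ) : rad θ = 1 ↔ π / 4 ≤ θ := by
  unfold rad
  rw [smoothTransition.eq_one_iff_one_le, le_div_iff₀ pi_pos]
  constructor <;> intro h <;> linarith

theorem abs_rad_lt_one {θ : ℝ} (h : θ < π / 4) : |rad θ| < 1 := by
  rw [abs_of_nonneg (rad_nonneg θ)]
  exact lt_of_le_of_ne (rad_le_one θ) fun h' => not_lt.2 ((rad_eq_one_iff θ).1 h') h

theorem cut_of_le {θ : ℝ} (h : θ ≤ π / 4) : cut θ = 0 := by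
  refine smoothTransition.zero_of_nonpos ?_
  rw [sub_nonpos, div_le_iff₀ pi_pos]; linarith

theorem cut_of_ge {θ : ℝ} (h : π / 2 ≤ θ) : cut θ = 1 := by
  refine smoothTransition.one_of_one_le ?_
  rw [le_sub_iff_add_le, le_div_iff₀ pi_pos]; linarith

theorem rad_zero : rad 0 = 0 := by simp [rad]

/-- The kernel on the first half of the deformation. -/
def kernelOne (δ : ℝ → ℝ → ℝ) (θ α x y : ℝ) : ℝ :=
  sin (α / 2) * outerInvExt (rad θ) (fun ξ => innerKernel (rad θ) α (δ ξ) y) x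

/-- The smooth part of the deformed kernel. -/
def kernelFull (δ : ℝ → ℝ → ℝ) (θ α x y : ℝ) : ℝ :=
  kernelOne δ θ α x y - cut θ * (kernelOne δ π α x y - mean fun x => kernelOne δ π α x y)

variable {δ : ℝ → ℝ → ℝ}

theorem contDiff_innerKernel (hδ : BiPer δ) :
    ContDiff ℝ ∞ fun q : ℝ × ℝ × ℝ × ℝ => innerKernel (rad q.1) q.2.1 (δ q.2.2.1) q.2.2.2 := by
  unfold innerKernel
  have h1 : ContDiff ℝ ∞ fun q : ℝ × ℝ × ℝ × ℝ => δ q.2.2.1 q.2.2.2 :=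
    hδ.smooth.comp (f := fun q : ℝ × ℝ × ℝ × ℝ => (q.2.2.1, q.2.2.2)) (by fun_prop)
  have hr : ContDiff ℝ ∞ fun q : ℝ × ℝ × ℝ × ℝ => rad q.1 := contDiff_rad.comp contDiff_fst
  refine h1.add (hr.mul ?_)
  have hq := contDiff_quot (φ := fun q : ℝ × ℝ => δ q.1 q.2) hδ.smooth hδ.right
  have hφ : ContDiff ℝ ∞ fun s : (ℝ × ℝ × ℝ) × ℝ =>
      sin ((s.1.1 - s.2 - s.1.2.2) / 2) * quot (δ s.1.2.1) (s.2 + s.1.1) s.1.2.2 :=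
    ContDiff.mul (by fun_prop) (hq.comp
      (f := fun s : (ℝ × ℝ × ℝ) × ℝ => (s.1.2.1, s.2 + s.1.1, s.1.2.2)) (by fun_prop))
  refine contDiff_poissonMean contDiff_rad rad_nonneg rad_le_one rad_eq_one_iff hφ fun p u => ?_
  simp only
  rw [show (p.1 - (u + 2 * π) - p.2.2) / 2 = (p.1 - u - p.2.2) / 2 - π by ring, sin_sub_pi,
    show u + 2 * π + p.1 = u + p.1 + 2 * π by ring, quot_add_left (hδ.right _), neg_mul_neg]

theorem innerKernel_add_right (hδ : BiPer δ) (r α x y : ℝ) :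
    innerKernel r α (δ x) (y + 2 * π) = innerKernel r α (δ x) y := by
  unfold innerKernel
  rw [hδ.right]
  congr 3; funext u
  rw [show (α - u - (y + 2 * π)) / 2 = (α - u - y) / 2 - π by ring, sin_sub_pi,
    quot_add_right (hδ.right _), neg_mul_neg]

theorem innerKernel_angle (hδ : BiPer δ) (r α x y : ℝ) :
    innerKernel r (α + 2 * π) (δ x) y = innerKernel r α (δ x) y := by
  unfold innerKernel
  congr 3; funext u
  rw [show (α + 2 * π - u - y) / 2 = (α - u - y) / 2 + π by ring, sin_add_pi, ← add_assoc,
    quot_add_left (hδ.right _), neg_mul_neg]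

theorem smoothPer_innerKernel (hδ : BiPer δ) (θ α y : ℝ) :
    SmoothPer fun x => innerKernel (rad θ) α (δ x) y :=
  ⟨(contDiff_innerKernel hδ).comp (f := fun x : ℝ => (θ, α, x, y)) (by fun_prop), fun x => by
    rw [show δ (x + 2 * π) = δ x from funext (hδ.left x)]⟩

theorem contDiff_kernelOne (hδ : BiPer δ) :
    ContDiff ℝ ∞ fun q : ℝ × ℝ × ℝ × ℝ => kernelOne δ q.1 q.2.1 q.2.2.1 q.2.2.2 := by
  unfold kernelOne outerInvExt
  have hV := contDiff_innerKernel hδ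
  have hV' : ContDiff ℝ ∞ fun s : (ℝ × ℝ × ℝ) × ℝ =>
      innerKernel (rad s.1.1) s.1.2.1 (δ s.2) s.1.2.2 :=
    hV.comp (f := fun s : (ℝ × ℝ × ℝ) × ℝ => (s.1.1, s.1.2.1, s.2, s.1.2.2)) (by fun_prop)
  have hper : ∀ p : ℝ × ℝ × ℝ, Function.Periodic
      (fun ξ => innerKernel (rad p.1) p.2.1 (δ ξ) p.2.2) (2 * π) := fun p =>
    (smoothPer_innerKernel hδ p.1 p.2.1 p.2.2).periodic
  have hH := contDiff_hilb hV' hper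
  have hQ := contDiff_quot hH fun p => periodic_hilb (hper p)
  have hφ : ContDiff ℝ ∞ fun s : (ℝ × ℝ × ℝ × ℝ) × ℝ =>
      innerKernel (rad s.1.1) s.1.2.1 (δ s.2) s.1.2.2.2
        + innerKernel (rad s.1.1) s.1.2.1 (δ s.1.2.2.1) s.1.2.2.2
        - cos ((s.2 - s.1.2.2.1) / 2) *
          quot (hilb fun ξ => innerKernel (rad s.1.1) s.1.2.1 (δ ξ) s.1.2.2.2) s.2 s.1.2.2.1 := by
    refine ContDiff.sub (ContDiff.add ?_ ?_) (ContDiff.mul (by fun_prop) ?_)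
    · exact hV.comp (f := fun s : (ℝ × ℝ × ℝ × ℝ) × ℝ => (s.1.1, s.1.2.1, s.2, s.1.2.2.2))
        (by fun_prop)
    · exact hV.comp contDiff_fst
    · exact hQ.comp (f := fun s : (ℝ × ℝ × ℝ × ℝ) × ℝ =>
        ((s.1.1, s.1.2.1, s.1.2.2.2), s.2, s.1.2.2.1)) (by fun_prop)
  have hP := contDiff_poissonMean contDiff_rad rad_nonneg rad_le_one rad_eq_one_iff hφ
    (fun p ξ => by
      have hp := hper (p.1, p.2.1, p.2.2.2)
      have e1 := hp ξ
      simp only at e1 ⊢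
      rw [e1, show (ξ + 2 * π - p.2.2.1) / 2 = (ξ - p.2.2.1) / 2 + π by ring, cos_add_pi,
        quot_add_left (periodic_hilb hp), neg_mul_neg])
  have hP' := hP.comp (f := fun q : ℝ × ℝ × ℝ × ℝ => (q.1, q)) (by fun_prop)
  exact ContDiff.mul (by fun_prop) (hP'.div_const 2)

theorem kernelOne_add_left (hδ : BiPer δ) (θ α x y : ℝ) :
    kernelOne δ θ α (x + 2 * π) y = kernelOne δ θ α x y := by
  have hV := (smoothPer_innerKernel hδ θ α y).periodic
  unfold kernelOne outerInvExt
  congr 3; funext ξ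
  have := hV x
  simp only at this ⊢
  rw [this, show (ξ - (x + 2 * π)) / 2 = (ξ - x) / 2 - π by ring, cos_sub_pi,
    quot_add_right (periodic_hilb hV), neg_mul_neg]

theorem kernelOne_add_right (hδ : BiPer δ) (θ α x y : ℝ) :
    kernelOne δ θ α x (y + 2 * π) = kernelOne δ θ α x y := by
  unfold kernelOne
  simp only [innerKernel_add_right hδ]

theorem kernelOne_angle (hδ : BiPer δ) (θ α x y : ℝ) :
    kernelOne δ θ (α + 2 * π) x y = -kernelOne δ θ α x y := by
  unfold kernelOne
  simp only [innerKernel_angle hδ]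
  rw [show (α + 2 * π) / 2 = α / 2 + π by ring, sin_add_pi, neg_mul]

theorem kernelOne_angle_zero (θ x y : ℝ) : kernelOne δ θ 0 x y = 0 := by simp [kernelOne]

/-- At radius 1 both averages are point evaluations, so neither y nor θ enters any more. -/
theorem kernelOne_of_one_le (hδ : BiPer δ) {θ : ℝ} (hθ : π / 4 ≤ θ) (α x y : ℝ) :
    kernelOne δ θ α x y = sin (α / 2) * ((δ 0 α + δ x α
      - cos (x / 2) * quot (hilb fun ξ => δ ξ α) 0 x) / 2) := by
  unfold kernelOne
  simp only [(rad_eq_one_iff θ).2 hθ, innerKernel_one α (hδ.smoothPer_right _)]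
  unfold outerInvExt poissonMean
  simp only [lt_irrefl, if_false, zero_sub, neg_div, cos_neg]

theorem kernelOne_eq_pi (hδ : BiPer δ) {θ : ℝ} (hθ : π / 4 ≤ θ) (α x y : ℝ) :
    kernelOne δ θ α x y = kernelOne δ π α x 0 := by
  rw [kernelOne_of_one_le hδ hθ, kernelOne_of_one_le hδ (by linarith [pi_pos])]

theorem kernelOne_zero (hδ : BiPer δ) (α x y : ℝ) :
    kernelOne δ 0 α x y = sin (α / 2) * δ x y := by
  have h := outerInvExt_eq (r := 0) (by simp) (hδ.smoothPer_left y) x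
  unfold kernelOne
  rw [rad_zero]
  have e : ∀ ξ, innerKernel 0 α (δ ξ) y = δ ξ y := fun ξ => by simp [innerKernel]
  simp only [e]
  rw [h]
  simp [outerInv, poisson, conjPoisson, poissonDenom, mean, hilb_const]
  left; ring

theorem smoothPer_kernelOne (hδ : BiPer δ) (θ α y : ℝ) :
    SmoothPer fun x => kernelOne δ θ α x y :=
  ⟨(contDiff_kernelOne hδ).comp (f := fun x : ℝ => (θ, α, x, y)) (by fun_prop),
    fun x => kernelOne_add_left hδ θ α x y⟩

theorem outer_kernelOne (hδ : BiPer δ) {θ : ℝ} (hθ : θ < π / 4) (α x y : ℝ) :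
    outer (rad θ) 0 (fun x => kernelOne δ θ α x y) x =
      sin (α / 2) * innerKernel (rad θ) α (δ x) y := by
  have hr := abs_rad_lt_one hθ
  have hV := smoothPer_innerKernel hδ θ α y
  have e : (fun x => kernelOne δ θ α x y) = fun x => sin (α / 2) *
      outerInv (rad θ) (fun x => innerKernel (rad θ) α (δ x) y) x := by
    funext x
    rw [← outerInvExt_eq hr hV]; rfl
  rw [← outer_outerInv hr hV, e]
  unfold outer
  rw [mean_mul_left, hilb_mul_left]
  ring

/-- With g = δ(·, α), the mean of the divided-difference term is H(Hg)(0) = -g(0) + mean g.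
Subtracted from g(0) + mean g it leaves 2 g(0). -/
theorem mean_kernelOne_pi (hδ : BiPer δ) (α y : ℝ) :
    (mean fun x => kernelOne δ π α x y) = sin (α / 2) * δ 0 α := by
  have h := hδ.smoothPer_left α
  simp only [kernelOne_of_one_le hδ (θ := π) (by linarith [pi_pos]), mean_mul_left]
  have hq : Continuous fun x => quot (hilb fun ξ => δ ξ α) 0 x :=
    (continuous_quot h.hilb).comp (f := fun x : ℝ => ((0 : ℝ), x)) (by fun_prop)
  have hc := h.continuous
  have e1 : (mean fun x => cos (x / 2) * quot (hilb fun ξ => δ ξ α) 0 x) =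
      -δ 0 α + mean fun ξ => δ ξ α := by
    rw [← hilb_hilb h, hilb_eq_mean_cot h.hilb.periodic]
    refine mean_congr fun u hu => ?_
    have hne := (sin_half_pos hu).ne'
    have : sin ((0 - u) / 2) = -sin (u / 2) := by
      rw [zero_sub, neg_div, sin_neg]
    simp only [quot, this, neg_eq_zero, if_neg hne, smul_eq_mul, zero_add]
    field_simp
    ring
  simp only [div_eq_mul_inv, mean_mul_right]
  simp only [← div_eq_mul_inv]
  rw [mean_sub (by fun_prop) (by fun_prop), mean_add (by fun_prop) (by fun_prop), mean_const, e1]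
  ring

theorem kernelOne_const (G θ α x y : ℝ) :
    kernelOne (fun _ _ => G) θ α x y = sin (α / 2) * G := by
  have h0 : ∀ r, poissonMean r (fun _ => 0) = 0 := fun r => by simp [poissonMean, mean]
  have h1 : ∀ y, innerKernel (rad θ) α (fun _ => G) y = G := fun y => by
    simp [innerKernel, quot, h0]
  unfold kernelOne
  simp only [h1]
  congr 1
  have h2 : ∀ a c, quot (hilb fun _ : ℝ => G) a c = 0 := fun a c => by
    rw [funext (hilb_const G)]; simp [quot]
  unfold outerInvExt
  simp only [h2, mul_zero, sub_zero]
  unfold poissonMean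
  split_ifs with h
  · rw [mean_mul_right, mean_poisson (by rw [abs_of_nonneg (rad_nonneg θ)]; exact h)]
    ring
  · ring

theorem contDiff_kernelFull (hδ : BiPer δ) :
    ContDiff ℝ ∞ fun q : ℝ × ℝ × ℝ × ℝ => kernelFull δ q.1 q.2.1 q.2.2.1 q.2.2.2 := by
  have h := contDiff_kernelOne hδ
  have h1 : ContDiff ℝ ∞ fun q : ℝ × ℝ × ℝ × ℝ => kernelOne δ π q.2.1 q.2.2.1 q.2.2.2 :=
    h.comp (f := fun q : ℝ × ℝ × ℝ × ℝ => (π, q.2)) (by fun_prop)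
  have h2 : ContDiff ℝ ∞ fun q : ℝ × ℝ × ℝ × ℝ => mean fun x => kernelOne δ π q.2.1 x q.2.2.2 :=
    contDiff_mean (E := ℝ × ℝ × ℝ × ℝ)
      (φ := fun s : (ℝ × ℝ × ℝ × ℝ) × ℝ => kernelOne δ π s.1.2.1 s.2 s.1.2.2.2)
      (h.comp (f := fun s : (ℝ × ℝ × ℝ × ℝ) × ℝ => (π, s.1.2.1, s.2, s.1.2.2.2)) (by fun_prop))
  exact h.sub ((contDiff_cut.comp contDiff_fst).mul (h1.sub h2))

theorem kernelFull_add_left (hδ : BiPer δ) (θ α x y : ℝ) :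
    kernelFull δ θ α (x + 2 * π) y = kernelFull δ θ α x y := by
  unfold kernelFull
  rw [kernelOne_add_left hδ, kernelOne_add_left hδ]

theorem kernelFull_add_right (hδ : BiPer δ) (θ α x y : ℝ) :
    kernelFull δ θ α x (y + 2 * π) = kernelFull δ θ α x y := by
  unfold kernelFull
  simp only [kernelOne_add_right hδ]

theorem kernelFull_angle (hδ : BiPer δ) (θ α x y : ℝ) :
    kernelFull δ θ (α + 2 * π) x y = -kernelFull δ θ α x y := by
  unfold kernelFull
  simp only [kernelOne_angle hδ, mean_neg]
  ring

theorem kernelFull_angle_zero (θ x y : ℝ) : kernelFull δ θ 0 x y = 0 := by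
  simp [kernelFull, kernelOne_angle_zero, mean]

theorem kernelFull_zero (hδ : BiPer δ) (α x y : ℝ) :
    kernelFull δ 0 α x y = sin (α / 2) * δ x y := by
  unfold kernelFull
  rw [cut_of_le (by positivity), kernelOne_zero hδ, zero_mul, sub_zero]

theorem kernelFull_pi_div_two (hδ : BiPer δ) (α x y : ℝ) :
    kernelFull δ (π / 2) α x y = sin (α / 2) * δ 0 α := by
  unfold kernelFull
  rw [cut_of_ge le_rfl, mean_kernelOne_pi hδ, kernelOne_eq_pi hδ (by linarith [pi_pos]),
    kernelOne_eq_pi hδ (θ := π) (by linarith [pi_pos]) α x y]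
  ring

theorem kernelFull_const (G θ α x y : ℝ) :
    kernelFull (fun _ _ => G) θ α x y = sin (α / 2) * G := by
  simp [kernelFull, kernelOne_const, mean_const]

end ScalarKernel

end ScalarKernels

/-! ### From weak to strong smoothness in sequentially complete locally convex spaces. -/

section LocallyConvex

section Mackey

/-- A copy of `V`, to be equipped with the topology of a seminorm. -/
def SeminormCopy {V : Type*} [AddCommGroup V] [Module ℝ V] (_p : Seminorm ℝ V) : Type _ := V

variable {V : Type*} [AddCommGroup V] [Module ℝ V]

instance (p : Seminorm ℝ V) : SeminormedAddCommGroup (SeminormCopy p) :=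
  AddGroupSeminorm.toSeminormedAddCommGroup (E := V) p.toAddGroupSeminorm

instance (p : Seminorm ℝ V) : Module ℝ (SeminormCopy p) := inferInstanceAs (Module ℝ V)

instance (p : Seminorm ℝ V) : NormedSpace ℝ (SeminormCopy p) where
  norm_smul_le a b := (map_smul_eq_mul p a b).le

variable [TopologicalSpace V]

/-- The identity map to the copy. -/
def toSeminormCopy [IsTopologicalAddGroup V] (p : Seminorm ℝ V) (hp : Continuous p) : V →L[ℝ] SeminormCopy p where
  toFun x := x
  map_add' _ _ := rfl
  map_smul' _ _ := rfl
  cont := by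
    refine continuous_iff_continuousAt.2 fun x => tendsto_iff_norm_sub_tendsto_zero.2 ?_
    have h : Continuous fun y : V => p (y - x) := hp.comp (by fun_prop)
    have := h.tendsto x
    simp only [sub_self, map_zero] at this
    exact this

/-- Weakly bounded sets are bounded. -/
theorem exists_bound_of_weakly_bounded [IsTopologicalAddGroup V] {p : Seminorm ℝ V} (hp : Continuous p) {ι : Type*}
    {u : ι → V} (h : ∀ l : V →L[ℝ] ℝ, ∃ C, ∀ i, |l (u i)| ≤ C) : ∃ C, ∀ i, p (u i) ≤ C := by
  let T := toSeminormCopy p hp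
  -- The vectors act on the dual of a seminormed space, which is a Banach space, so uniform
  -- boundedness needs no completeness of V.
  let g : ι → StrongDual ℝ (SeminormCopy p) →L[ℝ] ℝ := fun i =>
    NormedSpace.inclusionInDoubleDual ℝ (SeminormCopy p) (T (u i))
  obtain ⟨C, hC⟩ := banach_steinhaus (g := g) fun φ => by
    obtain ⟨C, hC⟩ := h (φ.comp T)
    exact ⟨C, fun i => hC i⟩
  refine ⟨C, fun i => ?_⟩
  obtain ⟨φ, hφ, hφu⟩ := exists_dual_vector'' ℝ (T (u i))
  have h1 : p (u i) = ‖T (u i)‖ := rfl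
  have h2 : g i φ = φ (T (u i)) := rfl
  have h3 : ‖T (u i)‖ = g i φ := by rw [h2, hφu]; rfl
  rw [h1, h3]
  calc g i φ ≤ ‖g i φ‖ := le_abs_self _
    _ ≤ ‖g i‖ * ‖φ‖ := (g i).le_opNorm φ
    _ ≤ C * 1 := mul_le_mul (hC i) hφ (norm_nonneg _) ((norm_nonneg _).trans (hC i))
    _ = C := mul_one C

variable [IsTopologicalAddGroup V] [ContinuousSMul ℝ V] [LocallyConvexSpace ℝ V]

/-- The quotients of u by ε are weakly bounded, hence bounded in every continuous seminorm. The
constants may depend on the functional, but the rate ε may not. -/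
theorem tendsto_zero_of_weak {ι : Type*} {F : Filter ι} {u : ι → V} {ε : ι → ℝ} {s : Set ι}
    (hs : s ∈ F) (hε : ∀ i ∈ s, 0 < ε i) (hlim : Tendsto ε F (𝓝 0))
    (h : ∀ l : V →L[ℝ] ℝ, ∃ C, ∀ i ∈ s, |l (u i)| ≤ C * ε i) : Tendsto u F (𝓝 0) := by
  rw [(PolynormableSpace.withSeminorms ℝ V).tendsto_nhds u 0]
  rintro ⟨p, hp⟩ η hη
  obtain ⟨C, hC⟩ := exists_bound_of_weakly_bounded hp (ι := s) (u := fun i => (ε i)⁻¹ • u i)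
    fun l => by
      obtain ⟨C, hC⟩ := h l
      refine ⟨C, fun i => ?_⟩
      have hi := hε i i.2
      rw [map_smul, smul_eq_mul, abs_mul, abs_of_pos (inv_pos.2 hi), inv_mul_le_iff₀ hi, mul_comm]
      exact hC i i.2
  have hlim' : Tendsto (fun i => C * ε i) F (𝓝 0) := by simpa using hlim.const_mul C
  filter_upwards [hs, hlim'.eventually (gt_mem_nhds hη)] with i hi hlt
  refine lt_of_le_of_lt ?_ hlt
  have h1 := hC ⟨i, hi⟩
  have h2 := hε i hi
  simp only [map_smul_eq_mul, Real.norm_eq_abs, abs_of_pos (inv_pos.2 h2)] at h1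
  rw [sub_zero, mul_comm]
  rwa [inv_mul_le_iff₀ h2] at h1

end Mackey

section DerivativeTVS

open scoped Pointwise

variable {V : Type*} [AddCommGroup V] [Module ℝ V] [TopologicalSpace V] [IsTopologicalAddGroup V]
  [ContinuousSMul ℝ V]

/-- Differentiability here is a little-o relation between gauges: once the slope is within εU of v,
the remainder lies in (y - x) εU. -/
theorem hasDerivAt_of_tendsto_slope {f : ℝ → V} {v : V} {x : ℝ}
    (h : Tendsto (fun t : ℝ => t⁻¹ • (f (x + t) - f x)) (𝓝[≠] 0) (𝓝 v)) : HasDerivAt f v x := by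
  refine ⟨⟨fun U hU => ⟨Metric.ball 0 1, Metric.ball_mem_nhds 0 one_pos, fun ε hε => ?_⟩⟩⟩
  have hε' : (ε : ℝ) ≠ 0 := by exact_mod_cast hε
  have h1 : Tendsto (fun t : ℝ => t⁻¹ • (f (x + t) - f x) - v) (𝓝[≠] 0) (𝓝 0) := by
    simpa using h.sub_const v
  have h2 : (ε : ℝ) • U ∈ 𝓝 (0 : V) := (set_smul_mem_nhds_zero_iff hε').2 hU
  have h3 : ∀ᶠ t in 𝓝 (0 : ℝ), t ≠ 0 → t⁻¹ • (f (x + t) - f x) - v ∈ (ε : ℝ) • U :=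
    eventually_nhdsWithin_iff.1 (h1.eventually h2)
  rw [prod_pure, EventuallyLE, eventually_map]
  have h4 : Tendsto (fun y : ℝ => y - x) (𝓝 x) (𝓝 0) := by
    have : Continuous fun y : ℝ => y - x := by fun_prop
    simpa using this.tendsto x
  filter_upwards [h4.eventually h3] with y hy
  have hmem : f y - f x - ContinuousLinearMap.toSpanSingleton ℝ v (y - x) ∈
      ((y - x) * ε) • U := by
    rw [ContinuousLinearMap.toSpanSingleton_apply]
    by_cases h0 : y - x = 0
    · have : y = x := sub_eq_zero.1 h0
      subst this
      simp only [sub_self, zero_smul, zero_mul]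
      exact ⟨0, mem_of_mem_nhds hU, by simp⟩
    · obtain ⟨w, hw, hwe⟩ := hy h0
      refine ⟨w, hw, ?_⟩
      simp only at hwe ⊢
      rw [mul_smul, hwe, smul_sub, smul_inv_smul₀ h0, add_sub_cancel]
  refine (egauge_le_of_mem_smul hmem).trans ?_
  rw [enorm_mul, mul_comm]
  have e : ‖(ε : ℝ)‖ₑ = ε := by simp
  rw [e]
  gcongr
  exact le_egauge_ball_one ℝ _

theorem hasDerivAt_clm_apply {f : ℝ → V} {v : V} {x : ℝ} (h : HasDerivAt f v x)
    (l : V →L[ℝ] ℝ) : HasDerivAt (fun t => l (f t)) (l v) x := by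
  have h1 := l.isBigOTVS_fun_comp (f := fun p : ℝ × ℝ => f p.1 - f p.2 -
    ContinuousLinearMap.toSpanSingleton ℝ v (p.1 - p.2)) (l := 𝓝 x ×ˢ pure x)
  have h2 := h1.trans_isLittleOTVS h.isLittleOTVS
  refine ⟨h2.congr_left fun p => ?_⟩
  simp

end DerivativeTVS

section WeaklySmooth

variable {E : Type*} [NormedAddCommGroup E] [NormedSpace ℝ E]
variable {V : Type*} [AddCommGroup V] [Module ℝ V] [TopologicalSpace V]

/-- Weakly smooth maps: composites with all continuous functionals are smooth. -/
def WeaklySmooth (f : E → V) : Prop := ∀ l : V →L[ℝ] ℝ, ContDiff ℝ ∞ fun x => l (f x)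

theorem WeaklySmooth.comp {E' : Type*} [NormedAddCommGroup E'] [NormedSpace ℝ E'] {f : E → V}
    (hf : WeaklySmooth f) {g : E' → E} (hg : ContDiff ℝ ∞ g) : WeaklySmooth fun x => f (g x) :=
  fun l => (hf l).comp hg

variable [FiniteDimensional ℝ E]

theorem exists_lipschitz_closedBall {g : E → ℝ} (hg : ContDiff ℝ ∞ g) (x : E) :
    ∃ C, ∀ y ∈ Metric.closedBall x 1, |g y - g x| ≤ C * ‖y - x‖ := by
  have hproper : ProperSpace E := FiniteDimensional.proper_real E
  obtain ⟨C, hC⟩ := (isCompact_closedBall x 1).exists_bound_of_continuousOn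
    (hg.continuous_fderiv (by simp)).continuousOn
  exact ⟨C, fun y hy => (convex_closedBall x 1).norm_image_sub_le_of_norm_fderiv_le
    (fun z _ => hg.differentiable (by simp) z) hC (Metric.mem_closedBall_self zero_le_one) hy⟩

variable [IsTopologicalAddGroup V] [ContinuousSMul ℝ V] [LocallyConvexSpace ℝ V]

/-- Composites with functionals are locally Lipschitz, so the differences are weakly O(‖y - x‖). -/
theorem WeaklySmooth.continuous {f : E → V} (hf : WeaklySmooth f) : Continuous f := by
  refine continuous_iff_continuousAt.2 fun x => continuousAt_iff_punctured_nhds.2 ?_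
  rw [← tendsto_sub_nhds_zero_iff]
  refine tendsto_zero_of_weak (ε := fun y => ‖y - x‖) (s := Metric.closedBall x 1 ∩ {x}ᶜ)
    (inter_mem (mem_nhdsWithin_of_mem_nhds (Metric.closedBall_mem_nhds x one_pos))
      self_mem_nhdsWithin) (fun y hy => norm_pos_iff.2 (sub_ne_zero.2 hy.2)) ?_ fun l => ?_
  · have : Continuous fun y : E => ‖y - x‖ := by fun_prop
    have h := this.tendsto x
    simp only [sub_self, norm_zero] at h
    exact h.mono_left nhdsWithin_le_nhds
  · obtain ⟨C, hC⟩ := exists_lipschitz_closedBall (hf l) x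
    exact ⟨C, fun y hy => by rw [map_sub]; exact hC y hy.1⟩

end WeaklySmooth

section SequentialCompleteness

variable {V : Type*} [AddCommGroup V] [Module ℝ V] [UniformSpace V] [IsUniformAddGroup V]
  [ContinuousSMul ℝ V] [LocallyConvexSpace ℝ V]

/-- A rate of weak convergence common to all functionals makes the sequence Cauchy for the original
topology. -/
theorem exists_limit_of_weak (hV : ∀ u : ℕ → V, CauchySeq u → ∃ b, Tendsto u atTop (𝓝 b))
    {u : ℕ → V} (h : ∀ l : V →L[ℝ] ℝ, ∃ a C, ∀ n, |l (u n) - a| ≤ C * (1 / ((n : ℝ) + 1))) :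
    ∃ b, Tendsto u atTop (𝓝 b) := by
  refine hV u ?_
  rw [CauchySeq, Cauchy, uniformity_eq_comap_nhds_zero, ← tendsto_iff_comap, prod_map_map_eq]
  refine ⟨inferInstance, ?_⟩
  rw [tendsto_map'_iff]
  have h0 : Tendsto (fun n : ℕ => 1 / ((n : ℝ) + 1)) atTop (𝓝 0) :=
    tendsto_one_div_add_atTop_nhds_zero_nat
  refine tendsto_zero_of_weak (ε := fun q : ℕ × ℕ => 1 / ((q.1 : ℝ) + 1) + 1 / ((q.2 : ℝ) + 1))
    (s := univ) univ_mem (fun q _ => by positivity) ?_ fun l => ?_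
  · simpa using (h0.comp tendsto_fst).add (h0.comp tendsto_snd)
  · obtain ⟨a, C, hC⟩ := h l
    refine ⟨C, fun q _ => ?_⟩
    have h1 := abs_le.1 (hC q.1)
    have h2 := abs_le.1 (hC q.2)
    simp only [Function.comp, map_sub]
    rw [abs_le]
    constructor <;> nlinarith [h1.1, h1.2, h2.1, h2.2]

theorem exists_of_weak_limit (hV : ∀ u : ℕ → V, CauchySeq u → ∃ b, Tendsto u atTop (𝓝 b))
    {u : ℕ → V} {a : (V →L[ℝ] ℝ) → ℝ}
    (h : ∀ l : V →L[ℝ] ℝ, ∃ C, ∀ n, |l (u n) - a l| ≤ C * (1 / ((n : ℝ) + 1))) :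
    ∃ b, ∀ l : V →L[ℝ] ℝ, l b = a l := by
  obtain ⟨b, hb⟩ := exists_limit_of_weak hV fun l => ⟨a l, h l⟩
  refine ⟨b, fun l => tendsto_nhds_unique ((l.continuous.tendsto b).comp hb) ?_⟩
  obtain ⟨C, hC⟩ := h l
  rw [tendsto_iff_norm_sub_tendsto_zero]
  refine squeeze_zero (fun _ => norm_nonneg _) hC ?_
  simpa using tendsto_one_div_add_atTop_nhds_zero_nat.const_mul C

/-- Weakly smooth curves are differentiable, with weakly smooth derivative. -/
theorem WeaklySmooth.exists_deriv (hV : ∀ u : ℕ → V, CauchySeq u → ∃ b, Tendsto u atTop (𝓝 b))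
    {f : ℝ → V} (hf : WeaklySmooth f) :
    ∃ f' : ℝ → V, WeaklySmooth f' ∧ (∀ x, HasDerivAt f (f' x) x) ∧
      (∀ x, Tendsto (fun t : ℝ => t⁻¹ • (f (x + t) - f x)) (𝓝[≠] 0) (𝓝 (f' x))) ∧
      ∀ (l : V →L[ℝ] ℝ) x, l (f' x) = deriv (fun x => l (f x)) x := by
  -- The scalar difference quotient is the integral of the derivative over the segment, a smooth
  -- function of t, so it converges at rate |t|.
  have key : ∀ (l : V →L[ℝ] ℝ) x, ∃ C, ∀ t : ℝ, t ≠ 0 → |t| ≤ 1 →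
      |l (t⁻¹ • (f (x + t) - f x)) - deriv (fun x => l (f x)) x| ≤ C * |t| := by
    intro l x
    have hd := (contDiff_infty_iff_deriv.1 (hf l)).2
    have hk : ContDiff ℝ ∞ fun t : ℝ =>
        ∫ s in (0 : ℝ)..1, deriv (fun x => l (f x)) (x + s * t) := by
      have : ContDiff ℝ ∞ fun q : ℝ × ℝ => deriv (fun x => l (f x)) (x + q.2 * q.1) :=
        hd.comp (f := fun q : ℝ × ℝ => x + q.2 * q.1) (by fun_prop)
      exact contDiff_intervalIntegral this 0 1
    obtain ⟨C, hC⟩ := exists_lipschitz_closedBall hk 0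
    refine ⟨C, fun t ht ht1 => ?_⟩
    have h1 := hC t (by simpa using ht1)
    have h2 := sub_eq_smul_integral_deriv ((hf l).of_le (by simp)) (x + t) x
    rw [add_sub_cancel_left] at h2
    rw [map_smul, map_sub, h2, smul_smul, inv_mul_cancel₀ ht, one_smul]
    simpa using h1
  have hex : ∀ x, ∃ b : V, ∀ l : V →L[ℝ] ℝ, l b = deriv (fun x => l (f x)) x := by
    intro x
    refine exists_of_weak_limit hV
      (u := fun n : ℕ => (1 / ((n : ℝ) + 1))⁻¹ • (f (x + 1 / ((n : ℝ) + 1)) - f x)) fun l => ?_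
    obtain ⟨C, hC⟩ := key l x
    refine ⟨C, fun n => ?_⟩
    have h0 : (0 : ℝ) < 1 / ((n : ℝ) + 1) := by positivity
    have h1 : 1 / ((n : ℝ) + 1) ≤ 1 := by
      rw [div_le_one (by positivity)]
      linarith [n.cast_nonneg (α := ℝ)]
    have := hC _ h0.ne' (by rwa [abs_of_pos h0])
    rwa [abs_of_pos h0] at this
  choose f' hf' using hex
  have hslope : ∀ x, Tendsto (fun t : ℝ => t⁻¹ • (f (x + t) - f x)) (𝓝[≠] 0) (𝓝 (f' x)) := by
    intro x
    rw [← tendsto_sub_nhds_zero_iff]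
    refine tendsto_zero_of_weak (ε := fun t => |t|) (s := Metric.closedBall 0 1 ∩ {0}ᶜ)
      (inter_mem (mem_nhdsWithin_of_mem_nhds (Metric.closedBall_mem_nhds 0 one_pos))
        self_mem_nhdsWithin) (fun y hy => abs_pos.2 hy.2) ?_ fun l => ?_
    · have := continuous_abs.tendsto (0 : ℝ)
      rw [abs_zero] at this
      exact this.mono_left nhdsWithin_le_nhds
    · obtain ⟨C, hC⟩ := key l x
      refine ⟨C, fun t ht => ?_⟩
      rw [map_sub, hf']
      exact hC t ht.2 (by simpa using ht.1)
  refine ⟨f', fun l => ?_, fun x => hasDerivAt_of_tendsto_slope (hslope x), hslope,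
    fun l x => hf' x l⟩
  simp only [hf']
  exact (contDiff_infty_iff_deriv.1 (hf l)).2

variable {E : Type*} [NormedAddCommGroup E] [NormedSpace ℝ E]

theorem WeaklySmooth.exists_dirDeriv
    (hV : ∀ u : ℕ → V, CauchySeq u → ∃ b, Tendsto u atTop (𝓝 b)) {f : E → V}
    (hf : WeaklySmooth f) :
    ∃ D : E × E → V, WeaklySmooth D ∧
      (∀ x w, HasDerivAt (fun t : ℝ => f (x + t • w)) (D (x, w)) 0) ∧
      (∀ x w, Tendsto (fun t : ℝ => t⁻¹ • (f (x + t • w) - f x)) (𝓝[≠] 0) (𝓝 (D (x, w)))) ∧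
      ∀ (l : V →L[ℝ] ℝ) x w, l (D (x, w)) = fderiv ℝ (fun x => l (f x)) x w := by
  have hline : ∀ x w : E, WeaklySmooth fun t : ℝ => f (x + t • w) := fun x w =>
    hf.comp (g := fun t : ℝ => x + t • w) (by fun_prop)
  choose D hD1 hD2 hD3 hD4 using fun q : E × E => (hline q.1 q.2).exists_deriv hV
  have hl : ∀ (l : V →L[ℝ] ℝ) x w, l (D (x, w) 0) = fderiv ℝ (fun x => l (f x)) x w := by
    intro l x w
    rw [hD4]
    have h1 : HasFDerivAt (fun x => l (f x)) (fderiv ℝ (fun x => l (f x)) x) (x + (0 : ℝ) • w) := by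
      rw [zero_smul, add_zero]
      exact ((hf l).differentiable (by simp) x).hasFDerivAt
    have h2 : HasDerivAt (fun t : ℝ => x + t • w) w 0 := by
      simpa using ((hasDerivAt_id (0 : ℝ)).smul_const w).const_add x
    exact (h1.comp_hasDerivAt (0 : ℝ) h2).deriv
  refine ⟨fun q => D q 0, fun l => ?_, fun x w => hD2 (x, w) 0, fun x w => ?_, hl⟩
  swap
  · simpa using hD3 (x, w) 0
  have : (fun q : E × E => l (D q 0)) = fun q => fderiv ℝ (fun x => l (f x)) q.1 q.2 :=
    funext fun q => hl l q.1 q.2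
  rw [this]
  exact (((hf l).fderiv_right (m := ∞) (by simp)).comp contDiff_fst).clm_apply contDiff_snd

theorem WeaklySmooth.isSmoothMap [FiniteDimensional ℝ E]
    (hV : ∀ u : ℕ → V, CauchySeq u → ∃ b, Tendsto u atTop (𝓝 b)) {f : E → V}
    (hf : WeaklySmooth f) : IsSmoothMap f := by
  have step : ∀ (k : ℕ) (g : {g : E × (Fin k → E) → V // WeaklySmooth g}),
      ∃ h : {g : E × (Fin (k + 1) → E) → V // WeaklySmooth g}, ∀ x v w,
        HasDerivAt (fun t : ℝ => g.1 (x + t • w, v)) (h.1 (x, Fin.cons w v)) 0 := by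
    rintro k ⟨g, hg⟩
    -- The earlier directions are additional variables, frozen by differentiating in the direction
    -- (w, 0).
    obtain ⟨D, hD, hD', -, -⟩ := hg.exists_dirDeriv hV
    refine ⟨⟨fun q => D ((q.1, Fin.tail q.2), (q.2 0, 0)), hD.comp
      (g := fun q : E × (Fin (k + 1) → E) => ((q.1, Fin.tail q.2), (q.2 0, (0 : Fin k → E)))) ?_⟩,
      fun x v w => ?_⟩
    · unfold Fin.tail
      fun_prop
    · have := hD' (x, v) (w, 0)
      simpa using this
  choose next hnext using step
  let D : (k : ℕ) → {g : E × (Fin k → E) → V // WeaklySmooth g} := fun k =>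
    Nat.rec ⟨fun q => f q.1, hf.comp contDiff_fst⟩ (fun k g => next k g) k
  refine ⟨fun k x v => (D k).1 (x, v), fun x v => rfl, fun k => (D k).2.continuous,
    fun k x v w => hnext k (D k) x v w⟩

/-- Weakly smooth curves have vector-valued means. -/
theorem WeaklySmooth.exists_mean (hV : ∀ u : ℕ → V, CauchySeq u → ∃ b, Tendsto u atTop (𝓝 b))
    {f : ℝ → V} (hf : WeaklySmooth f) :
    ∃ b : V, ∀ l : V →L[ℝ] ℝ, l b = mean fun x => l (f x) := by
  -- Left Riemann sums with n + 1 nodes: each scalar integrand is Lipschitz on the period, so the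
  -- error is O(1/(n + 1)) with a constant depending only on the functional.
  refine exists_of_weak_limit hV (u := fun n : ℕ => (1 / ((n : ℝ) + 1)) •
    ∑ k ∈ Finset.range (n + 1), f (2 * π * k / ((n : ℝ) + 1))) fun l => ?_
  set g := fun x => l (f x) with hg
  have hgs : ContDiff ℝ ∞ g := hf l
  obtain ⟨C, hC⟩ := (isCompact_Icc (a := (0 : ℝ)) (b := 2 * π)).exists_bound_of_continuousOn
    (contDiff_infty_iff_deriv.1 hgs).2.continuous.continuousOn
  refine ⟨C * (2 * π), fun n => ?_⟩
  set N : ℝ := (n : ℝ) + 1 with hN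
  have hNpos : 0 < N := by positivity
  have hsum : ∫ x in (0 : ℝ)..(2 * π), g x =
      ∑ k ∈ Finset.range (n + 1), ∫ x in (2 * π * k / N)..(2 * π * (k + 1 : ℕ) / N), g x := by
    have := intervalIntegral.sum_integral_adjacent_intervals (μ := volume) (f := g) (a := fun k : ℕ => 2 * π * k / N)
      (n := n + 1) fun k _ => hgs.continuous.intervalIntegrable _ _
    rw [this]
    congr 1
    · simp
    · push_cast
      rw [← hN]; field_simp
  have hterm : ∀ k ∈ Finset.range (n + 1),
      |g (2 * π * k / N) * (2 * π / N) - ∫ x in (2 * π * k / N)..(2 * π * (k + 1 : ℕ) / N), g x| ≤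
        C * (2 * π / N) * (2 * π / N) := by
    intro k hk
    have hk' : (k : ℝ) + 1 ≤ N := by
      have := Finset.mem_range.1 hk
      rw [hN]
      exact_mod_cast Nat.succ_le_of_lt this
    have hle : 2 * π * k / N ≤ 2 * π * (k + 1 : ℕ) / N := by
      push_cast
      gcongr
      linarith
    have hlen : 2 * π * (k + 1 : ℕ) / N - 2 * π * k / N = 2 * π / N := by
      push_cast; field_simp; ring
    have hc : g (2 * π * k / N) * (2 * π / N) =
        ∫ _ in (2 * π * k / N)..(2 * π * (k + 1 : ℕ) / N), g (2 * π * k / N) := by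
      rw [intervalIntegral.integral_const, hlen, smul_eq_mul, mul_comm]
    rw [hc, ← intervalIntegral.integral_sub intervalIntegrable_const
      (hgs.continuous.intervalIntegrable _ _)]
    have hb : ∀ x ∈ Icc (2 * π * k / N) (2 * π * (k + 1 : ℕ) / N),
        ‖g (2 * π * k / N) - g x‖ ≤ C * (2 * π / N) := by
      intro x hx
      have h0 : (0 : ℝ) ≤ 2 * π * k / N := by positivity
      have h2 : 2 * π * (k + 1 : ℕ) / N ≤ 2 * π := by
        push_cast
        rw [div_le_iff₀ hNpos]
        exact mul_le_mul_of_nonneg_left hk' two_pi_pos.le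
      have h3 := (convex_Icc (0 : ℝ) (2 * π)).norm_image_sub_le_of_norm_deriv_le
        (fun y _ => hgs.differentiable (by simp) y) hC
        (⟨h0.trans hx.1, hx.2.trans h2⟩ : x ∈ Icc (0 : ℝ) (2 * π))
        (⟨h0, hle.trans h2⟩ : 2 * π * k / N ∈ Icc (0 : ℝ) (2 * π))
      refine h3.trans ?_
      have hC0 : 0 ≤ C := (norm_nonneg _).trans (hC 0 ⟨le_rfl, two_pi_pos.le⟩)
      refine mul_le_mul_of_nonneg_left ?_ hC0
      rw [Real.norm_eq_abs, abs_sub_comm, abs_of_nonneg (by linarith [hx.1])]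
      linarith [hx.2]
    have := intervalIntegral.norm_integral_le_of_norm_le_const (a := 2 * π * k / N)
      (b := 2 * π * (k + 1 : ℕ) / N) (f := fun x => g (2 * π * k / N) - g x) (C := C * (2 * π / N))
      fun x hx => hb x (by rw [uIoc_of_le hle] at hx; exact Ioc_subset_Icc_self hx)
    rw [hlen, abs_of_pos (by positivity)] at this
    exact this
  have htot : |∑ k ∈ Finset.range (n + 1), g (2 * π * k / N) * (2 * π / N)
      - ∫ x in (0 : ℝ)..(2 * π), g x| ≤ C * (2 * π) * (2 * π / N) := by
    rw [hsum, ← Finset.sum_sub_distrib]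
    refine (Finset.abs_sum_le_sum_abs _ _).trans ((Finset.sum_le_sum hterm).trans ?_)
    rw [Finset.sum_const, Finset.card_range, nsmul_eq_mul]
    push_cast
    rw [← hN]
    apply le_of_eq
    field_simp
  have e : l ((1 / N) • ∑ k ∈ Finset.range (n + 1), f (2 * π * k / N)) - mean g =
      (2 * π)⁻¹ * (∑ k ∈ Finset.range (n + 1), g (2 * π * k / N) * (2 * π / N)
        - ∫ x in (0 : ℝ)..(2 * π), g x) := by
    rw [map_smul, map_sum, ← Finset.sum_mul, mean, smul_eq_mul, smul_eq_mul]
    have := pi_ne_zero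
    field_simp
    rfl
  rw [e, abs_mul, abs_of_pos (inv_pos.2 two_pi_pos), inv_mul_le_iff₀ two_pi_pos]
  refine htot.trans (le_of_eq ?_)
  ring

end SequentialCompleteness

section SmoothCurves

variable {V : Type*} [AddCommGroup V] [Module ℝ V] [TopologicalSpace V] [IsTopologicalAddGroup V]
  [ContinuousSMul ℝ V]

theorem IsSmoothMap.weaklySmooth {f : ℝ → V} (hf : IsSmoothMap f) : WeaklySmooth f := by
  obtain ⟨D, h0, hc, hd⟩ := hf
  intro l
  have hder : ∀ (k : ℕ) (x : ℝ), HasDerivAt (fun x => l (D k x fun _ => 1))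
      (l (D (k + 1) x fun _ => 1)) x := by
    intro k x
    have h1 := hasDerivAt_clm_apply (hd k x (fun _ => 1) 1) l
    have h2 : (Fin.cons (1 : ℝ) (fun _ : Fin k => (1 : ℝ)) : Fin (k + 1) → ℝ) = fun _ => 1 := by
      funext i; refine Fin.cases ?_ (fun j => ?_) i <;> simp
    rw [h2] at h1
    have h3 := HasDerivAt.comp (h₂ := fun t : ℝ => l (D k (x + t • (1 : ℝ)) fun _ => 1))
      (h := fun y : ℝ => y - x) x (by simpa using h1) ((hasDerivAt_id x).sub_const x)
    simpa [Function.comp_def] using h3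
  have hn : ∀ (n k : ℕ), ContDiff ℝ n fun x => l (D k x fun _ => 1) := by
    intro n
    induction n with
    | zero =>
      intro k
      exact_mod_cast contDiff_zero.2 (l.continuous.comp ((hc k).comp
        (f := fun x : ℝ => (x, fun _ : Fin k => (1 : ℝ))) (by fun_prop)))
    | succ n ih =>
      intro k
      push_cast
      rw [contDiff_succ_iff_deriv]
      refine ⟨fun x => (hder k x).differentiableAt, by simp, ?_⟩
      have : deriv (fun x => l (D k x fun _ => 1)) = fun x => l (D (k + 1) x fun _ => 1) :=
        funext fun x => (hder k x).deriv
      rw [this]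
      exact ih (k + 1)
  have := contDiff_infty.2 fun n => hn n 0
  simpa only [h0] using this

end SmoothCurves

end LocallyConvex

/-! ### Vectors defined by their pairings with functionals; vector-valued means and Hilbert
transforms. -/

section WeakFunctions

section Represented

/-- Sequential completeness. -/
class SeqComplete (V : Type*) [UniformSpace V] : Prop where
  exists_tendsto : ∀ u : ℕ → V, CauchySeq u → ∃ b, Tendsto u atTop (𝓝 b)

variable {V : Type*} [AddCommGroup V] [Module ℝ V]

/-- A function on the dual space is represented by a vector. -/
def Represented [TopologicalSpace V] (a : (V →L[ℝ] ℝ) → ℝ) : Prop := ∃ b : V, ∀ l, l b = a l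

/-- The vector representing a function on the dual space. -/
def weakRep [TopologicalSpace V] (a : (V →L[ℝ] ℝ) → ℝ) : V :=
  Classical.epsilon fun b : V => ∀ l : V →L[ℝ] ℝ, l b = a l

theorem Represented.apply [TopologicalSpace V] {a : (V →L[ℝ] ℝ) → ℝ} (h : Represented a)
    (l : V →L[ℝ] ℝ) : l (weakRep a) = a l :=
  Classical.epsilon_spec h l

section Operations

variable [TopologicalSpace V] {a b : (V →L[ℝ] ℝ) → ℝ}

theorem represented_apply (v : V) : Represented fun l : V →L[ℝ] ℝ => l v := ⟨v, fun _ => rfl⟩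

theorem Represented.add (ha : Represented a) (hb : Represented b) :
    Represented fun l => a l + b l := by
  obtain ⟨v, hv⟩ := ha
  obtain ⟨w, hw⟩ := hb
  exact ⟨v + w, fun l => by rw [map_add, hv, hw]⟩

theorem Represented.mul_left (c : ℝ) (ha : Represented a) : Represented fun l => c * a l := by
  obtain ⟨v, hv⟩ := ha
  exact ⟨c • v, fun l => by rw [map_smul, hv, smul_eq_mul]⟩

theorem Represented.sub (ha : Represented a) (hb : Represented b) :
    Represented fun l => a l - b l := by
  obtain ⟨v, hv⟩ := ha
  obtain ⟨w, hw⟩ := hb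
  exact ⟨v - w, fun l => by rw [map_sub, hv, hw]⟩

theorem Represented.div_const (ha : Represented a) (c : ℝ) : Represented fun l => a l / c := by
  simpa only [div_eq_inv_mul] using ha.mul_left c⁻¹

end Operations

variable [UniformSpace V] [IsUniformAddGroup V] [ContinuousSMul ℝ V] [LocallyConvexSpace ℝ V]
  [SeqComplete V]

theorem Represented.mean {a : (V →L[ℝ] ℝ) → ℝ → ℝ} (h : ∀ u, Represented fun l => a l u)
    (hs : ∀ l, ContDiff ℝ ∞ (a l)) : Represented fun l => mean (a l) := by
  choose f hf using h
  obtain ⟨b, hb⟩ := WeaklySmooth.exists_mean (f := f) SeqComplete.exists_tendsto fun l => by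
    simpa only [hf] using hs l
  exact ⟨b, fun l => by rw [hb]; simp only [hf]⟩

theorem Represented.deriv {a : (V →L[ℝ] ℝ) → ℝ → ℝ} (h : ∀ u, Represented fun l => a l u)
    (hs : ∀ l, ContDiff ℝ ∞ (a l)) (x : ℝ) : Represented fun l => deriv (a l) x := by
  choose f hf using h
  obtain ⟨f', -, -, -, h'⟩ := WeaklySmooth.exists_deriv (f := f) SeqComplete.exists_tendsto
    fun l => by simpa only [hf] using hs l
  exact ⟨f' x, fun l => by rw [h']; simp only [hf]⟩

theorem Represented.quot {a : (V →L[ℝ] ℝ) → ℝ → ℝ} (h : ∀ u, Represented fun l => a l u)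
    (hs : ∀ l, ContDiff ℝ ∞ (a l)) (x y : ℝ) : Represented fun l => quot (a l) x y := by
  unfold CircleCocycle.quot
  split_ifs
  · exact (Represented.deriv h hs x).mul_left _
  · exact ((h x).sub (h y)).mul_left _

theorem SmoothPer.contDiff_quot_comp {g : ℝ → ℝ} (hg : SmoothPer g) {a b : ℝ → ℝ}
    (ha : ContDiff ℝ ∞ a) (hb : ContDiff ℝ ∞ b) : ContDiff ℝ ∞ fun u => quot g (a u) (b u) :=
  (contDiff_quot (E := ℝ) (φ := fun q : ℝ × ℝ => g q.2) (hg.smooth.comp contDiff_snd)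
    fun _ => hg.periodic).comp (f := fun u : ℝ => ((0 : ℝ), a u, b u)) (by fun_prop)

theorem Represented.hilb {a : (V →L[ℝ] ℝ) → ℝ → ℝ} (h : ∀ u, Represented fun l => a l u)
    (hs : ∀ l, SmoothPer (a l)) (x : ℝ) : Represented fun l => hilb (a l) x :=
  Represented.mean (fun u => (Represented.quot h (fun l => (hs l).smooth) (x + u) x).mul_left _)
    fun l => ContDiff.mul (by fun_prop) ((hs l).contDiff_quot_comp (by fun_prop) (by fun_prop))

theorem Represented.poissonMean {r : ℝ} (hr : 0 ≤ r) {a : (V →L[ℝ] ℝ) → ℝ → ℝ}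
    (h : ∀ u, Represented fun l => a l u) (hs : ∀ l, ContDiff ℝ ∞ (a l)) :
    Represented fun l => poissonMean r (a l) := by
  unfold CircleCocycle.poissonMean
  split_ifs with h1
  · exact Represented.mean (fun u => (h u).mul_left _) fun l =>
      (smoothPer_poisson (by rwa [abs_of_nonneg hr])).smooth.mul (hs l)
  · exact h 0

theorem Represented.innerKernel {r : ℝ} (hr : 0 ≤ r) (α : ℝ) {a : (V →L[ℝ] ℝ) → ℝ → ℝ}
    (h : ∀ u, Represented fun l => a l u) (hs : ∀ l, SmoothPer (a l)) (y : ℝ) :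
    Represented fun l => innerKernel r α (a l) y :=
  (h y).add ((Represented.poissonMean hr
    (fun u => (Represented.quot h (fun l => (hs l).smooth) (u + α) y).mul_left _) fun l =>
    ContDiff.mul (by fun_prop)
      ((hs l).contDiff_quot_comp (by fun_prop) (by fun_prop))).mul_left r)

theorem Represented.outerInvExt {r : ℝ} (hr : 0 ≤ r) {a : (V →L[ℝ] ℝ) → ℝ → ℝ}
    (h : ∀ u, Represented fun l => a l u) (hs : ∀ l, SmoothPer (a l)) (x : ℝ) :
    Represented fun l => outerInvExt r (a l) x :=
  (Represented.poissonMean hr (fun ξ => ((h ξ).add (h x)).sub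
    ((Represented.quot (Represented.hilb h hs) (fun l => (hs l).hilb.smooth) ξ x).mul_left _))
    fun l => ((hs l).smooth.add contDiff_const).sub (ContDiff.mul (by fun_prop)
      ((hs l).hilb.contDiff_quot_comp (by fun_prop) (by fun_prop)))).div_const 2

variable {δ : (V →L[ℝ] ℝ) → ℝ → ℝ → ℝ}

theorem Represented.kernelOne (h : ∀ x y, Represented fun l => δ l x y) (hδ : ∀ l, BiPer (δ l))
    (θ α x y : ℝ) : Represented fun l => kernelOne (δ l) θ α x y :=
  (Represented.outerInvExt (rad_nonneg θ) (fun ξ => Represented.innerKernel (rad_nonneg θ) α (h ξ)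
    (fun l => (hδ l).smoothPer_right ξ) y) (fun l => smoothPer_innerKernel (hδ l) θ α y)
    x).mul_left _

theorem Represented.kernelFull (h : ∀ x y, Represented fun l => δ l x y) (hδ : ∀ l, BiPer (δ l))
    (θ α x y : ℝ) : Represented fun l => kernelFull (δ l) θ α x y :=
  (Represented.kernelOne h hδ θ α x y).sub (((Represented.kernelOne h hδ π α x y).sub
    (Represented.mean (fun x => Represented.kernelOne h hδ π α x y)
      fun l => (smoothPer_kernelOne (hδ l) π α y).smooth)).mul_left _)

end Represented

section VectorFunctions

variable {V : Type*} [AddCommGroup V] [Module ℝ V] [UniformSpace V] [IsUniformAddGroup V]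
  [ContinuousSMul ℝ V] [LocallyConvexSpace ℝ V]

theorem eq_of_forall_dual [T2Space V] {v w : V} (h : ∀ l : V →L[ℝ] ℝ, l v = l w) : v = w :=
  (SeparatingDual.eq_iff_forall_dual_eq (R := ℝ)).2 h

theorem weakRep_eq [T2Space V] {a : (V →L[ℝ] ℝ) → ℝ} {v : V} (h : ∀ l, l v = a l) :
    weakRep a = v :=
  eq_of_forall_dual fun l => by rw [Represented.apply ⟨v, h⟩, h]

/-- Weakly smooth periodic functions. -/
def WeaklySmoothPer (F : ℝ → V) : Prop := ∀ l : V →L[ℝ] ℝ, SmoothPer fun x => l (F x)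

theorem WeaklySmoothPer.weaklySmooth {F : ℝ → V} (hF : WeaklySmoothPer F) : WeaklySmooth F :=
  fun l => (hF l).smooth

theorem WeaklySmoothPer.periodic [T2Space V] {F : ℝ → V} (hF : WeaklySmoothPer F) :
    Function.Periodic F (2 * π) := fun x => eq_of_forall_dual fun l => (hF l).periodic x

theorem WeaklySmoothPer.add {F G : ℝ → V} (hF : WeaklySmoothPer F) (hG : WeaklySmoothPer G) :
    WeaklySmoothPer fun x => F x + G x := fun l => by
  simpa only [map_add] using (hF l).add (hG l)

theorem WeaklySmoothPer.smul {b : ℝ → ℝ} {F : ℝ → V} (hb : SmoothPer b) (hF : WeaklySmoothPer F) :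
    WeaklySmoothPer fun x => b x • F x := fun l => by
  simpa only [map_smul, smul_eq_mul] using hb.mul (hF l)

theorem WeaklySmoothPer.const (v : V) : WeaklySmoothPer fun _ => v := fun l =>
  SmoothPer.const (l v)

theorem WeaklySmoothPer.comp_add {F : ℝ → V} (hF : WeaklySmoothPer F) (s : ℝ) :
    WeaklySmoothPer fun x => F (x + s) := fun l => (hF l).comp_add s

theorem WeaklySmoothPer.comp_sub {F : ℝ → V} (hF : WeaklySmoothPer F) (s : ℝ) :
    WeaklySmoothPer fun x => F (x - s) := fun l => (hF l).comp_sub s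

theorem WeaklySmoothPer.clm {F : ℝ → V} (hF : WeaklySmoothPer F) (T : V →L[ℝ] V) :
    WeaklySmoothPer fun x => T (F x) := fun l => hF (l.comp T)

/-- The mean of a vector-valued function. -/
def vmean (F : ℝ → V) : V := weakRep fun l => mean fun x => l (F x)

/-- The Hilbert transform of a vector-valued function. -/
def vhilb (F : ℝ → V) (x : ℝ) : V := weakRep fun l => hilb (fun x => l (F x)) x

variable [SeqComplete V]

theorem apply_vmean {F : ℝ → V} (hF : WeaklySmooth F) (l : V →L[ℝ] ℝ) :
    l (vmean F) = mean fun x => l (F x) :=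
  (Represented.mean (a := fun l x => l (F x)) (fun x => represented_apply (F x)) hF).apply l

theorem apply_vhilb {F : ℝ → V} (hF : WeaklySmoothPer F) (l : V →L[ℝ] ℝ) (x : ℝ) :
    l (vhilb F x) = hilb (fun x => l (F x)) x :=
  (Represented.hilb (a := fun l x => l (F x)) (fun x => represented_apply (F x)) hF x).apply l

theorem WeaklySmoothPer.vhilb {F : ℝ → V} (hF : WeaklySmoothPer F) : WeaklySmoothPer (vhilb F) :=
  fun l => by simpa only [apply_vhilb hF] using (hF l).hilb

/-- Weakly smooth functions on the torus. -/
def WeaklySmoothBiPer (Φ : ℝ → ℝ → V) : Prop := ∀ l : V →L[ℝ] ℝ, BiPer fun x y => l (Φ x y)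

theorem BiPer.smoothPer_mean {δ : ℝ → ℝ → ℝ} (hδ : BiPer δ) : SmoothPer fun x => mean (δ x) :=
  ⟨contDiff_mean (E := ℝ) (φ := fun q : ℝ × ℝ => δ q.1 q.2) hδ.smooth, fun x => by
    rw [show δ (x + 2 * π) = δ x from funext (hδ.left x)]⟩

theorem WeaklySmoothBiPer.right {Φ : ℝ → ℝ → V} (h : WeaklySmoothBiPer Φ) (x : ℝ) :
    WeaklySmoothPer (Φ x) := fun l => (h l).smoothPer_right x

theorem WeaklySmoothBiPer.vmean {Φ : ℝ → ℝ → V} (h : WeaklySmoothBiPer Φ) :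
    WeaklySmoothPer fun x => vmean (Φ x) := fun l => by
  simpa only [apply_vmean (h.right _).weaklySmooth] using (h l).smoothPer_mean

/-- Fubini for the regularised integrand, which is continuous in both variables. -/
theorem hilb_mean {δ : ℝ → ℝ → ℝ} (hδ : BiPer δ) (x : ℝ) :
    hilb (fun x => mean (δ x)) x = mean fun y => hilb (fun x => δ x y) x := by
  have hk : Continuous fun q : ℝ × ℝ => cos (q.1 / 2) • quot (fun x => δ x q.2) (x + q.1) x := by
    have hc : Continuous fun q : ℝ × ℝ => cos (q.1 / 2) := by fun_prop
    exact hc.smul (((contDiff_quot (E := ℝ) (φ := fun q : ℝ × ℝ => δ q.2 q.1)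
      (hδ.smooth.comp (f := fun q : ℝ × ℝ => (q.2, q.1)) (by fun_prop))
      fun y => (hδ.smoothPer_left y).periodic).continuous).comp
      (f := fun q : ℝ × ℝ => (q.2, x + q.1, x)) (by fun_prop))
  have hs : ∀ x, Continuous (δ x) := fun x => (hδ.smoothPer_right x).continuous
  unfold hilb
  rw [← mean_swap hk]
  refine mean_congr fun u hu => ?_
  have hne := (sin_half_pos hu).ne'
  unfold quot
  simp only [add_sub_cancel_left, if_neg hne, smul_eq_mul]
  rw [mean_mul_left, mean_mul_left, mean_sub (hs _) (hs _)]

theorem mean_hilb_antisymm {Φ : ℝ → ℝ → ℝ} (hΦ : BiPer Φ) :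
    (mean fun y => hilb (Φ y) y) = -mean fun y => hilb (fun x => Φ x y) y := by
  have h := mean_mean_cot_antisymm (Φ := fun q : ℝ × ℝ => Φ q.1 q.2)
    (k₁ := fun q => quot (Φ q.1) (q.1 + q.2) q.1)
    (k₂ := fun q => quot (fun x => Φ x q.1) (q.1 + q.2) q.1) hΦ.smooth.continuous hΦ.left hΦ.right
    ((contDiff_quot (E := ℝ) (φ := fun q : ℝ × ℝ => Φ q.1 q.2) hΦ.smooth
      fun x => (hΦ.smoothPer_right x).periodic).comp
      (f := fun q : ℝ × ℝ => (q.1, q.1 + q.2, q.1)) (by fun_prop)).continuous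
    ((contDiff_quot (E := ℝ) (φ := fun q : ℝ × ℝ => Φ q.2 q.1)
      (hΦ.smooth.comp (f := fun q : ℝ × ℝ => (q.2, q.1)) (by fun_prop))
      fun y => (hΦ.smoothPer_left y).periodic).comp
      (f := fun q : ℝ × ℝ => (q.1, q.1 + q.2, q.1)) (by fun_prop)).continuous
    (fun y u => by
      have := sin_smul_quot (hΦ.smoothPer_right y).periodic (y + u) y
      rwa [add_sub_cancel_left] at this)
    (fun y u => by
      have := sin_smul_quot (hΦ.smoothPer_left y).periodic (y + u) y
      rwa [add_sub_cancel_left] at this)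
  exact h

end VectorFunctions

/-! ### Products of weakly smooth functions. -/

section Products

variable {B : Type*} [Ring B] [Algebra ℝ B] [UniformSpace B] [IsUniformAddGroup B]
  [IsTopologicalRing B] [ContinuousSMul ℝ B] [LocallyConvexSpace ℝ B]

/-- Left multiplication as a continuous linear map. -/
def mulLeftCLM (a : B) : B →L[ℝ] B := ⟨LinearMap.mulLeft ℝ a, by
  change Continuous fun x => a * x
  fun_prop⟩

/-- Right multiplication as a continuous linear map. -/
def mulRightCLM (a : B) : B →L[ℝ] B := ⟨LinearMap.mulRight ℝ a, by
  change Continuous fun x => x * a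
  fun_prop⟩

@[simp] theorem mulLeftCLM_apply (a b : B) : mulLeftCLM a b = a * b := rfl

@[simp] theorem mulRightCLM_apply (a b : B) : mulRightCLM a b = b * a := rfl

variable [SeqComplete B]

theorem hasDerivAt_mul_of_slope {f g : ℝ → B} {f' g' : B} (hfc : Continuous f)
    (hf : Tendsto (fun t : ℝ => t⁻¹ • (f t - f 0)) (𝓝[≠] 0) (𝓝 f'))
    (hg : Tendsto (fun t : ℝ => t⁻¹ • (g t - g 0)) (𝓝[≠] 0) (𝓝 g')) (l : B →L[ℝ] ℝ) :
    HasDerivAt (fun t => l (f t * g t)) (l (f' * g 0 + f 0 * g')) 0 := by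
  rw [hasDerivAt_iff_tendsto_slope_zero]
  have h1 : Tendsto f (𝓝[≠] 0) (𝓝 (f 0)) := (hfc.tendsto 0).mono_left nhdsWithin_le_nhds
  have h2 := (l.continuous.tendsto _).comp ((hf.mul_const (g 0)).add (h1.mul hg))
  refine h2.congr fun t => ?_
  rw [zero_add, smul_eq_mul, ← map_sub, ← smul_eq_mul, ← map_smul]
  simp only [Function.comp]
  congr 1
  rw [smul_mul_assoc, mul_smul_comm, ← smul_add]
  congr 1
  noncomm_ring

/-- A functional of a product is not determined by functionals of the factors. Instead, the class of
functions l(f g) with f and g weakly smooth is closed under partial derivatives up to sums, by the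
Leibniz rule for strong derivatives, and its members are continuous. -/
theorem WeaklySmooth.mul_prod {f g : ℝ × ℝ → B} (hf : WeaklySmooth f) (hg : WeaklySmooth g) :
    WeaklySmooth fun q => f q * g q := by
  intro l
  have key : ∀ (w : ℝ × ℝ) (f g : ℝ × ℝ → B), WeaklySmooth f → WeaklySmooth g →
      ∃ f₁ g₁ : ℝ × ℝ → B, WeaklySmooth f₁ ∧ WeaklySmooth g₁ ∧ ∀ q,
        HasDerivAt (fun t : ℝ => l (f (q + t • w) * g (q + t • w)))
          (l (f₁ q * g q) + l (f q * g₁ q)) 0 := by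
    intro w f g hf hg
    obtain ⟨D, hD, -, hDs, -⟩ := hf.exists_dirDeriv SeqComplete.exists_tendsto
    obtain ⟨D', hD', -, hDs', -⟩ := hg.exists_dirDeriv SeqComplete.exists_tendsto
    refine ⟨fun q => D (q, w), fun q => D' (q, w), hD.comp (by fun_prop), hD'.comp (by fun_prop),
      fun q => ?_⟩
    have h0 : q + (0 : ℝ) • w = q := by simp
    have := hasDerivAt_mul_of_slope (f := fun t : ℝ => f (q + t • w))
      (g := fun t : ℝ => g (q + t • w)) (f' := D (q, w)) (g' := D' (q, w))
      (hf.continuous.comp (by fun_prop)) (by simpa only [h0] using hDs q w)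
      (by simpa only [h0] using hDs' q w) l
    simpa only [h0, map_add] using this
  let P : (ℝ × ℝ → ℝ) → Prop := fun F => ∃ f g : ℝ × ℝ → B, WeaklySmooth f ∧ WeaklySmooth g ∧
    F = fun q => l (f q * g q)
  have hP : P fun q => l (f q * g q) := ⟨f, g, hf, hg, rfl⟩
  refine contDiff_of_partials (P := P) ?_ ?_ ?_ hP
  · rintro _ ⟨f, g, hf, hg, rfl⟩
    exact l.continuous.comp (hf.continuous.mul hg.continuous)
  · rintro _ ⟨f, g, hf, hg, rfl⟩
    obtain ⟨f₁, g₁, hf₁, hg₁, h⟩ := key (1, 0) f g hf hg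
    refine ⟨fun q => l (f₁ q * g q) + l (f q * g₁ q), fun n hn =>
      (hn _ ⟨f₁, g, hf₁, hg, rfl⟩).add (hn _ ⟨f, g₁, hf, hg₁, rfl⟩), fun t p => ?_⟩
    have h1 := HasDerivAt.comp_sub_const (f := fun s : ℝ => l (f ((t, p) + s • (1, 0)) *
      g ((t, p) + s • (1, 0)))) t t (by simpa using h (t, p))
    simpa using h1
  · rintro _ ⟨f, g, hf, hg, rfl⟩
    obtain ⟨f₁, g₁, hf₁, hg₁, h⟩ := key (0, 1) f g hf hg
    have hd : ∀ t p, HasDerivAt (fun p => l (f (t, p) * g (t, p)))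
        (l (f₁ (t, p) * g (t, p)) + l (f (t, p) * g₁ (t, p))) p := fun t p => by
      have h1 := HasDerivAt.comp_sub_const (f := fun s : ℝ => l (f ((t, p) + s • (0, 1)) *
        g ((t, p) + s • (0, 1)))) p p (by simpa using h (t, p))
      simpa using h1
    refine ⟨fun t p => (hd t p).differentiableAt, fun w =>
      ⟨fun q => w * (l (f₁ q * g q) + l (f q * g₁ q)), fun n hn => contDiff_const.mul
        ((hn _ ⟨f₁, g, hf₁, hg, rfl⟩).add (hn _ ⟨f, g₁, hf, hg₁, rfl⟩)), fun t p => ?_⟩⟩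
    rw [(hd t p).hasFDerivAt.fderiv]
    simp

theorem WeaklySmoothBiPer.mul [T2Space B] {Φ : ℝ → ℝ → B} (hΦ : WeaklySmoothBiPer Φ) {F : ℝ → B}
    (hF : WeaklySmoothPer F) : WeaklySmoothBiPer fun x y => Φ x y * F y := fun l =>
  ⟨WeaklySmooth.mul_prod (f := fun q : ℝ × ℝ => Φ q.1 q.2) (g := fun q => F q.2)
      (fun l => (hΦ l).smooth) (hF.weaklySmooth.comp contDiff_snd) l,
    fun x y => (hΦ (l.comp (mulRightCLM (F y)))).left x y,
    fun x y => by
      have h1 := hF.periodic y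
      have h2 := (hΦ.right x).periodic y
      simp only [h1, h2]⟩

theorem WeaklySmooth.mul {f g : ℝ → B} (hf : WeaklySmooth f) (hg : WeaklySmooth g) :
    WeaklySmooth fun x => f x * g x := fun l =>
  (WeaklySmooth.mul_prod (f := fun q : ℝ × ℝ => f q.1) (g := fun q => g q.1)
    (hf.comp contDiff_fst) (hg.comp contDiff_fst) l).comp
      (f := fun x : ℝ => (x, x)) (by fun_prop)

end Products

end WeakFunctions

/-! ### The rotation action, and the smooth two-point function Δ of a cocycle. -/

section Cocycles

section SkewQuot

/-- The quotient of a skew-periodic function vanishing at `0` by `sin (s / 2)`. -/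
def skewQuot (f : ℝ → ℝ) (s : ℝ) : ℝ :=
  cos (s / 2) * quot (fun s => f s * cos (s / 2)) s 0 + f s * sin (s / 2)

theorem periodic_mul_cos_half {f : ℝ → ℝ} (hf : ∀ s, f (s + 2 * π) = -f s) :
    Function.Periodic (fun s => f s * cos (s / 2)) (2 * π) := fun s => by
  simp only
  rw [hf, show (s + 2 * π) / 2 = s / 2 + π by ring, cos_add_pi, neg_mul_neg]

/-- The factor cos(s/2) makes f periodic, so that `quot` applies; then f = f cos² + f sin²
recombines the two terms. -/
theorem sin_mul_skewQuot {f : ℝ → ℝ} (hf : ∀ s, f (s + 2 * π) = -f s) (h0 : f 0 = 0) (s : ℝ) :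
    sin (s / 2) * skewQuot f s = f s := by
  have h := sin_smul_quot (periodic_mul_cos_half hf) s 0
  simp only [sub_zero, smul_eq_mul, h0, zero_mul] at h
  unfold skewQuot
  linear_combination cos (s / 2) * h + f s * sin_sq_add_cos_sq (s / 2)

theorem skewQuot_add {f : ℝ → ℝ} (hf : ∀ s, f (s + 2 * π) = -f s) (s : ℝ) :
    skewQuot f (s + 2 * π) = skewQuot f s := by
  unfold skewQuot
  rw [hf, show (s + 2 * π) / 2 = s / 2 + π by ring, cos_add_pi, sin_add_pi, neg_mul_neg,
    quot_add_left (periodic_mul_cos_half hf), neg_mul_neg]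

theorem skewQuot_sin_mul (g s : ℝ) : skewQuot (fun s => sin (s / 2) * g) s = g := by
  have hd : HasDerivAt (fun s => sin (s / 2) * g * cos (s / 2))
      ((cos (s / 2) ^ 2 - sin (s / 2) ^ 2) / 2 * g) s := by
    have h1 : HasDerivAt (fun s : ℝ => s / 2) (1 / 2) s := (hasDerivAt_id s).div_const 2
    refine ((h1.sin.mul_const g).mul h1.cos).congr_deriv ?_
    ring
  unfold skewQuot quot
  rw [hd.deriv, sub_zero]
  split_ifs with h
  · have := sin_sq_add_cos_sq (s / 2)
    rw [h] at this ⊢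
    simp only [smul_eq_mul]
    have h1 : cos (s / 2) ^ 2 = 1 := by linarith
    linear_combination (g * cos (s / 2) ^ 2 + g) * h1
  · simp only [zero_div, sin_zero, zero_mul, sub_zero, smul_eq_mul]
    field_simp
    linear_combination g * sin_sq_add_cos_sq (s / 2)

theorem contDiff_skewQuot {E : Type*} [NormedAddCommGroup E] [NormedSpace ℝ E]
    [FiniteDimensional ℝ E] {φ : E × ℝ → ℝ} (hφ : ContDiff ℝ ∞ φ)
    (hper : ∀ p s, φ (p, s + 2 * π) = -φ (p, s)) :
    ContDiff ℝ ∞ fun q : E × ℝ => skewQuot (fun s => φ (q.1, s)) q.2 := by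
  have h := contDiff_quot (φ := fun q : E × ℝ => φ q * cos (q.2 / 2))
    (hφ.mul (by fun_prop)) fun p => periodic_mul_cos_half (hper p)
  unfold skewQuot
  refine ContDiff.add (ContDiff.mul (by fun_prop) ?_) (hφ.mul (by fun_prop))
  exact h.comp (f := fun q : E × ℝ => (q.1, q.2, 0)) (by fun_prop)

end SkewQuot

variable {B : Type*} [Ring B] [Algebra ℝ B] [UniformSpace B] [IsUniformAddGroup B]
  [IsTopologicalRing B] [ContinuousSMul ℝ B] {𝒜 : ZMod 2 → Submodule ℝ B} (R : RotationAction 𝒜)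

namespace RotationAction

theorem continuous_uncurry : Continuous fun p : ℝ × B => R p.1 p.2 := by
  obtain ⟨D, h0, hc, -⟩ := R.smooth
  have := (hc 0).comp (f := fun p : ℝ × B => (p, fun _ : Fin 0 => ((0 : ℝ), (0 : B)))) (by fun_prop)
  simpa only [Function.comp_def, h0] using this

/-- The automorphism `R^x` as a continuous linear map. -/
def clm (x : ℝ) : B →L[ℝ] B := ⟨(R x).toLinearMap, R.continuous_uncurry.comp
  (f := fun b : B => (x, b)) (by fun_prop)⟩

@[simp] theorem clm_apply (x : ℝ) (b : B) : R.clm x b = R x b := rfl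

theorem neg_apply (x : ℝ) (b : B) : R x (R (-x) b) = b := by
  rw [← R.map_add, add_neg_cancel, R.map_zero]

/-- For a vector fixed by R^{2π} the odd component equals its own negative. Evenness thus becomes
invariance under a continuous linear map, which passes through weak constructions. -/
theorem mem_even_iff [GradedAlgebra 𝒜] (b : B) : b ∈ 𝒜 0 ↔ R (2 * π) b = b := by
  classical
  refine ⟨R.periodic b, fun h => ?_⟩
  have hs : b = (DirectSum.decompose 𝒜 b 0 : B) + DirectSum.decompose 𝒜 b 1 := by
    conv_lhs => rw [← DirectSum.sum_support_decompose 𝒜 b]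
    rw [Finset.sum_subset (Finset.subset_univ _) fun i _ hi => by simpa using hi]
    exact (Fin.sum_univ_two _)
  set b₀ := (DirectSum.decompose 𝒜 b 0 : B) with hb₀
  set b₁ := (DirectSum.decompose 𝒜 b 1 : B) with hb₁
  have m₀ : b₀ ∈ 𝒜 0 := SetLike.coe_mem _
  have m₁ : b₁ ∈ 𝒜 1 := SetLike.coe_mem _
  rw [hs, _root_.map_add, R.periodic _ m₀, R.skewPeriodic _ m₁] at h
  have h2 : (2 : ℝ) • b₁ = 0 := by
    have : b₁ + b₁ = 0 := by
      have := add_left_cancel h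
      nth_rewrite 1 [← this]
      simp
    rw [two_smul, this]
  have h3 : b₁ = 0 := by
    have := congrArg (fun z => (2⁻¹ : ℝ) • z) h2
    simpa [smul_smul] using this
  rw [hs, h3, add_zero]
  exact m₀

variable [LocallyConvexSpace ℝ B] [T2Space B]

/-- The derivative of R^x b at x = 0 is linear in b by uniqueness of derivatives and continuous by
joint smoothness. The group law moves it to any x. -/
theorem exists_generator : ∃ T : B →L[ℝ] B, ∀ (l : B →L[ℝ] ℝ) b x,
    HasDerivAt (fun x => l (R x b)) (l (R x (T b))) x := by
  obtain ⟨D, h0, hc, hd⟩ := R.smooth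
  let T : B → B := fun b => D 1 (0, b) (Fin.cons (1, 0) fun _ => 0)
  have hT0 : ∀ (l : B →L[ℝ] ℝ) b, HasDerivAt (fun x => l (R x b)) (l (T b)) 0 := fun l b => by
    have h := hasDerivAt_clm_apply (hd 0 (0, b) (fun _ => 0) (1, 0)) l
    simp only [h0] at h
    simpa [T] using h
  have hadd : ∀ b b', T (b + b') = T b + T b' := fun b b' => eq_of_forall_dual fun l => by
    have h := (hT0 l b).add (hT0 l b')
    rw [_root_.map_add]
    refine (hT0 l (b + b')).unique (h.congr_of_eventuallyEq (Eventually.of_forall fun x => ?_))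
    simp
  have hsmul : ∀ (r : ℝ) b, T (r • b) = r • T b := fun r b => eq_of_forall_dual fun l => by
    have h := (hT0 l b).const_mul r
    rw [_root_.map_smul, smul_eq_mul]
    refine (hT0 l (r • b)).unique (h.congr_of_eventuallyEq (Eventually.of_forall fun x => ?_))
    simp
  refine ⟨⟨⟨⟨T, hadd⟩, hsmul⟩, ?_⟩, fun l b x => ?_⟩
  · exact (hc 1).comp (f := fun b : B => (((0 : ℝ), b),
      (Fin.cons (1, 0) fun _ => 0 : Fin 1 → ℝ × B))) (by fun_prop)
  · have h := HasDerivAt.comp_sub_const (f := fun t => l (R x (R t b))) x x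
      (by simpa using hT0 (l.comp (R.clm x)) b)
    refine h.congr_of_eventuallyEq (Eventually.of_forall fun y => ?_)
    simp only [← R.map_add, add_sub_cancel]

variable [SeqComplete B]

/-- The class of such functions is closed under partial derivatives: in the first variable b is
replaced by T b with T the generator, in the second by b'. -/
theorem contDiff_apply {b : ℝ → B} (hb : WeaklySmooth b) (l : B →L[ℝ] ℝ) :
    ContDiff ℝ ∞ fun q : ℝ × ℝ => l (R q.1 (b q.2)) := by
  obtain ⟨T, hT⟩ := R.exists_generator
  let P : (ℝ × ℝ → ℝ) → Prop := fun F => ∃ b : ℝ → B, WeaklySmooth b ∧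
    F = fun q => l (R q.1 (b q.2))
  have hP : P fun q => l (R q.1 (b q.2)) := ⟨b, hb, rfl⟩
  refine contDiff_of_partials (P := P) ?_ ?_ ?_ hP
  · rintro _ ⟨b, hb, rfl⟩
    have := hb.continuous
    exact l.continuous.comp (R.continuous_uncurry.comp
      (f := fun q : ℝ × ℝ => (q.1, b q.2)) (by fun_prop))
  · rintro _ ⟨b, hb, rfl⟩
    exact ⟨fun q => l (R q.1 (T (b q.2))), fun n hn =>
      hn _ ⟨fun s => T (b s), fun l => hb (l.comp T), rfl⟩, fun t p => hT l (b p) t⟩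
  · rintro _ ⟨b, hb, rfl⟩
    obtain ⟨b', hb', hd, -, -⟩ := hb.exists_deriv SeqComplete.exists_tendsto
    have hd' : ∀ t p, HasDerivAt (fun p => l (R t (b p))) (l (R t (b' p))) p := fun t p =>
      hasDerivAt_clm_apply (hd p) (l.comp (R.clm t))
    refine ⟨fun t p => (hd' t p).differentiableAt, fun w =>
      ⟨fun q => w * l (R q.1 (b' q.2)), fun n hn => contDiff_const.mul (hn _ ⟨b', hb', rfl⟩),
        fun t p => ?_⟩⟩
    rw [(hd' t p).hasFDerivAt.fderiv]
    simp

end RotationAction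

section CocycleQuot

variable {R}

/-- The smooth part `Δ` of the two-point function `R^x c(y - x) = cos ((y - x) / 2) +
sin ((y - x) / 2) Δ(x, y)` of a cocycle. -/
def cocycleQuot (R : RotationAction 𝒜) (c : ℝ → B) (x y : ℝ) : B :=
  weakRep fun l => skewQuot (fun s => l (R x (c s)) - cos (s / 2) * l 1) (y - x)

variable {c : ℝ → B}

theorem IsSkewCocycle.apply_add_two_pi (hc : IsSkewCocycle R c) (x s : ℝ) :
    R (x + 2 * π) (c s) = R x (c s) := by
  rw [R.map_add, R.periodic _ (hc.mem s)]

theorem IsSkewCocycle.gap_add (hc : IsSkewCocycle R c) (l : B →L[ℝ] ℝ) (x s : ℝ) :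
    l (R x (c (s + 2 * π))) - cos ((s + 2 * π) / 2) * l 1 =
      -(l (R x (c s)) - cos (s / 2) * l 1) := by
  rw [hc.skew, show (s + 2 * π) / 2 = s / 2 + π by ring, cos_add_pi]
  simp only [map_neg]
  ring

theorem IsSkewCocycle.gap_zero (hc : IsSkewCocycle R c) (l : B →L[ℝ] ℝ) (x : ℝ) :
    l (R x (c 0)) - cos (0 / 2) * l 1 = 0 := by
  rw [hc.one]; simp

theorem IsSkewCocycle.mul_apply (hc : IsSkewCocycle R c) (x y : ℝ) :
    c x * R x (c (y - x)) = c y := (hc.cocycle y x).symm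

theorem IsSkewCocycle.apply_mul_self (hc : IsSkewCocycle R c) (x : ℝ) :
    R x (c (-x)) * c x = 1 := by
  have h := congrArg (R x) (hc.cocycle 0 (-x))
  rw [hc.one, map_one, map_mul, R.neg_apply, zero_sub, neg_neg] at h
  exact h.symm

variable [LocallyConvexSpace ℝ B] [T2Space B] [SeqComplete B]

theorem IsSkewCocycle.apply_cocycleQuot (hc : IsSkewCocycle R c) (l : B →L[ℝ] ℝ) (x y : ℝ) :
    l (cocycleQuot R c x y) =
      skewQuot (fun s => l (R x (c s)) - cos (s / 2) * l 1) (y - x) := by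
  refine Represented.apply ?_ l
  have hrep : ∀ s, Represented fun l : B →L[ℝ] ℝ => l (R x (c s)) - cos (s / 2) * l 1 :=
    fun s => (represented_apply _).sub ((represented_apply _).mul_left _)
  have hq := Represented.quot
    (a := fun (l : B →L[ℝ] ℝ) s => (l (R x (c s)) - cos (s / 2) * l 1) * cos (s / 2))
    (fun s => by simpa only [mul_comm _ (cos (s / 2))] using (hrep s).mul_left (cos (s / 2)))
    (fun l => by
      have : ContDiff ℝ ∞ fun s => l (R x (c s)) :=
        hc.smooth.weaklySmooth (l.comp (R.clm x))
      exact (this.sub (by fun_prop)).mul (by fun_prop)) (y - x) 0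
  unfold skewQuot
  refine (hq.mul_left _).add ?_
  simpa only [mul_comm _ (sin _)] using (hrep (y - x)).mul_left (sin ((y - x) / 2))

theorem IsSkewCocycle.weaklySmoothBiPer (hc : IsSkewCocycle R c) :
    WeaklySmoothBiPer (cocycleQuot R c) := by
  intro l
  simp only [hc.apply_cocycleQuot]
  refine ⟨?_, fun x y => ?_, fun x y => ?_⟩
  · have h := contDiff_skewQuot (E := ℝ)
      (φ := fun q : ℝ × ℝ => l (R q.1 (c q.2)) - cos (q.2 / 2) * l 1)
      ((R.contDiff_apply hc.smooth.weaklySmooth l).sub (by fun_prop)) (hc.gap_add l)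
    exact h.comp (f := fun q : ℝ × ℝ => (q.1, q.2 - q.1)) (by fun_prop)
  · simp only [hc.apply_add_two_pi]
    rw [← skewQuot_add (hc.gap_add l x) (y - (x + 2 * π))]
    congr 1; ring
  · rw [← skewQuot_add (hc.gap_add l x) (y - x)]
    congr 1; ring

theorem IsSkewCocycle.sin_smul_cocycleQuot (hc : IsSkewCocycle R c) (x y : ℝ) :
    sin ((y - x) / 2) • cocycleQuot R c x y = R x (c (y - x)) - cos ((y - x) / 2) • 1 := by
  refine eq_of_forall_dual fun l => ?_
  rw [map_smul, hc.apply_cocycleQuot, smul_eq_mul,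
    sin_mul_skewQuot (hc.gap_add l x) (hc.gap_zero l x), map_sub, map_smul, smul_eq_mul]

theorem IsSkewCocycle.sin_smul_mul_cocycleQuot (hc : IsSkewCocycle R c) (x y : ℝ) :
    sin ((y - x) / 2) • (c x * cocycleQuot R c x y) = c y - cos ((y - x) / 2) • c x := by
  rw [← mul_smul_comm, hc.sin_smul_cocycleQuot, mul_sub, hc.mul_apply, mul_smul_comm, mul_one]

theorem IsSkewCocycle.apply_rotate (hc : IsSkewCocycle R c) (σ x y : ℝ) :
    R σ (cocycleQuot R c (x - σ) (y - σ)) = cocycleQuot R c x y := by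
  refine eq_of_forall_dual fun l => ?_
  have h := hc.apply_cocycleQuot (l.comp (R.clm σ)) (x - σ) (y - σ)
  simp only [ContinuousLinearMap.comp_apply, RotationAction.clm_apply] at h
  rw [h, hc.apply_cocycleQuot]
  simp only [← R.map_add, add_sub_cancel, map_one, sub_sub_sub_cancel_right]

theorem IsSkewCocycle.cocycleQuot_rotate (hc : IsSkewCocycle R c) (γ x y : ℝ) :
    cocycleQuot R (fun s => R γ (c s)) x y = R γ (cocycleQuot R c x y) := by
  refine weakRep_eq fun l => ?_
  have h := hc.apply_cocycleQuot (l.comp (R.clm γ)) x y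
  simp only [ContinuousLinearMap.comp_apply, RotationAction.clm_apply] at h
  rw [h]
  simp only [← R.map_add, add_comm γ, map_one]

theorem cocycleQuot_linear {G : B} (hG : ∀ x, R x G = G) (x y : ℝ) :
    cocycleQuot R (fun s => cos (s / 2) • (1 : B) + sin (s / 2) • G) x y = G := by
  refine weakRep_eq fun l => ?_
  have e : ∀ s, l (R x (cos (s / 2) • (1 : B) + sin (s / 2) • G)) - cos (s / 2) * l 1 =
      sin (s / 2) * l G := fun s => by
    simp [hG]
  simp only [e, skewQuot_sin_mul]

theorem IsSkewCocycle.apply_two_pi (hc : IsSkewCocycle R c) (x y : ℝ) :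
    R (2 * π) (cocycleQuot R c x y) = cocycleQuot R c x y := by
  rw [← hc.cocycleQuot_rotate]
  simp only [R.periodic _ (hc.mem _)]

end CocycleQuot

end Cocycles

/-! ### The operator J attached to a cocycle and the cocycle law at radius below 1. -/

section RotationOperators

variable {B : Type*} [Ring B] [Algebra ℝ B] [UniformSpace B] [IsUniformAddGroup B]
  [IsTopologicalRing B] [ContinuousSMul ℝ B] [LocallyConvexSpace ℝ B] [T2Space B] [SeqComplete B]

section Operators

/-- The operator with kernel `cot ((y - x) / 2) + Δ(x, y)`. -/
def bottOp (Δ : ℝ → ℝ → B) (G : ℝ → B) (x : ℝ) : B := vhilb G x + vmean fun y => Δ x y * G y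

/-- The operator obtained from `bottOp` by conjugation with `outer`. -/
def rotOp (Δ : ℝ → ℝ → B) (r s α : ℝ) (G : ℝ → B) (x : ℝ) : B :=
  (cos (s / 2) + sin (s / 2) * conjPoisson r (x - α)) • G x
    + bottOp Δ (fun y => (sin (s / 2) * poisson r (y - α)) • G y) x

/-- The vector-valued version of `outer`. -/
def vouter (r s : ℝ) (F : ℝ → B) (x : ℝ) : B :=
  F x - r • (cos (x - s) • (F x - vmean F) - sin (x - s) • vhilb F x)

/-- The vector-valued version of `kernelFull`. -/
def vkernel (Δ : ℝ → ℝ → B) (θ α x y : ℝ) : B :=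
  weakRep fun l => kernelFull (fun x y => l (Δ x y)) θ α x y

/-- The operator with kernel
`cos (α / 2) δ(y - x) + sin (α / 2) cot ((y - x) / 2) + vkernel Δ θ α x y`. -/
def kernelOp (Δ : ℝ → ℝ → B) (θ α : ℝ) (F : ℝ → B) (x : ℝ) : B :=
  cos (α / 2) • F x + sin (α / 2) • vhilb F x + vmean fun y => vkernel Δ θ α x y * F y

variable {Δ : ℝ → ℝ → B} (hΔ : WeaklySmoothBiPer Δ) {F G : ℝ → B}
include hΔ

theorem apply_bottOp (hG : WeaklySmoothPer G) (l : B →L[ℝ] ℝ) (x : ℝ) :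
    l (bottOp Δ G x) = hilb (fun x => l (G x)) x + mean fun y => l (Δ x y * G y) := by
  unfold bottOp
  rw [map_add, apply_vhilb hG, apply_vmean ((hΔ.mul hG).right x).weaklySmooth]

theorem WeaklySmoothPer.bottOp (hG : WeaklySmoothPer G) : WeaklySmoothPer (bottOp Δ G) :=
  hG.vhilb.add (hΔ.mul hG).vmean

theorem bottOp_add (hF : WeaklySmoothPer F) (hG : WeaklySmoothPer G) (x : ℝ) :
    bottOp Δ (fun x => F x + G x) x = bottOp Δ F x + bottOp Δ G x := by
  refine eq_of_forall_dual fun l => ?_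
  rw [map_add, apply_bottOp hΔ (hF.add hG), apply_bottOp hΔ hF, apply_bottOp hΔ hG]
  simp only [map_add, mul_add]
  rw [hilb_add (hF l) (hG l), mean_add ((hΔ.mul hF l).smoothPer_right x).continuous
    ((hΔ.mul hG l).smoothPer_right x).continuous]
  ring

theorem bottOp_smul (hF : WeaklySmoothPer F) (a x : ℝ) :
    bottOp Δ (fun x => a • F x) x = a • bottOp Δ F x := by
  refine eq_of_forall_dual fun l => ?_
  rw [map_smul, apply_bottOp hΔ (WeaklySmoothPer.smul (SmoothPer.const a) hF), apply_bottOp hΔ hF]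
  simp only [map_smul, mul_smul_comm, smul_eq_mul, hilb_mul_left, mean_mul_left]
  ring

end Operators

section Tricomi

variable {𝒜 : ZMod 2 → Submodule ℝ B} {R : RotationAction 𝒜} {c : ℝ → B}
  (hc : IsSkewCocycle R c) {G : ℝ → B}
include hc

/-- The cocycle relation c(x) R^x c(y - x) = c(y) turns c(x) (cot((y - x)/2) + Δ(x, y)) into
cosec((y - x)/2) c(y). -/
theorem IsSkewCocycle.apply_mul_bottOp (hG : WeaklySmoothPer G) (l : B →L[ℝ] ℝ) (x : ℝ) :
    l (c x * bottOp (cocycleQuot R c) G x) = cosecHilb (fun x => l (c x * G x)) x := by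
  have hΔ := hc.weaklySmoothBiPer
  have h := apply_bottOp hΔ hG (l.comp (mulLeftCLM (c x))) x
  simp only [ContinuousLinearMap.comp_apply, mulLeftCLM_apply] at h
  have hG' : SmoothPer fun y => l (c x * G y) := hG (l.comp (mulLeftCLM (c x)))
  have hm : SmoothPer fun y => l (c x * (cocycleQuot R c x y * G y)) :=
    (hΔ.mul hG).right x (l.comp (mulLeftCLM (c x)))
  rw [h, ← mean_comp_add hm.periodic x]
  have hm' := hm.comp_add x
  unfold hilb
  rw [← mean_add (continuous_hilb_integrand_right hG' x) hm'.continuous]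
  refine mean_congr fun u hu => ?_
  have hne := (sin_half_pos hu).ne'
  have e1 := sin_smul_quot hG'.periodic (x + u) x
  have e2 := congrArg (fun b => l (b * G (x + u))) (hc.sin_smul_mul_cocycleQuot x (x + u))
  rw [add_sub_cancel_left] at e1 e2
  simp only [sub_mul, smul_mul_assoc, map_sub, map_smul, smul_eq_mul, mul_assoc] at e1 e2 ⊢
  rw [eq_inv_mul_iff_mul_eq₀ hne, add_comm u x]
  linear_combination cos (u / 2) * e1 + e2

theorem IsSkewCocycle.mul_left_cancel (x : ℝ) {a b : B} (h : c x * a = c x * b) : a = b := by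
  have := congrArg (fun z => R x (c (-x)) * z) h
  simpa only [← mul_assoc, hc.apply_mul_self, one_mul] using this

/-- The scalar Tricomi identity for the skew-periodic function c G. The weight b is real, so it
commutes with c, and c(x) is left cancellable. -/
theorem IsSkewCocycle.bottOp_tricomi {b : ℝ → ℝ} (hb : SmoothPer b) (hG : WeaklySmoothPer G)
    (x : ℝ) :
    bottOp (cocycleQuot R c) (fun x => b x • bottOp (cocycleQuot R c) G x + hilb b x • G x) x =
      hilb b x • bottOp (cocycleQuot R c) G x - b x • G x := by
  have hΔ := hc.weaklySmoothBiPer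
  have hU := WeaklySmoothPer.bottOp hΔ hG
  refine hc.mul_left_cancel x (eq_of_forall_dual fun l => ?_)
  rw [hc.apply_mul_bottOp ((WeaklySmoothPer.smul hb hU).add (WeaklySmoothPer.smul hb.hilb hG))]
  have hg : ContDiff ℝ ∞ fun x => l (c x * G x) :=
    hc.smooth.weaklySmooth.mul hG.weaklySmooth l
  have h := cosecHilb_tricomi hb hg (fun x => by
    rw [hc.skew, hG.periodic x, neg_mul, map_neg]) x
  simp only [← hc.apply_mul_bottOp hG] at h
  simp only [mul_add, mul_sub, mul_smul_comm, map_add, map_sub, map_smul, smul_eq_mul]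
  simpa only [mul_comm (hilb b _)] using h

/-- Composing the two operators produces J b J with b = sin(s/2) P(· - s), which the Tricomi
identity reduces to terms with at most one J. The coefficients agree by the addition formulas for P
and Q. -/
theorem IsSkewCocycle.rotOp_rotOp {r : ℝ} (hr : |r| < 1) (hG : WeaklySmoothPer G) (s t x : ℝ) :
    rotOp (cocycleQuot R c) r s s (rotOp (cocycleQuot R c) r t (s + t) G) x =
      rotOp (cocycleQuot R c) r (s + t) (s + t) G x := by
  have hΔ := hc.weaklySmoothBiPer
  have hP := smoothPer_poisson hr
  have hQ := smoothPer_conjPoisson hr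
  have hB : SmoothPer fun y => sin (s / 2) * poisson r (y - s) :=
    (SmoothPer.const _).mul (hP.comp_sub s)
  have hB' : SmoothPer fun y => sin (t / 2) * poisson r (y - (s + t)) :=
    (SmoothPer.const _).mul (hP.comp_sub (s + t))
  have hA : SmoothPer fun y => cos (s / 2) + sin (s / 2) * conjPoisson r (y - s) :=
    (SmoothPer.const _).add ((SmoothPer.const _).mul (hQ.comp_sub s))
  have hA' : SmoothPer fun y => cos (t / 2) + sin (t / 2) * conjPoisson r (y - (s + t)) :=
    (SmoothPer.const _).add ((SmoothPer.const _).mul (hQ.comp_sub (s + t)))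
  have hHB : ∀ y, hilb (fun y => sin (s / 2) * poisson r (y - s)) y =
      -(sin (s / 2) * conjPoisson r (y - s)) := fun y => by
    rw [hilb_mul_left, hilb_comp_sub, hilb_poisson hr]; ring
  have hBG := WeaklySmoothPer.smul hB' hG
  have hU := WeaklySmoothPer.bottOp hΔ hBG
  have hT := hc.bottOp_tricomi hB hBG x
  simp only [hHB] at hT
  -- The addition formulas at a = y - s and b = y - (s + t), so that (a - b)/2 = t/2.
  have e1 : ∀ y, sin (s / 2) * poisson r (y - s) *
        (cos (t / 2) + sin (t / 2) * conjPoisson r (y - (s + t))) +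
      (cos (s / 2) + sin (s / 2) * conjPoisson r (y - s)) *
        (sin (t / 2) * poisson r (y - (s + t))) =
      sin ((s + t) / 2) * poisson r (y - (s + t)) := fun y => by
    have h := poisson_conjPoisson_add hr (y - s) (y - (s + t))
    rw [show (y - s - (y - (s + t))) / 2 = t / 2 by ring] at h
    rw [add_div, sin_add]
    linear_combination -sin (s / 2) * h
  have e2 : (cos (s / 2) + sin (s / 2) * conjPoisson r (x - s)) *
        (cos (t / 2) + sin (t / 2) * conjPoisson r (x - (s + t))) -
      sin (s / 2) * poisson r (x - s) * (sin (t / 2) * poisson r (x - (s + t))) =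
      cos ((s + t) / 2) + sin ((s + t) / 2) * conjPoisson r (x - (s + t)) := by
    have h := poisson_conjPoisson_sub hr (x - s) (x - (s + t))
    rw [show (x - s - (x - (s + t))) / 2 = t / 2 by ring] at h
    rw [add_div, cos_add, sin_add]
    linear_combination sin (s / 2) * h
  have h1 := bottOp_add hΔ
    ((WeaklySmoothPer.smul hB hU).add (WeaklySmoothPer.smul hB.hilb hBG))
    (WeaklySmoothPer.smul ((hB.mul hA').add (hA.mul hB')) hG) x
  have h2 := bottOp_add hΔ
    (WeaklySmoothPer.smul hB ((WeaklySmoothPer.smul hA' hG).add hU))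
    (WeaklySmoothPer.smul (SmoothPer.const (cos (s / 2))) hBG) x
  rw [bottOp_smul hΔ hBG] at h2
  simp only [hHB, e1] at h1
  rw [hT] at h1
  have e3 : ∀ y, (sin (s / 2) * poisson r (y - s)) •
        bottOp (cocycleQuot R c) (fun x => (sin (t / 2) * poisson r (x - (s + t))) • G x) y +
      (-(sin (s / 2) * conjPoisson r (y - s))) • (sin (t / 2) * poisson r (y - (s + t))) • G y +
      (sin ((s + t) / 2) * poisson r (y - (s + t))) • G y =
      (sin (s / 2) * poisson r (y - s)) •
        ((cos (t / 2) + sin (t / 2) * conjPoisson r (y - (s + t))) • G y +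
        bottOp (cocycleQuot R c) (fun x => (sin (t / 2) * poisson r (x - (s + t))) • G x) y) +
      cos (s / 2) • (sin (t / 2) * poisson r (y - (s + t))) • G y := fun y => by
    rw [← e1]
    module
  simp only [e3] at h1
  unfold rotOp
  rw [h1] at h2
  rw [← e2, eq_sub_of_add_eq h2.symm]
  module

end Tricomi

end RotationOperators

/-! ### The deformed kernel realises the conjugated operator. -/

section KernelOperators

section ScalarOperators

theorem BiPer.mul {Φ Ψ : ℝ → ℝ → ℝ} (hΦ : BiPer Φ) (hΨ : BiPer Ψ) :
    BiPer fun x y => Φ x y * Ψ x y :=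
  ⟨hΦ.smooth.mul hΨ.smooth, fun x y => by rw [hΦ.left, hΨ.left],
    fun x y => by rw [hΦ.right, hΨ.right]⟩

theorem BiPer.swap {Φ : ℝ → ℝ → ℝ} (hΦ : BiPer Φ) : BiPer fun x y => Φ y x :=
  ⟨hΦ.smooth.comp (f := fun q : ℝ × ℝ => (q.2, q.1)) (by fun_prop), fun x y => hΦ.right y x,
    fun x y => hΦ.left y x⟩

theorem SmoothPer.biPer_left {f : ℝ → ℝ} (hf : SmoothPer f) : BiPer fun x _ => f x :=
  ⟨hf.smooth.comp contDiff_fst, fun x _ => hf.periodic x, fun _ _ => rfl⟩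

theorem BiPer.continuous_diag {Φ : ℝ → ℝ → ℝ} (hΦ : BiPer Φ) : Continuous fun y => Φ y y :=
  (hΦ.smooth.comp (f := fun y : ℝ => (y, y)) (by fun_prop)).continuous

theorem BiPer.hilb {Φ : ℝ → ℝ → ℝ} (hΦ : BiPer Φ) : BiPer fun x y => hilb (Φ x) y :=
  ⟨contDiff_hilb (φ := fun q : ℝ × ℝ => Φ q.1 q.2) hΦ.smooth fun x => hΦ.right x,
    fun x y => by rw [show Φ (x + 2 * π) = Φ x from funext (hΦ.left x)],
    fun x => (hΦ.smoothPer_right x).hilb.periodic⟩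

theorem outer_add {F G : ℝ → ℝ} (hF : SmoothPer F) (hG : SmoothPer G) (r s x : ℝ) :
    outer r s (fun x => F x + G x) x = outer r s F x + outer r s G x := by
  unfold outer
  rw [mean_add hF.continuous hG.continuous, hilb_add hF hG]
  ring

theorem outer_mul_left (F : ℝ → ℝ) (r s a x : ℝ) :
    outer r s (fun x => a * F x) x = a * outer r s F x := by
  unfold outer
  rw [mean_mul_left, hilb_mul_left]
  ring

theorem outer_mean {Φ : ℝ → ℝ → ℝ} (hΦ : BiPer Φ) (r s x : ℝ) :
    outer r s (fun x => mean (Φ x)) x = mean fun y => outer r s (fun x => Φ x y) x := by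
  have h1 : Continuous fun y => Φ x y := (hΦ.smoothPer_right x).continuous
  have h2 : Continuous fun y => mean fun x => Φ x y := hΦ.swap.smoothPer_mean.continuous
  have h3 : Continuous fun y => CircleCocycle.hilb (fun x => Φ x y) x :=
    (hΦ.swap.hilb.smoothPer_left x).continuous
  unfold outer
  rw [hilb_mean hΦ, mean_swap (f := fun q : ℝ × ℝ => Φ q.1 q.2) hΦ.smooth.continuous,
    mean_sub h1 (by fun_prop), mean_mul_left, mean_sub (by fun_prop) (by fun_prop),
    mean_mul_left, mean_mul_left, mean_sub h1 h2]

/-- `innerKernel` is a transpose: integrated on the diagonal, it moves P and `outer` to the other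
variable. The Hilbert transform moves by antisymmetry of the cotangent, the mean by Fubini. -/
theorem mean_innerKernel {r : ℝ} (hr : |r| < 1) (α : ℝ) {Ψ : ℝ → ℝ → ℝ} (hΨ : BiPer Ψ) :
    mean (fun y => innerKernel r α (fun z => Ψ z y) y) =
      mean fun y => poisson r (y - α) * outer r α (Ψ y) y := by
  have hP := (smoothPer_poisson hr).comp_sub α
  have hQ := (smoothPer_conjPoisson hr).comp_sub α
  have hC := (smoothPer_cos.comp_sub α).mul hP
  have hPc := hP.continuous
  have hQc := hQ.continuous
  have hQΨ := hQ.biPer_left.mul hΨ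
  have hCΨ := hC.biPer_left.mul hΨ
  have c1 : Continuous fun y => (1 + poisson r (y - α)) * Ψ y y :=
    (continuous_const.add hPc).mul hΨ.continuous_diag
  have c2 : Continuous fun y => hilb (fun z => conjPoisson r (z - α) * Ψ z y) y :=
    hQΨ.swap.hilb.continuous_diag
  have c3 : Continuous fun y => mean fun z => cos (z - α) * poisson r (z - α) * Ψ z y :=
    hCΨ.swap.smoothPer_mean.continuous
  have c4 : Continuous fun y => conjPoisson r (y - α) * hilb (Ψ y) y :=
    hQc.mul hΨ.hilb.continuous_diag
  have c5 : Continuous fun y => cos (y - α) * poisson r (y - α) * mean (Ψ y) :=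
    hC.continuous.mul hΨ.smoothPer_mean.continuous
  simp only [innerKernel_eq hr α (hΨ.smoothPer_left _), poisson_mul_outer hr, mul_assoc r]
  rw [mean_add (by fun_prop) (by fun_prop), mean_add (by fun_prop) (by fun_prop), mean_mul_left,
    mean_mul_left, mean_mul_left, mean_mul_left, mean_sub c1 c2, mean_add c1 c4]
  have e1 := mean_hilb_antisymm hQΨ
  simp only [hilb_mul_left] at e1
  have e2 := mean_swap (f := fun q : ℝ × ℝ => cos (q.1 - α) * poisson r (q.1 - α) * Ψ q.1 q.2)
    hCΨ.smooth.continuous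
  simp only [mean_mul_left] at e2
  rw [← e2, e1]
  ring

end ScalarOperators

variable {B : Type*} [Ring B] [Algebra ℝ B] [UniformSpace B] [IsUniformAddGroup B]
  [IsTopologicalRing B] [ContinuousSMul ℝ B] [LocallyConvexSpace ℝ B] [T2Space B] [SeqComplete B]

section KernelOp

variable {F G : ℝ → B}

theorem WeaklySmoothPer.mul_biPer (hF : WeaklySmoothPer F) (hG : WeaklySmoothPer G) :
    WeaklySmoothBiPer fun x y => F x * G y := fun l =>
  ⟨WeaklySmooth.mul_prod (f := fun q : ℝ × ℝ => F q.1) (g := fun q => G q.2)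
      (hF.weaklySmooth.comp contDiff_fst) (hG.weaklySmooth.comp contDiff_snd) l,
    fun x y => by simp only [hF.periodic x], fun x y => by simp only [hG.periodic y]⟩

theorem apply_vouter (hF : WeaklySmoothPer F) (l : B →L[ℝ] ℝ) (r s x : ℝ) :
    l (vouter r s F x) = outer r s (fun x => l (F x)) x := by
  unfold vouter outer
  simp only [map_sub, map_smul, smul_eq_mul, apply_vmean hF.weaklySmooth, apply_vhilb hF]

theorem WeaklySmoothPer.vouter (hF : WeaklySmoothPer F) (r s : ℝ) :
    WeaklySmoothPer (vouter r s F) := fun l => by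
  simpa only [apply_vouter hF] using (hF l).outer r s

variable {Δ : ℝ → ℝ → B} (hΔ : WeaklySmoothBiPer Δ)
include hΔ

theorem apply_vkernel (l : B →L[ℝ] ℝ) (θ α x y : ℝ) :
    l (vkernel Δ θ α x y) = kernelFull (fun x y => l (Δ x y)) θ α x y :=
  (Represented.kernelFull (δ := fun l x y => l (Δ x y)) (fun x y => represented_apply (Δ x y))
    hΔ θ α x y).apply l

theorem weaklySmooth_vkernel :
    WeaklySmooth fun q : ℝ × ℝ × ℝ × ℝ => vkernel Δ q.1 q.2.1 q.2.2.1 q.2.2.2 := fun l => by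
  simpa only [apply_vkernel hΔ] using contDiff_kernelFull (hΔ l)

theorem weaklySmoothBiPer_vkernel (θ α : ℝ) : WeaklySmoothBiPer (vkernel Δ θ α) := fun l =>
  ⟨((weaklySmooth_vkernel hΔ).comp (g := fun q : ℝ × ℝ => (θ, α, q.1, q.2)) (by fun_prop)) l,
    fun x y => by simp only [apply_vkernel hΔ, kernelFull_add_left (hΔ l)],
    fun x y => by simp only [apply_vkernel hΔ, kernelFull_add_right (hΔ l)]⟩

theorem apply_kernelOp (hF : WeaklySmoothPer F) (l : B →L[ℝ] ℝ) (θ α x : ℝ) :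
    l (kernelOp Δ θ α F x) = cos (α / 2) * l (F x) + sin (α / 2) * hilb (fun x => l (F x)) x
      + mean fun y => l (vkernel Δ θ α x y * F y) := by
  unfold kernelOp
  rw [map_add, map_add, map_smul, map_smul, apply_vhilb hF,
    apply_vmean (((weaklySmoothBiPer_vkernel hΔ θ α).mul hF).right x).weaklySmooth]
  rfl

theorem WeaklySmoothPer.kernelOp (hF : WeaklySmoothPer F) (θ α : ℝ) :
    WeaklySmoothPer (kernelOp Δ θ α F) :=
  ((WeaklySmoothPer.smul (SmoothPer.const _) hF).add
    (WeaklySmoothPer.smul (SmoothPer.const _) hF.vhilb)).add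
    ((weaklySmoothBiPer_vkernel hΔ θ α).mul hF).vmean

/-- On the singular part this is `outer_rotation`. On the smooth part `outer r 0` undoes `outerInv`
in x, and `mean_innerKernel` transfers P · `outer r α` from Δ to F. -/
theorem outer_kernelOp {θ : ℝ} (hθ : θ < π / 4) (hF : WeaklySmoothPer F) (l : B →L[ℝ] ℝ)
    (α x : ℝ) : outer (rad θ) 0 (fun x => l (kernelOp Δ θ α F x)) x =
      l (rotOp Δ (rad θ) α α (vouter (rad θ) α F) x) := by
  have hr := abs_rad_lt_one hθ
  have hS := (weaklySmoothBiPer_vkernel hΔ θ α).mul hF l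
  have hO := hF.vouter (rad θ) α
  have hB := WeaklySmoothPer.smul ((SmoothPer.const (sin (α / 2))).mul
    ((smoothPer_poisson hr).comp_sub α)) hO
  simp only [apply_kernelOp hΔ hF]
  rw [outer_add (((SmoothPer.const _).mul (hF l)).add ((SmoothPer.const _).mul (hF l).hilb))
    hS.smoothPer_mean, outer_add ((SmoothPer.const _).mul (hF l))
    ((SmoothPer.const _).mul (hF l).hilb), outer_mul_left, outer_mul_left,
    outer_rotation hr α (hF l), outer_mean hS]
  have e1 : ∀ y, outer (rad θ) 0 (fun x => l (vkernel Δ θ α x y * F y)) x =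
      sin (α / 2) * innerKernel (rad θ) α (fun z => l (Δ x z * F y)) y := fun y => by
    have hl : BiPer fun x z => l (Δ x z * F y) := hΔ (l.comp (mulRightCLM (F y)))
    rw [← outer_kernelOne hl hθ]
    congr 1; funext x
    have := apply_vkernel hΔ (l.comp (mulRightCLM (F y))) θ α x y
    simp only [ContinuousLinearMap.comp_apply, mulRightCLM_apply] at this
    rw [this, kernelFull, cut_of_le hθ.le, zero_mul, sub_zero]
  simp only [e1, mean_mul_left]
  rw [mean_innerKernel hr α ((hΔ.right x).mul_biPer hF l)]
  unfold rotOp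
  rw [map_add, map_smul, apply_bottOp hΔ hB, apply_vouter hF]
  simp only [map_smul, mul_smul_comm, smul_eq_mul, apply_vouter hF, mul_assoc (sin (α / 2)),
    mean_mul_left]
  have e2 : ∀ y, l (Δ x y * vouter (rad θ) α F y) =
      outer (rad θ) α (fun z => l (Δ x y * F z)) y := fun y =>
    apply_vouter hF (l.comp (mulLeftCLM (Δ x y))) (rad θ) α y
  simp only [e2]
  ring

end KernelOp

end KernelOperators

/-! ### Conjugation by internal rotations and the cocycle law up to θ = π/4. -/

section InternalRotations

theorem outer_sub {F G : ℝ → ℝ} (hF : SmoothPer F) (hG : SmoothPer G) (r s x : ℝ) :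
    outer r s (fun x => F x - G x) x = outer r s F x - outer r s G x := by
  unfold outer
  rw [mean_sub hF.continuous hG.continuous, hilb_sub hF hG]
  ring

theorem outer_comp_add {F : ℝ → ℝ} (hF : SmoothPer F) (r s t x : ℝ) :
    outer r s (fun x => F (x + t)) x = outer r (s + t) F (x + t) := by
  unfold outer
  rw [mean_comp_add hF.periodic, hilb_comp_add, add_sub_add_right_eq_sub]

variable {B : Type*} [Ring B] [Algebra ℝ B] [UniformSpace B] [IsUniformAddGroup B]
  [IsTopologicalRing B] [ContinuousSMul ℝ B] [LocallyConvexSpace ℝ B] [T2Space B] [SeqComplete B]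
  {𝒜 : ZMod 2 → Submodule ℝ B} {R : RotationAction 𝒜} {c : ℝ → B}

/-- Conjugation of an operator by an internal rotation. -/
def conjOp (R : RotationAction 𝒜) (σ : ℝ) (T : (ℝ → B) → ℝ → B) (F : ℝ → B) (x : ℝ) : B :=
  R σ (T (fun y => R (-σ) (F (y + σ))) (x - σ))

theorem WeaklySmoothPer.rotate {F : ℝ → B} (hF : WeaklySmoothPer F) (R : RotationAction 𝒜)
    (σ t : ℝ) : WeaklySmoothPer fun y => R σ (F (y + t)) := (hF.comp_add t).clm (R.clm σ)

theorem WeaklySmoothPer.conjOp_kernelOp {Δ : ℝ → ℝ → B} (hΔ : WeaklySmoothBiPer Δ) {F : ℝ → B}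
    (hF : WeaklySmoothPer F) (R : RotationAction 𝒜) (σ θ β : ℝ) :
    WeaklySmoothPer (conjOp R σ (CircleCocycle.kernelOp Δ θ β) F) :=
  WeaklySmoothPer.rotate (WeaklySmoothPer.kernelOp hΔ (hF.rotate R (-σ) σ) θ β) R σ (-σ)

theorem vouter_rotate {F : ℝ → B} (hF : WeaklySmoothPer F) (R : RotationAction 𝒜) (σ r s y : ℝ) :
    vouter r s (fun y => R (-σ) (F (y + σ))) y = R (-σ) (vouter r (s + σ) F (y + σ)) := by
  refine eq_of_forall_dual fun l => ?_
  have h := apply_vouter hF (l.comp (R.clm (-σ))) r (s + σ) (y + σ)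
  rw [apply_vouter (hF.rotate R (-σ) σ),
    outer_comp_add (F := fun y => l (R (-σ) (F y))) (hF (l.comp (R.clm (-σ))))]
  exact h.symm

section Rotation

variable (hc : IsSkewCocycle R c) {F G : ℝ → B}
include hc

/-- H commutes with translations and constant linear maps, and R^σ Δ(x - σ, y - σ) = Δ(x, y). -/
theorem IsSkewCocycle.bottOp_rotate (hG : WeaklySmoothPer G) (σ x : ℝ) :
    conjOp R σ (bottOp (cocycleQuot R c)) G x = bottOp (cocycleQuot R c) G x := by
  have hΔ := hc.weaklySmoothBiPer
  refine eq_of_forall_dual fun l => ?_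
  have h := apply_bottOp hΔ (hG.rotate R (-σ) σ) (l.comp (R.clm σ)) (x - σ)
  simp only [ContinuousLinearMap.comp_apply, RotationAction.clm_apply, map_mul, R.neg_apply] at h
  refine h.trans ?_
  have e : ∀ y, R σ (cocycleQuot R c (x - σ) y) = cocycleQuot R c x (y + σ) := fun y => by
    rw [← hc.apply_rotate σ x (y + σ), add_sub_cancel_right]
  simp only [e]
  rw [apply_bottOp hΔ hG, hilb_comp_add (fun y => l (G y)), sub_add_cancel,
    mean_comp_add (f := fun y => l (cocycleQuot R c x y * G y)) ((hΔ.mul hG l).right x)]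

theorem IsSkewCocycle.rotOp_rotate {r : ℝ} (hr : |r| < 1) (hG : WeaklySmoothPer G)
    (σ s α x : ℝ) : conjOp R σ (rotOp (cocycleQuot R c) r s α) G x =
      rotOp (cocycleQuot R c) r s (α + σ) G x := by
  have hB := WeaklySmoothPer.smul ((SmoothPer.const (sin (s / 2))).mul
    ((smoothPer_poisson hr).comp_sub (α + σ))) hG
  have h := hc.bottOp_rotate hB σ x
  unfold conjOp at h ⊢
  unfold rotOp
  rw [← h]
  simp only [map_add, map_smul, R.neg_apply, sub_add_cancel, add_sub_add_right_eq_sub]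
  rw [show x - σ - α = x - (α + σ) by ring]

theorem IsSkewCocycle.vouter_conjOp_kernelOp {θ : ℝ} (hθ : θ < π / 4) (hF : WeaklySmoothPer F)
    (σ β x : ℝ) : vouter (rad θ) σ (conjOp R σ (kernelOp (cocycleQuot R c) θ β) F) x =
      rotOp (cocycleQuot R c) (rad θ) β (β + σ) (vouter (rad θ) (β + σ) F) x := by
  have hΔ := hc.weaklySmoothBiPer
  refine eq_of_forall_dual fun l => ?_
  have hK := WeaklySmoothPer.kernelOp hΔ (hF.rotate R (-σ) σ) θ β
  have h := outer_kernelOp hΔ hθ (hF.rotate R (-σ) σ) (l.comp (R.clm σ)) β (x - σ)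
  rw [funext (vouter_rotate hF R σ (rad θ) β)] at h
  rw [apply_vouter (WeaklySmoothPer.conjOp_kernelOp hΔ hF R σ θ β),
    ← hc.rotOp_rotate (abs_rad_lt_one hθ) (hF.vouter _ _) σ]
  refine Eq.trans ?_ h
  have := outer_comp_add (hK (l.comp (R.clm σ))) (rad θ) σ (-σ) x
  rw [add_neg_cancel] at this
  exact this

/-- After applying the injective operator `outer r 0`, the left factor contributes `outer r σ` on
its right. This intertwines the rotated second factor, leaving the product treated in `rotOp_rotOp`.
-/
theorem IsSkewCocycle.kernelOp_add_of_lt {θ : ℝ} (hθ : θ < π / 4) (hF : WeaklySmoothPer F)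
    (σ β x : ℝ) : kernelOp (cocycleQuot R c) θ (σ + β) F x =
      kernelOp (cocycleQuot R c) θ σ (conjOp R σ (kernelOp (cocycleQuot R c) θ β) F) x := by
  have hΔ := hc.weaklySmoothBiPer
  have hr := abs_rad_lt_one hθ
  have hG := WeaklySmoothPer.conjOp_kernelOp hΔ hF R σ θ β
  refine eq_of_forall_dual fun l => sub_eq_zero.1 ?_
  have h1 := WeaklySmoothPer.kernelOp hΔ hF θ (σ + β) l
  have h2 := WeaklySmoothPer.kernelOp hΔ hG θ σ l
  refine outer_injective hr (h1.sub h2) (fun x => ?_) x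
  rw [outer_sub h1 h2, outer_kernelOp hΔ hθ hF, outer_kernelOp hΔ hθ hG,
    funext (hc.vouter_conjOp_kernelOp hθ hF σ β), add_comm β σ,
    hc.rotOp_rotOp hr (hF.vouter _ _), sub_self]

end Rotation

section Limit

variable {Δ : ℝ → ℝ → B} (hΔ : WeaklySmoothBiPer Δ)
include hΔ

theorem continuous_kernelOp {Φ : ℝ → ℝ → B} (hΦ : WeaklySmooth fun q : ℝ × ℝ => Φ q.1 q.2)
    (hper : ∀ θ, WeaklySmoothPer (Φ θ)) (l : B →L[ℝ] ℝ) (α x : ℝ) :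
    Continuous fun θ => l (kernelOp Δ θ α (Φ θ) x) := by
  simp only [apply_kernelOp hΔ (hper _)]
  have h1 : Continuous fun θ => l (Φ θ x) :=
    ((hΦ l).comp (f := fun θ : ℝ => (θ, x)) (by fun_prop)).continuous
  have h2 : Continuous fun θ => hilb (fun x => l (Φ θ x)) x :=
    ((contDiff_hilb (φ := fun q : ℝ × ℝ => l (Φ q.1 q.2)) (hΦ l) fun θ => (hper θ l).periodic).comp
      (f := fun θ : ℝ => (θ, x)) (by fun_prop)).continuous
  have h3 : Continuous fun q : ℝ × ℝ => l (vkernel Δ q.1 α x q.2 * Φ q.1 q.2) :=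
    l.continuous.comp (((weaklySmooth_vkernel hΔ).continuous.comp
      (f := fun q : ℝ × ℝ => (q.1, α, x, q.2)) (by fun_prop)).mul hΦ.continuous)
  exact ((continuous_const.mul h1).add (continuous_const.mul h2)).add (continuous_mean h3)

theorem weaklySmooth_conjOp_kernelOp_one (R : RotationAction 𝒜) (σ β : ℝ) :
    WeaklySmooth fun q : ℝ × ℝ => conjOp R σ (kernelOp Δ q.1 β) (fun _ => 1) q.2 := by
  intro l
  unfold conjOp
  have h : ∀ q : ℝ × ℝ, l (R σ (kernelOp Δ q.1 β (fun _ => R (-σ) 1) (q.2 - σ))) =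
      cos (β / 2) * l 1 + mean fun z => l (R σ (vkernel Δ q.1 β (q.2 - σ) z)) := fun q => by
    have := apply_kernelOp hΔ (WeaklySmoothPer.const (R (-σ) 1)) (l.comp (R.clm σ)) q.1 β (q.2 - σ)
    simpa only [ContinuousLinearMap.comp_apply, RotationAction.clm_apply, R.neg_apply, hilb_const,
      mul_zero, add_zero, map_one, mul_one] using this
  simp only [h]
  refine contDiff_const.add (contDiff_mean (E := ℝ × ℝ)
    (φ := fun s : (ℝ × ℝ) × ℝ => l (R σ (vkernel Δ s.1.1 β (s.1.2 - σ) s.2))) ?_)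
  exact (weaklySmooth_vkernel hΔ (l.comp (R.clm σ))).comp
    (f := fun s : (ℝ × ℝ) × ℝ => (s.1.1, β, s.1.2 - σ, s.2)) (by fun_prop)

end Limit

/-- The limit θ → π/4 from below. The constant function 1 suffices, because at π/4 the smooth part
depends on x only and is recovered from the value of the operator at 1. -/
theorem IsSkewCocycle.kernelOp_add_one (hc : IsSkewCocycle R c) (σ β x : ℝ) :
    kernelOp (cocycleQuot R c) (π / 4) (σ + β) (fun _ => 1) x =
      kernelOp (cocycleQuot R c) (π / 4) σ
        (conjOp R σ (kernelOp (cocycleQuot R c) (π / 4) β) fun _ => 1) x := by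
  have hΔ := hc.weaklySmoothBiPer
  have h1 := WeaklySmoothPer.const (1 : B)
  refine eq_of_forall_dual fun l => ?_
  have hl : Continuous fun θ => l (kernelOp (cocycleQuot R c) θ (σ + β) (fun _ => 1) x) :=
    continuous_kernelOp hΔ (Φ := fun _ _ => 1) (fun l => contDiff_const) (fun _ => h1) l _ x
  have hr : Continuous fun θ => l (kernelOp (cocycleQuot R c) θ σ
      (conjOp R σ (kernelOp (cocycleQuot R c) θ β) fun _ => 1) x) :=
    continuous_kernelOp hΔ (weaklySmooth_conjOp_kernelOp_one hΔ R σ β)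
      (fun θ => WeaklySmoothPer.conjOp_kernelOp hΔ h1 R σ θ β) l _ x
  have hsub : Iio (π / 4) ⊆ {θ | l (kernelOp (cocycleQuot R c) θ (σ + β) (fun _ => 1) x) =
      l (kernelOp (cocycleQuot R c) θ σ
        (conjOp R σ (kernelOp (cocycleQuot R c) θ β) fun _ => 1) x)} := fun θ hθ =>
    congrArg l (hc.kernelOp_add_of_lt hθ h1 σ β x)
  have := closure_minimal hsub (isClosed_eq hl hr)
  rw [closure_Iio] at this
  exact this (mem_Iic.2 le_rfl)

end InternalRotations

/-! ### Operators whose smooth part depends on x only; the cocycle law for all θ. -/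

section Interpolation

variable {B : Type*} [Ring B] [Algebra ℝ B] [UniformSpace B] [IsUniformAddGroup B]
  [IsTopologicalRing B] [ContinuousSMul ℝ B] [LocallyConvexSpace ℝ B] [T2Space B] [SeqComplete B]

section VectorCalculus

variable {F G : ℝ → B}

theorem vmean_const (b : B) : vmean (fun _ => b) = b :=
  weakRep_eq fun _ => (mean_const _).symm

theorem vmean_add (hF : WeaklySmoothPer F) (hG : WeaklySmoothPer G) :
    vmean (fun x => F x + G x) = vmean F + vmean G :=
  weakRep_eq fun l => by
    simp only [map_add, apply_vmean hF.weaklySmooth, apply_vmean hG.weaklySmooth]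
    rw [mean_add (hF l).continuous (hG l).continuous]

theorem vmean_clm (hF : WeaklySmoothPer F) (T : B →L[ℝ] B) :
    vmean (fun x => T (F x)) = T (vmean F) :=
  weakRep_eq fun l => apply_vmean hF.weaklySmooth (l.comp T)

theorem vmean_smul (hF : WeaklySmoothPer F) (a : ℝ) :
    vmean (fun x => a • F x) = a • vmean F :=
  vmean_clm hF (a • ContinuousLinearMap.id ℝ B)

theorem vmean_mul_left (hF : WeaklySmoothPer F) (b : B) :
    vmean (fun x => b * F x) = b * vmean F := vmean_clm hF (mulLeftCLM b)

theorem vmean_mul_right (hF : WeaklySmoothPer F) (b : B) :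
    vmean (fun x => F x * b) = vmean F * b := vmean_clm hF (mulRightCLM b)

theorem vmean_comp_add (hF : WeaklySmoothPer F) (s : ℝ) :
    vmean (fun x => F (x + s)) = vmean F :=
  weakRep_eq fun l => by
    rw [apply_vmean hF.weaklySmooth, mean_comp_add (f := fun x => l (F x)) (hF l).periodic]

theorem vhilb_add (hF : WeaklySmoothPer F) (hG : WeaklySmoothPer G) (x : ℝ) :
    vhilb (fun x => F x + G x) x = vhilb F x + vhilb G x :=
  weakRep_eq fun l => by
    simp only [map_add, apply_vhilb hF, apply_vhilb hG]
    rw [hilb_add (hF l) (hG l)]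

theorem vhilb_clm (hF : WeaklySmoothPer F) (T : B →L[ℝ] B) (x : ℝ) :
    vhilb (fun x => T (F x)) x = T (vhilb F x) :=
  weakRep_eq fun l => apply_vhilb hF (l.comp T) x

theorem vhilb_smul (hF : WeaklySmoothPer F) (a x : ℝ) :
    vhilb (fun x => a • F x) x = a • vhilb F x :=
  vhilb_clm hF (a • ContinuousLinearMap.id ℝ B) x

theorem vhilb_mul_right (hF : WeaklySmoothPer F) (b : B) (x : ℝ) :
    vhilb (fun x => F x * b) x = vhilb F x * b := vhilb_clm hF (mulRightCLM b) x

theorem vhilb_const (b : B) (x : ℝ) : vhilb (fun _ => b) x = 0 :=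
  weakRep_eq fun _ => by rw [map_zero, hilb_const]

theorem vhilb_comp_add (hF : WeaklySmoothPer F) (s x : ℝ) :
    vhilb (fun x => F (x + s)) x = vhilb F (x + s) :=
  weakRep_eq fun l => by rw [apply_vhilb hF, hilb_comp_add (fun x => l (F x))]

theorem vhilb_vhilb (hF : WeaklySmoothPer F) (x : ℝ) :
    vhilb (vhilb F) x = -F x + vmean F :=
  weakRep_eq fun l => by
    simp only [apply_vhilb hF, map_add, map_neg, apply_vmean hF.weaklySmooth]
    exact (hilb_hilb (hF l) x).symm

theorem vmean_vhilb (hF : WeaklySmoothPer F) : vmean (vhilb F) = 0 :=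
  weakRep_eq fun l => by
    simp only [apply_vhilb hF, map_zero]
    exact (mean_hilb (hF l)).symm

end VectorCalculus

section AffineOp

/-- The operator with kernel `cos (s / 2) δ(y - x) + sin (s / 2) cot ((y - x) / 2) + S(x)`. -/
def affineOp (s : ℝ) (S F : ℝ → B) (x : ℝ) : B :=
  cos (s / 2) • F x + sin (s / 2) • vhilb F x + S x * vmean F

/-- The smooth part of the composite of two operators `affineOp`. -/
def affineComp (s t : ℝ) (S T : ℝ → B) (x : ℝ) : B :=
  (sin (s / 2) * sin (t / 2)) • (1 : B) + cos (s / 2) • T x + sin (s / 2) • vhilb T x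
    + cos (t / 2) • S x + S x * vmean T

variable {F S T : ℝ → B}

theorem WeaklySmoothPer.mul_const (hF : WeaklySmoothPer F) (b : B) :
    WeaklySmoothPer fun x => F x * b := hF.clm (mulRightCLM b)

theorem WeaklySmoothPer.const_smul (hF : WeaklySmoothPer F) (a : ℝ) :
    WeaklySmoothPer fun x => a • F x := WeaklySmoothPer.smul (SmoothPer.const a) hF

/-- The class is closed because H² = -1 + mean and the mean of HF vanishes; the mean in H² accounts
for the constant sin(s/2) sin(t/2). -/
theorem affineOp_affineOp (hT : WeaklySmoothPer T) (hF : WeaklySmoothPer F) (s t x : ℝ) :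
    affineOp s S (affineOp t T F) x = affineOp (s + t) (affineComp s t S T) F x := by
  have h1 := hF.const_smul (cos (t / 2))
  have h2 := hF.vhilb.const_smul (sin (t / 2))
  have h3 := hT.mul_const (vmean F)
  have e1 : vhilb (affineOp t T F) x =
      cos (t / 2) • vhilb F x + sin (t / 2) • (-F x + vmean F) + vhilb T x * vmean F := by
    unfold affineOp
    rw [vhilb_add (h1.add h2) h3, vhilb_add h1 h2, vhilb_smul hF, vhilb_smul hF.vhilb,
      vhilb_mul_right hT, vhilb_vhilb hF]
  have e2 : vmean (affineOp t T F) = cos (t / 2) • vmean F + vmean T * vmean F := by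
    unfold affineOp
    rw [vmean_add (h1.add h2) h3, vmean_add h1 h2, vmean_smul hF, vmean_smul hF.vhilb,
      vmean_mul_right hT, vmean_vhilb hF, smul_zero, add_zero]
  rw [affineOp, e1, e2]
  unfold affineOp affineComp
  rw [add_div, cos_add, sin_add]
  simp only [mul_add, add_mul, smul_mul_assoc, mul_smul_comm, one_mul, mul_assoc]
  module

theorem affineOp_one (s x : ℝ) : affineOp s S (fun _ => 1) x = cos (s / 2) • 1 + S x := by
  rw [affineOp, vhilb_const, vmean_const, smul_zero, add_zero, mul_one]

theorem vmean_affineComp (hS : WeaklySmoothPer S) (hT : WeaklySmoothPer T) (s t : ℝ) :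
    vmean (affineComp s t S T) = (sin (s / 2) * sin (t / 2)) • (1 : B) + cos (s / 2) • vmean T
      + cos (t / 2) • vmean S + vmean S * vmean T := by
  have h1 := WeaklySmoothPer.const ((sin (s / 2) * sin (t / 2)) • (1 : B))
  have h2 := hT.const_smul (cos (s / 2))
  have h3 := hT.vhilb.const_smul (sin (s / 2))
  have h4 := hS.const_smul (cos (t / 2))
  unfold affineComp
  rw [vmean_add (((h1.add h2).add h3).add h4) (hS.mul_const _), vmean_add ((h1.add h2).add h3) h4,
    vmean_add (h1.add h2) h3, vmean_add h1 h2, vmean_const, vmean_smul hT, vmean_smul hT.vhilb,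
    vmean_smul hS, vmean_mul_right hS, vmean_vhilb hT, smul_zero, add_zero]

/-- Replacing functions by interpolations with their means is compatible with composition. -/
theorem affineComp_interpolate (hS : WeaklySmoothPer S) (hT : WeaklySmoothPer T) (s t τ x : ℝ) :
    affineComp s t (fun x => (1 - τ) • S x + τ • vmean S) (fun x => (1 - τ) • T x + τ • vmean T) x =
      (1 - τ) • affineComp s t S T x + τ • vmean (affineComp s t S T) := by
  have h1 := hT.const_smul (1 - τ)
  have h2 := WeaklySmoothPer.const (τ • vmean T)
  rw [vmean_affineComp hS hT]
  unfold affineComp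
  rw [vmean_add h1 h2, vhilb_add h1 h2, vhilb_const, vmean_const, vmean_smul hT, vhilb_smul hT]
  simp only [mul_add, add_mul, smul_mul_assoc, mul_smul_comm]
  module

variable {𝒜 : ZMod 2 → Submodule ℝ B} {R : RotationAction 𝒜} {c : ℝ → B}

theorem conjOp_affineOp (hF : WeaklySmoothPer F) (R : RotationAction 𝒜) (σ t x : ℝ) :
    conjOp R σ (affineOp t T) F x = affineOp t (fun x => R σ (T (x - σ))) F x := by
  have h := hF.comp_add σ
  have e1 := vhilb_clm h (R.clm (-σ)) (x - σ)
  have e2 := vmean_clm h (R.clm (-σ))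
  simp only [RotationAction.clm_apply] at e1 e2
  unfold conjOp affineOp
  rw [e1, e2, vhilb_comp_add hF, vmean_comp_add hF]
  simp only [map_add, map_smul, map_mul, R.neg_apply, sub_add_cancel]

theorem WeaklySmoothBiPer.left {Φ : ℝ → ℝ → B} (h : WeaklySmoothBiPer Φ) (y : ℝ) :
    WeaklySmoothPer fun x => Φ x y := fun l => (h l).smoothPer_left y

theorem conjOp_congr {T T' : (ℝ → B) → ℝ → B} (h : ∀ F, WeaklySmoothPer F → ∀ x, T F x = T' F x)
    {F : ℝ → B} (hF : WeaklySmoothPer F) (R : RotationAction 𝒜) (σ x : ℝ) :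
    conjOp R σ T F x = conjOp R σ T' F x := by
  unfold conjOp
  rw [h _ (hF.rotate R (-σ) σ)]

variable {Δ : ℝ → ℝ → B} (hΔ : WeaklySmoothBiPer Δ)
include hΔ

theorem vkernel_eq {θ : ℝ} (hθ : π / 4 ≤ θ) (α x y : ℝ) :
    vkernel Δ θ α x y = (1 - cut θ) • vkernel Δ (π / 4) α x 0
      + cut θ • vmean fun x => vkernel Δ (π / 4) α x 0 := by
  refine eq_of_forall_dual fun l => ?_
  have hπ : π / 4 ≤ π := by linarith [pi_pos]
  have e : ∀ x, l (vkernel Δ (π / 4) α x 0) = kernelOne (fun x y => l (Δ x y)) π α x 0 := fun x => by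
    rw [apply_vkernel hΔ, kernelFull, cut_of_le le_rfl, kernelOne_eq_pi (hΔ l) le_rfl]
    ring
  rw [map_add, map_smul, map_smul,
    apply_vmean ((weaklySmoothBiPer_vkernel hΔ (π / 4) α).left 0).weaklySmooth]
  simp only [e]
  rw [apply_vkernel hΔ, kernelFull, kernelOne_eq_pi (hΔ l) hθ]
  simp only [kernelOne_eq_pi (hΔ l) hπ α _ y, smul_eq_mul]
  ring

theorem kernelOp_eq {θ : ℝ} (hθ : π / 4 ≤ θ) (hF : WeaklySmoothPer F) (α x : ℝ) :
    kernelOp Δ θ α F x = affineOp α (fun x => (1 - cut θ) • vkernel Δ (π / 4) α x 0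
      + cut θ • vmean fun x => vkernel Δ (π / 4) α x 0) F x := by
  unfold kernelOp affineOp
  simp only [vkernel_eq hΔ hθ, vmean_mul_left hF]

end AffineOp

section Cocycle

variable {𝒜 : ZMod 2 → Submodule ℝ B} {R : RotationAction 𝒜} {c : ℝ → B}
  (hc : IsSkewCocycle R c)
include hc

/-- Evaluating the composition law at the constant function 1 reads off the smooth parts. -/
theorem IsSkewCocycle.vkernel_add (σ β x : ℝ) :
    vkernel (cocycleQuot R c) (π / 4) (σ + β) x 0 =
      affineComp σ β (fun x => vkernel (cocycleQuot R c) (π / 4) σ x 0)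
        (fun x => R σ (vkernel (cocycleQuot R c) (π / 4) β (x - σ) 0)) x := by
  have hΔ := hc.weaklySmoothBiPer
  have h1 := WeaklySmoothPer.const (1 : B)
  have hω : ∀ α, WeaklySmoothPer fun x => vkernel (cocycleQuot R c) (π / 4) α x 0 := fun α =>
    (weaklySmoothBiPer_vkernel hΔ (π / 4) α).left 0
  have hω' : WeaklySmoothPer fun x => R σ (vkernel (cocycleQuot R c) (π / 4) β (x - σ) 0) :=
    (hω β).rotate R σ (-σ)
  have hK : ∀ α F, WeaklySmoothPer F → ∀ x, kernelOp (cocycleQuot R c) (π / 4) α F x =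
      affineOp α (fun x => vkernel (cocycleQuot R c) (π / 4) α x 0) F x := fun α F hF x => by
    rw [kernelOp_eq hΔ le_rfl hF]
    simp only [cut_of_le le_rfl, sub_zero, one_smul, zero_smul, add_zero]
  have h := hc.kernelOp_add_one σ β x
  rw [hK _ _ h1, hK _ _ (WeaklySmoothPer.conjOp_kernelOp hΔ h1 R σ (π / 4) β),
    funext fun x => conjOp_congr (hK β) h1 R σ x, funext (conjOp_affineOp h1 R σ β),
    affineOp_affineOp hω' h1, affineOp_one, affineOp_one] at h
  exact add_left_cancel h

theorem IsSkewCocycle.kernelOp_add {F : ℝ → B} (hF : WeaklySmoothPer F) (θ σ β x : ℝ) :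
    kernelOp (cocycleQuot R c) θ (σ + β) F x =
      kernelOp (cocycleQuot R c) θ σ (conjOp R σ (kernelOp (cocycleQuot R c) θ β) F) x := by
  rcases lt_or_ge θ (π / 4) with hθ | hθ
  · exact hc.kernelOp_add_of_lt hθ hF σ β x
  have hΔ := hc.weaklySmoothBiPer
  have hω : ∀ α, WeaklySmoothPer fun x => vkernel (cocycleQuot R c) (π / 4) α x 0 := fun α =>
    (weaklySmoothBiPer_vkernel hΔ (π / 4) α).left 0
  have hω' : WeaklySmoothPer fun x => R σ (vkernel (cocycleQuot R c) (π / 4) β (x - σ) 0) :=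
    (hω β).rotate R σ (-σ)
  -- Means are unaffected by translation, so internal rotation commutes with the interpolation
  -- towards the mean.
  have hm : R σ (vmean fun x => vkernel (cocycleQuot R c) (π / 4) β x 0) =
      vmean fun x => R σ (vkernel (cocycleQuot R c) (π / 4) β (x - σ) 0) := by
    have e1 := vmean_clm (hω β) (R.clm σ)
    have e2 := vmean_comp_add ((hω β).clm (R.clm σ)) (-σ)
    exact e1.symm.trans e2.symm
  have hT : WeaklySmoothPer fun x =>
      (1 - cut θ) • R σ (vkernel (cocycleQuot R c) (π / 4) β (x - σ) 0) +
      cut θ • vmean fun x => R σ (vkernel (cocycleQuot R c) (π / 4) β (x - σ) 0) :=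
    (hω'.const_smul _).add (WeaklySmoothPer.const _)
  rw [kernelOp_eq hΔ hθ hF, kernelOp_eq hΔ hθ (WeaklySmoothPer.conjOp_kernelOp hΔ hF R σ θ β),
    funext fun x => conjOp_congr (fun F hF x => kernelOp_eq hΔ hθ hF β x) hF R σ x,
    funext (conjOp_affineOp hF R σ β)]
  simp only [map_add, map_smul, hm]
  rw [affineOp_affineOp hT hF, funext (affineComp_interpolate (hω σ) hω' σ β (cut θ))]
  simp only [hc.vkernel_add σ β]

end Cocycle

end Interpolation

/-! ### Return from operators to kernels, and verification of the asserted properties. -/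

section Kernels

theorem integral_cot_half (ε : ℝ) :
    ∫ β in ε..(2 * π - ε), cos (β / 2) / sin (β / 2) = 0 := by
  have h := intervalIntegral.integral_comp_sub_left (a := ε) (b := 2 * π - ε)
    (fun β => cos (β / 2) / sin (β / 2)) (2 * π)
  have e : ∀ β : ℝ, cos ((2 * π - β) / 2) / sin ((2 * π - β) / 2) =
      -(cos (β / 2) / sin (β / 2)) := fun β => by
    rw [show (2 * π - β) / 2 = π - β / 2 by ring, cos_pi_sub, sin_pi_sub, neg_div]
  simp only [e, intervalIntegral.integral_neg, sub_sub_cancel] at h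
  linarith

variable {B : Type*} [Ring B] [Algebra ℝ B] [UniformSpace B] [IsUniformAddGroup B]
  [IsTopologicalRing B] [ContinuousSMul ℝ B] [LocallyConvexSpace ℝ B] [T2Space B]

section CircleIntegral

theorem IsCircleIntegral.eq {F : ℝ → B} {v : B} (h : IsCircleIntegral F v) :
    circleIntegral F = v :=
  eq_of_forall_dual fun l =>
    tendsto_nhds_unique (Classical.epsilon_spec (p := IsCircleIntegral F) ⟨v, h⟩ l) (h l)

variable [SeqComplete B]

/-- Subtracting f 0 removes the pole. The symmetric truncation makes the subtracted term exactly
zero, since the cotangent is odd about π. -/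
theorem isCircleIntegral_cot_add {F f g : ℝ → B} (hf : WeaklySmoothPer f) (hg : WeaklySmooth g)
    (h : ∀ β ∈ Ioo 0 (2 * π), F β = (cos (β / 2) / sin (β / 2)) • f β + g β) :
    IsCircleIntegral F (vhilb f 0 + vmean g) := by
  intro l
  have hk : Continuous fun u => cos (u / 2) * quot (fun x => l (f x)) (0 + u) 0 + l (g u) :=
    (continuous_hilb_integrand_right (hf l) 0).add (hg l).continuous
  set k := fun u => cos (u / 2) * quot (fun x => l (f x)) (0 + u) 0 + l (g u) with hkdef
  have hv : l (vhilb f 0 + vmean g) = (2 * π)⁻¹ * ∫ u in (0 : ℝ)..(2 * π), k u := by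
    rw [map_add, apply_vhilb hf, apply_vmean hg]
    exact (mean_add (continuous_hilb_integrand_right (hf l) 0) (hg l).continuous).symm
  rw [hv]
  have hP : Continuous fun ε : ℝ => (2 * π)⁻¹ * ∫ β in ε..(2 * π - ε), k β := by
    have hprim := intervalIntegral.continuous_primitive (μ := volume)
      (fun a b => hk.intervalIntegrable a b) 0
    have e : ∀ ε : ℝ, ∫ β in ε..(2 * π - ε), k β =
        (∫ β in (0 : ℝ)..(2 * π - ε), k β) - ∫ β in (0 : ℝ)..ε, k β := fun ε =>
      (intervalIntegral.integral_interval_sub_left (hk.intervalIntegrable _ _)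
        (hk.intervalIntegrable _ _)).symm
    simp only [e]
    exact continuous_const.mul ((hprim.comp (by fun_prop : Continuous fun ε : ℝ => 2 * π - ε)).sub
      hprim)
  have hlim := (hP.tendsto 0).mono_left (nhdsWithin_le_nhds (s := Ioi 0))
  rw [sub_zero] at hlim
  refine hlim.congr' ?_
  filter_upwards [Ioo_mem_nhdsGT pi_pos] with ε hε
  congr 1
  have hsub : uIcc ε (2 * π - ε) ⊆ Ioo 0 (2 * π) := by
    rw [uIcc_of_le (by linarith [hε.2])]
    exact fun x hx => ⟨hε.1.trans_le hx.1, hx.2.trans_lt (by linarith [hε.1])⟩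
  have hcot : IntervalIntegrable (fun β => cos (β / 2) / sin (β / 2) * l (f 0)) volume ε
      (2 * π - ε) :=
    (ContinuousOn.mul (ContinuousOn.div (by fun_prop) (by fun_prop)
      fun x hx => (sin_half_pos (hsub hx)).ne') continuousOn_const).intervalIntegrable
  have e : EqOn (fun β => l (F β)) (fun β => k β + cos (β / 2) / sin (β / 2) * l (f 0))
      (uIcc ε (2 * π - ε)) := fun β hβ => by
    have hne := (sin_half_pos (hsub hβ)).ne'
    simp only [h β (hsub hβ), map_add, map_smul, smul_eq_mul, hkdef, quot, zero_add, sub_zero,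
      if_neg hne]
    field_simp
    ring
  rw [intervalIntegral.integral_congr e, intervalIntegral.integral_add
    (hk.intervalIntegrable _ _) hcot, intervalIntegral.integral_mul_const, integral_cot_half,
    zero_mul, add_zero]

theorem IsTest.weaklySmoothPer {f : ℝ → B} (hf : IsTest f) : WeaklySmoothPer f := fun l =>
  ⟨hf.smooth.weaklySmooth l, fun x => congrArg l (hf.periodic x)⟩

theorem Kernel.ofFun_apply {S : ℝ → ℝ → B} {η : ℝ} (hS : WeaklySmooth (S η)) {f : ℝ → B}
    (hf : WeaklySmoothPer f) : Kernel.ofFun S η f = vmean fun β => S η β * f β := by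
  have h := isCircleIntegral_cot_add (F := fun β => S η β * f β) (f := fun _ => 0)
    (WeaklySmoothPer.const 0) (hS.mul hf.weaklySmooth) fun β _ => by simp
  rw [vhilb_const, zero_add] at h
  exact h.eq

theorem Kernel.hilbert_apply (η : ℝ) {f : ℝ → B} (hf : WeaklySmoothPer f) :
    Kernel.hilbert η f = vhilb f 0 := by
  have h := isCircleIntegral_cot_add (F := fun β => (cos (β / 2) / sin (β / 2)) • (1 : B) * f β)
    (g := fun _ => 0) hf (fun l => contDiff_const) fun β _ => by simp
  rw [vmean_const, add_zero] at h
  exact h.eq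

variable {𝒜 : ZMod 2 → Submodule ℝ B} {R : RotationAction 𝒜} {c : ℝ → B}

/-- Division by sin(β/2) splits cosec(β/2) R^η c(β) into cot(β/2) + Δ(η, η + β). -/
theorem IsSkewCocycle.bott_apply (hc : IsSkewCocycle R c) (η : ℝ) {f : ℝ → B}
    (hf : WeaklySmoothPer f) : Kernel.bott R c η f =
      vhilb f 0 + vmean fun β => cocycleQuot R c η (η + β) * f β := by
  have hΔ : WeaklySmooth fun β => cocycleQuot R c η (η + β) :=
    (hc.weaklySmoothBiPer.right η).weaklySmooth.comp (g := fun β : ℝ => η + β) (by fun_prop)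
  refine (isCircleIntegral_cot_add (F := fun β => (sin (β / 2))⁻¹ • R η (c β) * f β) hf
    (hΔ.mul hf.weaklySmooth) fun β hβ => ?_).eq
  have hne := (sin_half_pos hβ).ne'
  have h := hc.sin_smul_cocycleQuot η (η + β)
  rw [add_sub_cancel_left] at h
  rw [eq_add_of_sub_eq h.symm, smul_add, smul_smul, smul_smul, inv_mul_cancel₀ hne, one_smul,
    add_mul, smul_mul_assoc, one_mul, ← div_eq_inv_mul]
  exact add_comm _ _

end CircleIntegral

section DeformedKernel

variable [SeqComplete B] {Δ : ℝ → ℝ → B} (hΔ : WeaklySmoothBiPer Δ)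

/-- The kernel of the operator `kernelOp`. -/
def deformedKernel (Δ : ℝ → ℝ → B) (θ α : ℝ) : Kernel B :=
  fun η f => kernelOp Δ θ α (fun y => f (y - η)) η

theorem WeaklySmoothBiPer.mul_shift (hΦ : WeaklySmoothBiPer Δ) (η : ℝ) {f : ℝ → B}
    (hf : WeaklySmoothPer f) : WeaklySmoothPer fun β => Δ η (η + β) * f β := by
  have h := ((hΦ.mul (hf.comp_sub η)).right η).comp_add η
  simpa only [add_comm _ η, add_sub_cancel_left] using h

theorem weaklySmoothBiPer_const (G : B) : WeaklySmoothBiPer fun _ _ => G := fun _ =>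
  ⟨contDiff_const, fun _ _ => rfl, fun _ _ => rfl⟩

theorem vkernel_const (G : B) (θ α x y : ℝ) :
    vkernel (fun _ _ => G) θ α x y = sin (α / 2) • G :=
  weakRep_eq fun l => by rw [kernelFull_const, map_smul, smul_eq_mul]

theorem vkernel_angle_zero (θ x y : ℝ) : vkernel Δ θ 0 x y = 0 :=
  weakRep_eq fun l => by rw [map_zero, kernelFull_angle_zero]

include hΔ

theorem weaklySmooth_vkernel_add (θ α η : ℝ) :
    WeaklySmooth fun β => vkernel Δ θ α η (η + β) :=
  (weaklySmooth_vkernel hΔ).comp (g := fun β : ℝ => (θ, α, η, η + β)) (by fun_prop)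

theorem deformedKernel_apply (θ α η : ℝ) {f : ℝ → B} (hf : WeaklySmoothPer f) :
    deformedKernel Δ θ α η f = cos (α / 2) • f 0 + sin (α / 2) • vhilb f 0
      + vmean fun β => vkernel Δ θ α η (η + β) * f β := by
  have h1 := vhilb_comp_add hf (-η) η
  have h2 := vmean_comp_add (((weaklySmoothBiPer_vkernel hΔ θ α).mul (hf.comp_sub η)).right η) η
  simp only [add_sub_cancel_right] at h2
  simp only [← sub_eq_add_neg, sub_self] at h1
  unfold deformedKernel kernelOp
  rw [h1, ← h2]
  simp only [sub_self, add_comm η]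

theorem vkernel_clm (T : B →L[ℝ] B) (θ α x y : ℝ) :
    vkernel (fun x y => T (Δ x y)) θ α x y = T (vkernel Δ θ α x y) :=
  weakRep_eq fun l => apply_vkernel hΔ (l.comp T) θ α x y

theorem vkernel_angle (θ α x y : ℝ) :
    vkernel Δ θ (α + 2 * π) x y = -vkernel Δ θ α x y :=
  weakRep_eq fun l => by rw [map_neg, apply_vkernel hΔ, kernelFull_angle (hΔ l)]

theorem vkernel_zero (α x y : ℝ) : vkernel Δ 0 α x y = sin (α / 2) • Δ x y :=
  weakRep_eq fun l => by rw [map_smul, smul_eq_mul, kernelFull_zero (hΔ l)]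

theorem vkernel_pi_div_two (α x y : ℝ) : vkernel Δ (π / 2) α x y = sin (α / 2) • Δ 0 α :=
  weakRep_eq fun l => by rw [map_smul, smul_eq_mul, kernelFull_pi_div_two (hΔ l)]

end DeformedKernel

section Properties

open Kernel

variable [SeqComplete B] {𝒜 : ZMod 2 → Submodule ℝ B} {R : RotationAction 𝒜} {c : ℝ → B}
  (hc : IsSkewCocycle R c)
include hc

theorem IsSkewCocycle.isSmoothKernelFamily [GradedAlgebra 𝒜] :
    IsSmoothKernelFamily 𝒜 fun θ α η β => vkernel (cocycleQuot R c) θ α η (η + β) := by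
  have hΔ := hc.weaklySmoothBiPer
  have hS := weaklySmoothBiPer_vkernel hΔ
  refine ⟨fun θ α η β => ?_, ?_, fun θ α η β => ?_, fun θ α η β => ?_⟩
  -- The construction commutes with R^{2π}, which fixes Δ; being fixed by R^{2π} is evenness.
  · have h := vkernel_clm hΔ (R.clm (2 * π)) θ α η (η + β)
    simp only [RotationAction.clm_apply, hc.apply_two_pi] at h
    exact (R.mem_even_iff _).2 h.symm
  · exact ((weaklySmooth_vkernel hΔ).comp (g := fun p : ℝ × ℝ × ℝ × ℝ =>
      (p.1, p.2.1, p.2.2.1, p.2.2.1 + p.2.2.2)) (by fun_prop)).isSmoothMap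
      SeqComplete.exists_tendsto
  · have h1 := ((hS θ α).right (η + 2 * π)).periodic (η + β)
    have h2 := ((hS θ α).left (η + β)).periodic η
    rw [add_right_comm, h1, h2]
  · rw [← add_assoc]
    exact ((hS θ α).right η).periodic (η + β)

/-- In the coordinates x = η, y = η + β the convolution of kernels is the composition of operators
and `intRot` is `conjOp`, so this is `kernelOp_add`. -/
theorem IsSkewCocycle.deformedKernel_conv (θ α σ : ℝ) :
    (deformedKernel (cocycleQuot R c) θ α).Same ((deformedKernel (cocycleQuot R c) θ σ).conv
      ((deformedKernel (cocycleQuot R c) θ (α - σ)).intRot R σ)) := by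
  intro η f hf
  have h := hc.kernelOp_add (hf.weaklySmoothPer.comp_sub η) θ σ (α - σ) η
  rw [add_sub_cancel] at h
  refine h.trans ?_
  unfold conv intRot extRot deformedKernel
  congr 1
  funext y
  unfold conjOp
  simp only [add_sub_cancel]
  congr 2
  funext z
  congr 2
  ring

theorem IsSkewCocycle.deformedKernel_zero (α : ℝ) :
    (deformedKernel (cocycleQuot R c) 0 α).Same
      (cos (α / 2) • delta + sin (α / 2) • bott R c) := by
  intro η f hf
  have hΔ := hc.weaklySmoothBiPer
  have hf := hf.weaklySmoothPer
  have hm := hΔ.mul_shift η hf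
  rw [deformedKernel_apply hΔ 0 α η hf]
  change _ = cos (α / 2) • f 0 + sin (α / 2) • bott R c η f
  rw [hc.bott_apply η hf]
  simp only [vkernel_zero hΔ, smul_mul_assoc]
  rw [vmean_smul hm, smul_add, add_assoc]

theorem IsSkewCocycle.deformedKernel_pi_div_two (α : ℝ) :
    (deformedKernel (cocycleQuot R c) (π / 2) α).Same
      (cos (α / 2) • (delta - ofFun fun _ _ => (1 : B)) + sin (α / 2) • hilbert
        + ofFun fun _ _ => c α) := by
  intro η f hf
  have hΔ := hc.weaklySmoothBiPer
  have hf := hf.weaklySmoothPer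
  have hconst : ∀ b : B, WeaklySmooth fun _ : ℝ => b := fun b l => contDiff_const
  -- At x = 0 the relation reads sin(α/2) Δ(0, α) = c(α) - cos(α/2), which is the constant kernel
  -- reached at θ = π/2.
  have h := hc.sin_smul_cocycleQuot 0 α
  rw [sub_zero, R.map_zero] at h
  rw [deformedKernel_apply hΔ (π / 2) α η hf]
  change _ = cos (α / 2) • (f 0 - ofFun (fun _ _ => (1 : B)) η f) + sin (α / 2) • hilbert η f
    + ofFun (fun _ _ => c α) η f
  rw [ofFun_apply (hconst _) hf, ofFun_apply (hconst _) hf, hilbert_apply η hf]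
  simp only [vkernel_pi_div_two hΔ, h, vmean_mul_left hf]
  simp only [one_mul, sub_mul, smul_mul_assoc]
  module

theorem IsSkewCocycle.deformedKernel_rotate (γ θ α : ℝ) :
    (deformedKernel (cocycleQuot R fun x => R γ (c x)) θ α).Same
      ((deformedKernel (cocycleQuot R c) θ α).extRot R γ) := by
  intro η f hf
  have hΔ := hc.weaklySmoothBiPer
  have hf := hf.weaklySmoothPer
  have hf' : WeaklySmoothPer fun β => R (-γ) (f β) := hf.clm (R.clm (-γ))
  have hΔ' : WeaklySmoothBiPer fun x y => R.clm γ (cocycleQuot R c x y) := fun l =>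
    hΔ (l.comp (R.clm γ))
  have e1 := vhilb_clm hf (R.clm (-γ)) 0
  have hm := (weaklySmoothBiPer_vkernel hΔ θ α).mul_shift η hf'
  have e2 := vmean_clm hm (R.clm γ)
  simp only [RotationAction.clm_apply, map_mul, R.neg_apply] at e1 e2
  unfold extRot
  rw [show (cocycleQuot R fun x => R γ (c x)) = fun x y => R.clm γ (cocycleQuot R c x y) from
    funext fun x => funext fun y => hc.cocycleQuot_rotate γ x y,
    deformedKernel_apply hΔ' θ α η hf, deformedKernel_apply hΔ θ α η hf', e1]
  simp only [vkernel_clm hΔ]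
  simp only [map_add, map_smul, R.neg_apply, RotationAction.clm_apply]
  rw [e2]

end Properties

section GeneralProperties

open Kernel

variable [SeqComplete B] {Δ : ℝ → ℝ → B}

theorem deformedKernel_same (hΔ : WeaklySmoothBiPer Δ) (θ α : ℝ) :
    (deformedKernel Δ θ α).Same (cos (α / 2) • delta + sin (α / 2) • hilbert
      + ofFun fun η β => vkernel Δ θ α η (η + β)) := by
  intro η f hf
  have hf := hf.weaklySmoothPer
  rw [deformedKernel_apply hΔ θ α η hf]
  change _ = cos (α / 2) • f 0 + sin (α / 2) • hilbert η f
    + ofFun (fun η β => vkernel Δ θ α η (η + β)) η f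
  rw [hilbert_apply η hf, ofFun_apply (weaklySmooth_vkernel_add hΔ θ α η) hf]

theorem deformedKernel_angle (hΔ : WeaklySmoothBiPer Δ) (θ α : ℝ) :
    (deformedKernel Δ θ (α + 2 * π)).Same (-deformedKernel Δ θ α) := by
  intro η f hf
  have hf := hf.weaklySmoothPer
  have hm := (weaklySmoothBiPer_vkernel hΔ θ α).mul_shift η hf
  have h := vmean_smul hm (-1)
  rw [deformedKernel_apply hΔ θ _ η hf]
  change _ = -deformedKernel Δ θ α η f
  rw [deformedKernel_apply hΔ θ _ η hf, add_div, mul_div_cancel_left₀ π (by norm_num : (2 : ℝ) ≠ 0),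
    cos_add_pi, sin_add_pi]
  simp only [neg_smul, one_smul] at h
  simp only [vkernel_angle hΔ, neg_mul, h]
  module

theorem deformedKernel_angle_zero (θ : ℝ) : (deformedKernel Δ θ 0).Same delta := by
  intro η f _
  unfold deformedKernel kernelOp
  simp [vkernel_angle_zero, vmean_const, delta]

theorem deformedKernel_const (G : B) (θ α : ℝ) :
    (deformedKernel (fun _ _ => G) θ α).Same
      (cos (α / 2) • delta + sin (α / 2) • (hilbert + ofFun fun _ _ => G)) := by
  intro η f hf
  have hf := hf.weaklySmoothPer
  rw [deformedKernel_apply (weaklySmoothBiPer_const G) θ α η hf]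
  change _ = cos (α / 2) • f 0 + sin (α / 2) • (hilbert η f + ofFun (fun _ _ => G) η f)
  rw [hilbert_apply η hf, ofFun_apply (fun l => contDiff_const) hf]
  simp only [vkernel_const, vmean_mul_left hf]
  simp only [smul_mul_assoc, smul_add, add_assoc]

end GeneralProperties

end Kernels

end CircleCocycle

end

/-! ### Assembly of the theorem. -/

theorem mainTheorem5 {B : Type*} [Ring B] [Algebra ℝ B] [UniformSpace B] [IsUniformAddGroup B]
    [IsTopologicalRing B] [ContinuousSMul ℝ B] [LocallyConvexSpace ℝ B] [T2Space B]
    (hB : ∀ u : ℕ → B, CauchySeq u → ∃ b, Tendsto u atTop (𝓝 b))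
    (𝒜 : ZMod 2 → Submodule ℝ B) [GradedAlgebra 𝒜]
    (R : CircleCocycle.RotationAction 𝒜) :
    ∃ K : (ℝ → B) → ℝ → ℝ → CircleCocycle.Kernel B,
      (∀ c : ℝ → B, CircleCocycle.IsSkewCocycle R c →
        -- smooth perturbation
        (∃ S : ℝ → ℝ → ℝ → ℝ → B, CircleCocycle.IsSmoothKernelFamily 𝒜 S ∧
          ∀ θ α : ℝ, (K c θ α).Same
            (Real.cos (α / 2) • CircleCocycle.Kernel.delta
              + Real.sin (α / 2) • CircleCocycle.Kernel.hilbert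
              + CircleCocycle.Kernel.ofFun (S θ α))) ∧
        -- skew-periodic cocycle with respect to internal rotations
        (∀ θ α : ℝ, (K c θ (α + 2 * Real.pi)).Same (-K c θ α)) ∧
        (∀ θ : ℝ, (K c θ 0).Same CircleCocycle.Kernel.delta) ∧
        (∀ θ α σ : ℝ, (K c θ α).Same
          ((K c θ σ).conv ((K c θ (α - σ)).intRot R σ))) ∧
        -- the value at `θ = 0`
        (∀ α : ℝ, (K c 0 α).Same
          (Real.cos (α / 2) • CircleCocycle.Kernel.delta
            + Real.sin (α / 2) • CircleCocycle.Kernel.bott R c)) ∧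
        -- the value at `θ = π / 2`
        (∀ α : ℝ, (K c (Real.pi / 2) α).Same
          (Real.cos (α / 2) • (CircleCocycle.Kernel.delta
              - CircleCocycle.Kernel.ofFun fun _ _ => (1 : B))
            + Real.sin (α / 2) • CircleCocycle.Kernel.hilbert
            + CircleCocycle.Kernel.ofFun fun _ _ => c α)) ∧
        -- equivariance with respect to external rotations
        (∀ γ θ α : ℝ, (K (fun x => R γ (c x)) θ α).Same ((K c θ α).extRot R γ))) ∧
      -- linear cocycles
      (∀ G : B, G ∈ 𝒜 0 → G * G = -1 → (∀ α : ℝ, R α G = G) → ∀ θ α : ℝ,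
        (K (fun x => Real.cos (x / 2) • (1 : B) + Real.sin (x / 2) • G) θ α).Same
          (Real.cos (α / 2) • CircleCocycle.Kernel.delta
            + Real.sin (α / 2) • (CircleCocycle.Kernel.hilbert
              + CircleCocycle.Kernel.ofFun fun _ _ => G))) := by
  have : CircleCocycle.SeqComplete B := ⟨hB⟩
  refine ⟨fun c => CircleCocycle.deformedKernel (CircleCocycle.cocycleQuot R c), fun c hc => ?_,
    fun G _ _ hG θ α => ?_⟩
  · have hΔ := hc.weaklySmoothBiPer
    exact ⟨⟨_, hc.isSmoothKernelFamily, CircleCocycle.deformedKernel_same hΔ⟩,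
      CircleCocycle.deformedKernel_angle hΔ, CircleCocycle.deformedKernel_angle_zero,
      hc.deformedKernel_conv, hc.deformedKernel_zero, hc.deformedKernel_pi_div_two,
      hc.deformedKernel_rotate⟩
  -- A linear cocycle has constant two-point function G, and invariance of G under all rotations is
  -- what this needs.
  · have h : CircleCocycle.cocycleQuot R
        (fun x => Real.cos (x / 2) • (1 : B) + Real.sin (x / 2) • G) = fun _ _ => G :=
      funext fun x => funext (CircleCocycle.cocycleQuot_linear hG x)
    beta_reduce
    rw [h]
    exact CircleCocycle.deformedKernel_const G θ α
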